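/- **Setting.** Let $m,n\ge 5$ and let $G$ be the $m\times n$ grid graph, with vertices $(x,y)\in\mathbb Z^2$, $0\le x<m$, $0\le y<n$, and edges between points at distance $1$. A *box* is a unit lattice square; it is a box of $G$ if its four corners are vertices of $G$. Let $H$ be a Hamiltonian cycle of $G$. *Cookies.* Two boxes of $G$ are *$H$-neighbours* if they share an edge that is not in $H$; *$H$-paths* and *$H$-components* (in $G$) are the paths and the connected components for this relation. A *cookie* is an $H$-component lying in the exterior (unbounded) region of $H$; it is *small* if it is a single box and *large* otherwise. A *neck edge* of a cookie is an edge of one of its boxes (its *neck*) that is on the boundary of $G$ and not in $H$. A small cookie is outermost if it is extreme in the horizontal direction (easternmost or westernmost, ties allowed) among all small cookies with a horizontal neck edge, or extreme in the vertical direction among all small cookies with a vertical neck edge, where the cookie itself belongs to the class in question. *Cascades.* A box is *switchable* in a subgraph if it has exactly two edges in the subgraph and they are parallel; *switching* it exchanges its edges with its non-edges. A *move* $X\mapsto Y$ switches a switchable box $X$ of $G$ and then a box $Y$ of $G$ that is switchable afterwards; it is valid if the result is a Hamiltonian cycle of $G$. It is a *neck-shifting flip* if it is valid, $X$ is the neck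 of a large cookie, and $Y$ shares an edge with $X$ and has exactly three edges in the cycle before the move. A *cascade* is a sequence of successive valid moves, each of which either is a neck-shifting flip or creates no new cookie (every neck edge of a cookie after the move was a neck edge of a cookie before it). *Local patterns.* Let $w,u$ be perpendicular lattice unit vectors, and write $[x,y]_p=p+xw+yu$. Call the following sets of edges of $H$, if present: the *leaf at $p$*, formed by the edges of the path $[0,0]_p,[0,1]_p,[1,1]_p,[1,0]_p$; the *$A_0$-type at $p$*, formed by the leaf at $p$ and the edges $[-1,0]_p[0,0]_p$, $[1,0]_p[2,0]_p$; the *$j$-stack at $q$* ($j\ge1$), the union of the $A_0$-types at $q+2iu$, $0\le i<j$; the *$A_1$-type following the leaf at $p$*, formed by the wings $[-1,2]_p[0,2]_p$, $[1,2]_p[2,2]_p$ and the legs $[0,2]_p[0,3]_p[0,4]_p$, $[1,2]_p[1,3]_p[1,4]_p$. The two edges of a leg are the (left, respectively right) *collinear edges of the $A_1$-type*. *Looping fat paths.* Assume that $H$ contains the leaf at $p$ and the $A_1$-type following it, and let $X$ and $Y$ be the boxes with opposite corners $[1,2]_p,[2,3]_p$ and $[-1,2]_p,[0,3]_p$. Let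 $P=P(X,Y)$ be an $H$-path in $G$ from $X$ to $Y$, let $N[P]$ be the set of the boxes of $P$ and their $H$-neighbours in $G$, and let $F$ be the subgraph of $G$ whose vertices are the corners of the boxes of $N[P]$ and whose edges are the edges of these boxes that are in $H$. $F$ is a *looping fat path*, with *end-boxes* $X,Y$, if no cascade of length at most three produces a Hamiltonian cycle containing the edge $[0,2]_p[1,2]_p$. It is *anchored* at an outermost small cookie $C$ if $C$ has corners $[0,0]_q,[1,0]_q,[0,1]_q,[1,1]_q$ (with the same $w,u$, where the two sides of $C$ parallel to $u$ are in $H$ and "outermost" refers to the direction of $w$), $H$ contains the $j$-stack at $q$ for some $j\ge1$, and $p=q+2(j-1)u$. The *shadow* $h(F)$ is the graph with the vertices of $F$, whose edges are those of $F$ together with all edges not in $H$ that are shared by a box in $N[P]$ and a box (of the lattice) not in $N[P]$. *Turns.* Let $d\ge2$, and let $a,b$ be perpendicular lattice unit vectors ($a$ east and $b$ north for a north-east turn). For a lattice point $c$ write $\langle x,y\rangle=c+xa+yb$. A *turn* $T$ of length $d$ of a graph is a subgraph formed by the edge $\langle0,-1\rangle\langle0,0\rangle$, the staircase path $\langle1,0\rangle,\langle1,-1\rangle,\langle2,-1\rangle,\langle2,-2\rangle,\dots,\langle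 d-1,-(d-1)\rangle,\langle d,-(d-1)\rangle$, and the edge $\langle d-1,-d\rangle\langle d,-d\rangle$. Its two *leaves* are the boxes with opposite corners $\langle0,-1\rangle,\langle1,0\rangle$ and $\langle d-1,-d\rangle,\langle d,-d+1\rangle$. It is *admissible* (for $F$) if both leaves are in $N[P]$ and neither is $X$ or $Y$. Its *sector* consists of the vertices $\langle x,y\rangle$ of $G$ with $x\ge0$, $y\ge-d$, $x+y\ge0$. **Statement.** Assume that $H$ has exactly one large cookie, and let $F$ be a looping fat path anchored at an outermost small cookie $C$, with its $j$-stack of $A_0$-types. Then: 1. the edges of $h(F)$ form a Hamiltonian cycle of $h(F)$; 2. the pairs of consecutive collinear edges of $h(F)$ are exactly the two pairs of left and of right collinear edges of the $A_1$-type of $F$; 3. $h(F)$ has an admissible turn; 4. $F$ has an admissible turn whose sector has no vertex in common with the $j$-stack. -/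

import Mathlib

/-! Vertices are points of `ℤ × ℤ`; the box with lower left corner `(k, l)` is represented by `(k, l)`.
A subgraph of the square lattice is given by its set of edges. -/

namespace FatPath

abbrev Vtx := ℤ × ℤ

abbrev Box := ℤ × ℤ

abbrev EdgeSet := Set (Sym2 Vtx)

/-! ### Grid graph, boxes, Hamiltonian cycles -/

/-- The vertices of the `m × n` grid graph `G`. -/
def gridVerts (m n : ℕ) : Set Vtx :=
  {v | 0 ≤ v.1 ∧ v.1 < m ∧ 0 ≤ v.2 ∧ v.2 < n}

/-- The edges of the `m × n` grid graph `G`. -/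
def gridEdges (m n : ℕ) : EdgeSet :=
  {e | ∃ v ∈ gridVerts m n, ∃ v' ∈ gridVerts m n,
    (v' = v + (1, 0) ∨ v' = v + (0, 1)) ∧ e = s(v, v')}

/-- The boxes of `G`. -/
def gridBoxes (m n : ℕ) : Set Box :=
  {B | 0 ≤ B.1 ∧ B.1 + 1 < m ∧ 0 ≤ B.2 ∧ B.2 + 1 < n}

/-- The bottom and top edges of a box. -/
def horEdges (B : Box) : EdgeSet :=
  {s(B, B + (1, 0)), s(B + (0, 1), B + (1, 1))}

/-- The left and right edges of a box. -/
def verEdges (B : Box) : EdgeSet :=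
  {s(B, B + (0, 1)), s(B + (1, 0), B + (1, 1))}

def boxEdges (B : Box) : EdgeSet := horEdges B ∪ verEdges B

def boxVerts (B : Box) : Set Vtx := {B, B + (1, 0), B + (0, 1), B + (1, 1)}

/-- `E` is the edge set of a cycle whose vertex set is `V`. -/
def IsHamCycle (V : Set Vtx) (E : EdgeSet) : Prop :=
  ∃ (v : Vtx) (c : (SimpleGraph.fromEdgeSet E).Walk v v),
    c.IsCycle ∧ {x | x ∈ c.support} = V ∧ {e | e ∈ c.edges} = E

/-- `H` is (the edge set of) a Hamiltonian cycle of the `m × n` grid graph. -/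
def IsGridHamCycle (m n : ℕ) (H : EdgeSet) : Prop :=
  H ⊆ gridEdges m n ∧ IsHamCycle (gridVerts m n) H

/-- The edges that lie on a box of `G` and on a box outside `G`. -/
def IsBoundaryEdge (m n : ℕ) (e : Sym2 Vtx) : Prop :=
  (∃ B ∈ gridBoxes m n, e ∈ boxEdges B) ∧ ∃ B, B ∉ gridBoxes m n ∧ e ∈ boxEdges B

/-! ### Box adjacency across edges that are not in `H`, and cookies -/

/-- Two distinct boxes of the lattice are adjacent if they share an edge that is not in `H`. -/
def latticeBoxGraph (H : EdgeSet) : SimpleGraph Box where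
  Adj B B' := B ≠ B' ∧ ∃ e, e ∈ boxEdges B ∧ e ∈ boxEdges B' ∧ e ∉ H
  symm := ⟨fun _ _ h => ⟨h.1.symm, h.2.imp fun _ he => ⟨he.2.1, he.1, he.2.2⟩⟩⟩
  loopless := ⟨fun _ h => h.1 rfl⟩

/-- The same adjacency, restricted to the boxes of `G`: two boxes of `G` are adjacent here if and
only if they are `H`-neighbours, and the paths of this graph are the `H`-paths in `G`. -/
def boxGraph (m n : ℕ) (H : EdgeSet) : SimpleGraph Box where
  Adj B B' := B ∈ gridBoxes m n ∧ B' ∈ gridBoxes m n ∧ (latticeBoxGraph H).Adj B B'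
  symm := ⟨fun _ _ h => ⟨h.2.1, h.1, h.2.2.symm⟩⟩
  loopless := ⟨fun _ h => (latticeBoxGraph H).irrefl h.2.2⟩

/-- A box lies in the unbounded region of the complement of `H`: it can be joined to a box outside
`G` without crossing an edge of `H`. -/
def InExt (m n : ℕ) (H : EdgeSet) (B : Box) : Prop :=
  ∃ B', B' ∉ gridBoxes m n ∧ (latticeBoxGraph H).Reachable B B'

/-- A cookie: an `H`-component of `G` contained in the exterior of `H`. -/
def IsCookie (m n : ℕ) (H : EdgeSet) (J : Set Box) : Prop :=
  ∃ B ∈ gridBoxes m n, InExt m n H B ∧ J = {B' | (boxGraph m n H).Reachable B B'}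

/-- A large cookie: a cookie with more than one box. -/
def IsLargeCookie (m n : ℕ) (H : EdgeSet) (J : Set Box) : Prop :=
  IsCookie m n H J ∧ J.Nontrivial

/-- `{B}` is a small cookie. -/
def IsSmallCookie (m n : ℕ) (H : EdgeSet) (B : Box) : Prop :=
  IsCookie m n H {B}

/-- `e` is a neck edge of `J`: a boundary edge of `G`, not in `H`, on the box `N` (the neck)
of `J`. -/
def IsNeckEdge (m n : ℕ) (H : EdgeSet) (J : Set Box) (N : Box) (e : Sym2 Vtx) : Prop :=
  N ∈ J ∧ e ∈ boxEdges N ∧ IsBoundaryEdge m n e ∧ e ∉ H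

/-! ### Moves and cascades -/

/-- A box with exactly two edges in `H`, which are parallel to each other. -/
def Switchable (H : EdgeSet) (B : Box) : Prop :=
  boxEdges B ∩ H = horEdges B ∨ boxEdges B ∩ H = verEdges B

/-- A box with exactly three edges in `H`. -/
def IsLeafBox (H : EdgeSet) (B : Box) : Prop := (boxEdges B ∩ H).ncard = 3

/-- The result of switching a switchable box. -/
def switch (H : EdgeSet) (B : Box) : EdgeSet := symmDiff H (boxEdges B)

/-- The double-switch move `X ↦ Y` is available in `H` and produces `H'`. -/
def IsMove (m n : ℕ) (H : EdgeSet) (X Y : Box) (H' : EdgeSet) : Prop :=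
  X ∈ gridBoxes m n ∧ Y ∈ gridBoxes m n ∧ Switchable H X ∧ Switchable (switch H X) Y ∧
    H' = switch (switch H X) Y

/-- The move `X ↦ Y` is a neck-shifting flip: `X` is the neck of a large cookie and `Y` is a leaf
adjacent to `X`. -/
def IsNeckShift (m n : ℕ) (H : EdgeSet) (X Y : Box) : Prop :=
  (∃ J e, IsLargeCookie m n H J ∧ IsNeckEdge m n H J X e) ∧
    X ≠ Y ∧ (∃ e, e ∈ boxEdges X ∧ e ∈ boxEdges Y) ∧ IsLeafBox H Y

/-- Passing from `H` to `H'` creates a new cookie: some cookie of `H'` has a neck edge that is not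
a neck edge of a cookie of `H`. -/
def CreatesCookie (m n : ℕ) (H H' : EdgeSet) : Prop :=
  ∃ J' N' e, IsCookie m n H' J' ∧ IsNeckEdge m n H' J' N' e ∧
    ¬ ∃ J N, IsCookie m n H J ∧ IsNeckEdge m n H J N e

/-- One move of a cascade: it yields a Hamiltonian cycle, and it is a neck-shifting flip or creates
no new cookie. -/
def CascadeStep (m n : ℕ) (H H' : EdgeSet) : Prop :=
  ∃ X Y, IsMove m n H X Y H' ∧ IsGridHamCycle m n H' ∧
    (IsNeckShift m n H X Y ∨ ¬ CreatesCookie m n H H')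

/-- `Cascade m n r H H'`: some cascade of length `r` leads from `H` to `H'`. -/
inductive Cascade (m n : ℕ) : ℕ → EdgeSet → EdgeSet → Prop
  | nil (H : EdgeSet) : Cascade m n 0 H H
  | cons {r : ℕ} {H H' H'' : EdgeSet} :
      CascadeStep m n H H' → Cascade m n r H' H'' → Cascade m n (r + 1) H H''

/-! ### Local frames, leaves, stacks of `A₀`-types, `A₁`-types -/

def IsUnitVec (t : ℤ × ℤ) : Prop := t = (1, 0) ∨ t = (-1, 0) ∨ t = (0, 1) ∨ t = (0, -1)

def dot (x y : ℤ × ℤ) : ℤ := x.1 * y.1 + x.2 * y.2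

/-- Two perpendicular lattice unit vectors. For `w = (1, 0)`, `u = (0, 1)` the objects below are the
northern ones; the other frames give their rotations and reflections. -/
def IsFrame (w u : ℤ × ℤ) : Prop := IsUnitVec w ∧ IsUnitVec u ∧ dot w u = 0

/-- The box with corners `p`, `p + a`, `p + b`, `p + a + b`, for a frame `a`, `b`. -/
def boxAt (p a b : ℤ × ℤ) : Box := (min p.1 (p + a + b).1, min p.2 (p + a + b).2)

/-- The lattice point with coordinates `(x, y)` in the frame `w`, `u` with origin `p`. -/
def pt (p w u : ℤ × ℤ) (x y : ℤ) : Vtx := p + x • w + y • u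

/-- The three edges of the leaf on the box `boxAt p w u`, pointing in the direction `u`. -/
def leafEdges (p w u : ℤ × ℤ) : EdgeSet :=
  {s(pt p w u 0 0, pt p w u 0 1), s(pt p w u 0 1, pt p w u 1 1), s(pt p w u 1 1, pt p w u 1 0)}

/-- The `A₀`-type whose leaf is on the box `boxAt p w u`. -/
def a0Edges (p w u : ℤ × ℤ) : EdgeSet :=
  {s(pt p w u (-1) 0, pt p w u 0 0), s(pt p w u 1 0, pt p w u 2 0)} ∪ leafEdges p w u

/-- The `A₁`-type that follows, in the direction `u`, the leaf on the box `boxAt p w u`. -/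
def a1Edges (p w u : ℤ × ℤ) : EdgeSet :=
  {s(pt p w u (-1) 2, pt p w u 0 2), s(pt p w u 1 2, pt p w u 2 2),
   s(pt p w u 0 2, pt p w u 0 3), s(pt p w u 1 2, pt p w u 1 3),
   s(pt p w u 0 3, pt p w u 0 4), s(pt p w u 1 3, pt p w u 1 4)}

/-- The `j`-stack of `A₀`-types starting at the one with leaf on `boxAt q w u`. -/
def stackEdges (q w u : ℤ × ℤ) (j : ℕ) : EdgeSet :=
  {e | ∃ i : ℕ, i < j ∧ e ∈ a0Edges (q + (2 * (i : ℤ)) • u) w u}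

def stackVerts (q w u : ℤ × ℤ) (j : ℕ) : Set Vtx := {v | ∃ e ∈ stackEdges q w u j, v ∈ e}

/-- The box `B` is a small cookie that opens in the direction `u` or `-u`: its two edges parallel
to `u` are in `H`. -/
def IsSmallCookieAlong (m n : ℕ) (H : EdgeSet) (u : ℤ × ℤ) (B : Box) : Prop :=
  IsSmallCookie m n H B ∧ ∀ e ∈ boxEdges B, (∃ v : Vtx, e = s(v, v + u)) → e ∈ H

/-- `C` is an outermost one among the small cookies that open in the direction `u` or `-u`: it is
extreme in the direction `w` or in the direction `-w`. -/
def IsOutermost (m n : ℕ) (H : EdgeSet) (w u : ℤ × ℤ) (C : Box) : Prop :=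
  IsSmallCookieAlong m n H u C ∧
    ((∀ B, IsSmallCookieAlong m n H u B → dot w B ≤ dot w C) ∨
      (∀ B, IsSmallCookieAlong m n H u B → dot w C ≤ dot w B))

/-! ### Looping fat paths and their shadows -/

/-- The two neighbours of the middle box of the `A₁`-type across its legs. -/
def endBoxX (p w u : ℤ × ℤ) : Box := boxAt (pt p w u 1 2) w u

def endBoxY (p w u : ℤ × ℤ) : Box := boxAt (pt p w u (-1) 2) w u

/-- There is a cascade of length at most three after which the edge joining the inner ends of the
wings of the `A₁`-type lies in the Hamiltonian cycle. -/
def HasShortWeakening (m n : ℕ) (H : EdgeSet) (p w u : ℤ × ℤ) : Prop :=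
  ∃ r H', r ≤ 3 ∧ Cascade m n r H H' ∧ s(pt p w u 0 2, pt p w u 1 2) ∈ H'

/-- `P` is an `H`-path in `G` between the end-boxes of an `A₁`-type that follows the leaf on
`boxAt p w u`, and the subgraph induced by its `H`-neighbourhood is a looping fat path. -/
structure IsLoopingFatPath (m n : ℕ) (H : EdgeSet) (p w u : ℤ × ℤ)
    (P : (boxGraph m n H).Walk (endBoxX p w u) (endBoxY p w u)) : Prop where
  leaf : leafEdges p w u ⊆ H
  follows : a1Edges p w u ⊆ H
  isPath : P.IsPath
  noWeakening : ¬ HasShortWeakening m n H p w u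

/-- The boxes of `N[P]`: the boxes of `P` and their `H`-neighbours. -/
def nbhd {m n : ℕ} {H : EdgeSet} {X Y : Box} (P : (boxGraph m n H).Walk X Y) : Set Box :=
  {Z | Z ∈ P.support ∨ ∃ W ∈ P.support, (boxGraph m n H).Adj W Z}

/-- The vertices of the boxes of `S`; these are the vertices of the subgraph induced by `S` and of
its shadow. -/
def vertsOf (S : Set Box) : Set Vtx := {v | ∃ Z ∈ S, v ∈ boxVerts Z}

/-- The edges of the subgraph induced by `S`. -/
def inducedEdges (H : EdgeSet) (S : Set Box) : EdgeSet := {e | (∃ Z ∈ S, e ∈ boxEdges Z) ∧ e ∈ H}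

/-- The edges, not in `H`, shared by a box in `S` and a box not in `S`. -/
def shadowBorder (H : EdgeSet) (S : Set Box) : EdgeSet :=
  {e | e ∉ H ∧ (∃ Z ∈ S, e ∈ boxEdges Z) ∧ ∃ Z', Z' ∉ S ∧ e ∈ boxEdges Z'}

/-- The edges of the shadow of `S`. -/
def shadowEdges (H : EdgeSet) (S : Set Box) : EdgeSet := inducedEdges H S ∪ shadowBorder H S

/-! ### Turns -/

/-- The edges of the turn of length `d` at the corner `p`. For `a = (1, 0)`, `b = (0, 1)` it is the
north-east turn: the outer edge of its northern leaf, the stairs, which start downward at `p + a`,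
and the outer edge of its eastern leaf. -/
def turnEdges (p a b : ℤ × ℤ) (d : ℕ) : EdgeSet :=
  {s(pt p a b 0 (-1), pt p a b 0 0), s(pt p a b (d - 1) (-d), pt p a b d (-d))} ∪
  {e | ∃ i : ℕ, i + 1 < d ∧
    (e = s(pt p a b (i + 1) (-i), pt p a b (i + 1) (-(i + 1))) ∨
     e = s(pt p a b (i + 1) (-(i + 1)), pt p a b (i + 2) (-(i + 1))))}

/-- The turn is contained in the graph with edge set `E`. -/
def IsTurnOf (E : EdgeSet) (p a b : ℤ × ℤ) (d : ℕ) : Prop :=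
  IsFrame a b ∧ 2 ≤ d ∧ turnEdges p a b d ⊆ E

/-- The two leaves of the turn (for a north-east turn, the northern and the eastern one). -/
def turnLeaf₁ (p a b : ℤ × ℤ) : Box := boxAt (pt p a b 0 (-1)) a b

def turnLeaf₂ (p a b : ℤ × ℤ) (d : ℕ) : Box := boxAt (pt p a b (d - 1) (-d)) a b

/-- Both leaves of the turn are boxes of `S`, and none of them is one of the end-boxes `X`, `Y`. -/
def IsAdmissible (S : Set Box) (X Y : Box) (p a b : ℤ × ℤ) (d : ℕ) : Prop :=
  ∀ L, (L = turnLeaf₁ p a b ∨ L = turnLeaf₂ p a b d) → L ∈ S ∧ L ≠ X ∧ L ≠ Y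

/-- The vertices of the sector of the turn: for a north-east turn, the part of the grid that is
bounded by the closed-up staircase, by the vertical ray upward from `p` and by the horizontal ray
to the right from the lower end of the staircase. -/
def sectorVerts (m n : ℕ) (p a b : ℤ × ℤ) (d : ℕ) : Set Vtx :=
  {v | v ∈ gridVerts m n ∧ ∃ x y : ℤ, v = pt p a b x y ∧ 0 ≤ x ∧ -(d : ℤ) ≤ y ∧ 0 ≤ x + y}

end FatPath

/-! A side of a box is called a *wall* if it is in `H`. By the discrete Jordan curve theorem
(`wall_iff`) a side is a wall exactly if it separates an interior box of `H` from an exterior one,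
and at each vertex of the grid exactly two of the four sides are walls (`corner_rule`). Since `H` is
connected, the graph of `H`-neighbours is a forest (`isAcyclic_boxGraph`). Hence the shadow of a
connected set `S` of boxes, which consists of the sides between boxes in `S` and boxes not in `S`
(`side_mem_shadowEdges`), is a Hamiltonian cycle on the vertices of `S`: by acyclicity it has degree
two everywhere, and it stays connected when `S` grows box by box (`Grown.isHamCycle_shadowEdges`).

The other three assertions rest on one property of the path `P`: no inner box of `P` has walls on two
opposite sides (`IsLoop.not_wall_of_wall`). Let `M` be the box between the legs of the `A₁`-type, so
that `P` joins the two boxes beside `M`. If an inner box `Z` of `P` has two opposite walls and is not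
at the boundary, switching `M` cuts `H` into two cycles, separated by the closed sequence of boxes
formed by `M` and `P`, and switching `Z` joins them again; this valid move creates no cookie and puts
the lower side of `M` into the cycle (`cascadeStep_doubleSwitch`), which is forbidden. A path in the
exterior has no walls on the boundary, so only paths in the interior that run along the boundary
remain. Such a path can only continue along the boundary, around corners of the grid and small
cookies, or else it offers a move as above, if need be after a small cookie has been collected
(`cascadeStep_collect`); so it never ends (`next_of_isHugging`, `next_of_isPassing`). But it does
end, since the end-boxes are far from the boundary: an interior path forces `j ≥ 2`, and then the
degrees at the vertices of the stack leave no other possibility (`IsStack.far`).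

It follows that a straight inner box of `P` has exactly one wall beside the path, a box where `P`
turns has walls on both outer sides, and the boxes of `N[P]` outside `P` are enclosed on both sides
(`IsTight.leaf_walls`). Going through the pairs of adjacent boxes of `N[P]`, one finds that the legs
give the only consecutive collinear edges of the shadow (`IsTight.collinear_iff`). For the turn, take
a box of `P` at which the linear functional `w + u` is maximal. There `P` turns, and from there both
arms descend in staircases until they first go straight, or reach the end-box, where a box of `N[P]`
outside `P` closes the turn (`IsTight.exists_chain`). This box is at least two levels above `M`, so
the sector lies above the whole stack. -/

open SimpleGraph

namespace FatPath

/-! ### Hamiltonian cycles as connected two-regular graphs -/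

section Graph

variable {V : Type*}

/-- A connected component of a finite two-regular graph survives the deletion of an edge. -/
lemma reachable_deleteEdges_of_isCycles {G : SimpleGraph V} {S : Set V} (hS : S.Finite)
    (hadj : ∀ v w, G.Adj v w → v ∈ S) (hc : G.IsCycles) {v w : V} (h : G.Adj v w) :
    (G.deleteEdges {s(v, w)}).Reachable v w := by
  have : Finite S := hS
  have hv := hadj v w h
  have hw := hadj w v h.symm
  have hc' : (G.induce S).IsCycles := by
    rintro ⟨x, hx⟩ ⟨⟨y, hy⟩, hxy⟩
    have h2 := hc (v := x) ⟨y, hxy⟩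
    rw [← h2, ← Set.ncard_image_of_injective _ Subtype.val_injective]
    congr 1
    ext z
    simp only [Set.mem_image, mem_neighborSet, comap_adj, Function.Embedding.subtype_apply,
      Subtype.exists, exists_and_right, exists_eq_right]
    exact ⟨fun ⟨_, h⟩ => h, fun h => ⟨hadj z x h.symm, h⟩⟩
  have hr := hc'.reachable_deleteEdges (v := ⟨v, hv⟩) (w := ⟨w, hw⟩) h
  refine hr.map (G' := G.deleteEdges {s(v, w)}) ⟨Subtype.val, ?_⟩
  rintro ⟨a, ha⟩ ⟨b, hb⟩ hab
  simp only [deleteEdges_adj, comap_adj, Function.Embedding.subtype_apply,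
    Set.mem_singleton_iff, Sym2.eq_iff, Subtype.mk.injEq] at hab ⊢
  exact hab

lemma exists_isCycle_of_isCycles {G : SimpleGraph V} {S : Set V} (hS : S.Finite)
    (hadj : ∀ v w, G.Adj v w → v ∈ S) (hc : G.IsCycles)
    (hconn : ∀ v ∈ S, ∀ w ∈ S, G.Reachable v w) {v w : V} (h : G.Adj v w) :
    ∃ (a : V) (c : G.Walk a a), c.IsCycle ∧ {x | x ∈ c.support} = S ∧
      {e | e ∈ c.edges} = G.edgeSet := by
  classical
  obtain ⟨a, c, hcyc, -⟩ := adj_and_reachable_delete_edges_iff_exists_cycle.mp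
    ⟨h, reachable_deleteEdges_of_isCycles hS hadj hc h⟩
  have key : ∀ x ∈ c.support, ∀ y, G.Adj x y → s(x, y) ∈ c.edges := by
    intro x hx y hxy
    have h1 := hcyc.ncard_neighborSet_toSubgraph_eq_two hx
    have h2 := hc (v := x) ⟨y, hxy⟩
    have hfin : (G.neighborSet x).Finite := Set.finite_of_ncard_ne_zero (by omega)
    have := Set.eq_of_subset_of_ncard_le (c.toSubgraph.neighborSet_subset x) (by omega) hfin
    have hy : y ∈ c.toSubgraph.neighborSet x := by rw [this]; exact hxy
    rw [Subgraph.mem_neighborSet, ← Subgraph.mem_edgeSet, Walk.mem_edges_toSubgraph] at hy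
    exact hy
  have hreach : ∀ x y, G.Reachable x y → x ∈ c.support → y ∈ c.support := by
    rintro x y ⟨p⟩
    induction p with
    | nil => exact id
    | cons h p ih => exact fun hx => ih (c.snd_mem_support_of_mem_edges (key _ hx _ h))
  have haS : a ∈ S := hadj a c.snd (c.adj_snd hcyc.not_nil)
  have hsupp : ∀ x, x ∈ c.support ↔ x ∈ S := by
    intro x
    constructor
    · intro hx
      have h1 := hcyc.ncard_neighborSet_toSubgraph_eq_two hx
      obtain ⟨y, hy⟩ := Set.nonempty_of_ncard_ne_zero (s := c.toSubgraph.neighborSet x) (by omega)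
      exact hadj x y (c.toSubgraph.neighborSet_subset x hy)
    · exact fun hx => hreach a x (hconn a haS x hx) c.start_mem_support
  refine ⟨a, c, hcyc, Set.ext hsupp, Set.ext fun e => ⟨fun he => c.edges_subset_edgeSet he, ?_⟩⟩
  induction e with
  | _ x y => exact fun he => key x ((hsupp x).2 (hadj x y he)) y he

/-- `E` is the edge set of a connected two-regular graph on `S`. -/
structure IsConnTwoRegular (S : Set V) (E : Set (Sym2 V)) : Prop where
  subset : ∀ v w, s(v, w) ∈ E → v ∈ S
  two : ∀ v ∈ S, {w | s(v, w) ∈ E}.ncard = 2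
  irrefl : ∀ v, s(v, v) ∉ E
  conn : ∀ v ∈ S, ∀ w ∈ S, (fromEdgeSet E).Reachable v w

lemma adj_fromEdgeSet_of_irrefl {E : Set (Sym2 V)} (hE : ∀ v, s(v, v) ∉ E) {v w : V} :
    (fromEdgeSet E).Adj v w ↔ s(v, w) ∈ E := by
  rw [fromEdgeSet_adj]
  exact ⟨fun h => h.1, fun h => ⟨h, fun hvw => hE v (hvw ▸ h)⟩⟩

lemma IsConnTwoRegular.neighborSet_eq {S : Set V} {E : Set (Sym2 V)} (h : IsConnTwoRegular S E)
    (v : V) : (fromEdgeSet E).neighborSet v = {w | s(v, w) ∈ E} := by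
  ext w
  exact adj_fromEdgeSet_of_irrefl h.irrefl

lemma IsConnTwoRegular.isCycles {S : Set V} {E : Set (Sym2 V)} (h : IsConnTwoRegular S E) :
    (fromEdgeSet E).IsCycles := by
  rintro v ⟨w, hw⟩
  rw [h.neighborSet_eq] at hw ⊢
  exact h.two v (h.subset v w hw)

lemma IsConnTwoRegular.reachable_diff {S : Set V} {E : Set (Sym2 V)} (h : IsConnTwoRegular S E)
    (hS : S.Finite) {a b : V} (hab : s(a, b) ∈ E) {v w : V} (hv : v ∈ S) (hw : w ∈ S) :
    (fromEdgeSet (E \ {s(a, b)})).Reachable v w := by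
  have h1 := reachable_deleteEdges_of_isCycles hS
    (fun v w hvw => h.subset v w ((adj_fromEdgeSet_of_irrefl h.irrefl).1 hvw)) h.isCycles
    ((adj_fromEdgeSet_of_irrefl h.irrefl).2 hab)
  have h2 : (fromEdgeSet E).deleteEdges {s(a, b)} = fromEdgeSet (E \ {s(a, b)}) := by
    ext x y
    simp only [deleteEdges_adj, fromEdgeSet_adj, Set.mem_sdiff]
    tauto
  rw [h2] at h1
  obtain ⟨p⟩ := h.conn v hv w hw
  clear hv hw
  induction p with
  | nil => exact Reachable.refl _
  | @cons x y z hxy p ih =>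
    refine Reachable.trans ?_ ih
    by_cases he : s(x, y) = s(a, b)
    · rcases Sym2.eq_iff.1 he with ⟨rfl, rfl⟩ | ⟨rfl, rfl⟩
      exacts [h1, h1.symm]
    · refine Adj.reachable ?_
      rw [fromEdgeSet_adj] at hxy ⊢
      exact ⟨⟨hxy.1, he⟩, hxy.2⟩

end Graph

lemma isHamCycle_iff {S : Set Vtx} {E : EdgeSet} (hS : S.Finite) (hne : S.Nonempty) :
    IsHamCycle S E ↔ IsConnTwoRegular S E := by
  constructor
  · rintro ⟨v, c, hc, hs, he⟩
    have hirr : ∀ v, s(v, v) ∉ E := by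
      intro v hv
      exact (c.adj_of_mem_edges ((Set.ext_iff.1 he _).2 hv)).ne rfl
    have hmem : ∀ x y, s(x, y) ∈ E ↔ s(x, y) ∈ c.edges :=
      fun x y => (Set.ext_iff.1 he _).symm
    refine ⟨fun x y h => ?_, fun x hx => ?_, hirr, fun x hx y hy => ?_⟩
    · rw [← hs]
      exact c.fst_mem_support_of_mem_edges ((hmem x y).1 h)
    · rw [← hs] at hx
      rw [← hc.ncard_neighborSet_toSubgraph_eq_two hx]
      congr 1
      ext y
      rw [Subgraph.mem_neighborSet, ← Subgraph.mem_edgeSet, Walk.mem_edges_toSubgraph]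
      exact hmem x y
    · rw [← hs] at hx hy
      classical
      exact (c.takeUntil x hx).reachable.symm.trans (c.takeUntil y hy).reachable
  · intro h
    obtain ⟨x, hx⟩ := hne
    obtain ⟨y, hy⟩ := Set.nonempty_of_ncard_ne_zero (s := {w | s(x, w) ∈ E})
      (by rw [h.two x hx]; omega)
    obtain ⟨a, c, hc, hs, he⟩ := exists_isCycle_of_isCycles (G := fromEdgeSet E) hS
      (fun v w hvw => h.subset v w ((adj_fromEdgeSet_of_irrefl h.irrefl).1 hvw)) h.isCycles h.conn
      ((adj_fromEdgeSet_of_irrefl h.irrefl).2 hy)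
    refine ⟨a, c, hc, hs, he.trans ?_⟩
    ext e
    induction e with
    | _ x y => exact adj_fromEdgeSet_of_irrefl h.irrefl

/-! ### Sides and corners of boxes -/

/-- The side of the box `B` in the direction `t`, shared with the box `B + t`. -/
def side (B : Box) (t : ℤ × ℤ) : Sym2 Vtx :=
  s(B + (max t.1 0, max t.2 0), B + (max t.1 0 + |t.2|, max t.2 0 + |t.1|))

/-- The side of `B` in the direction `t` is in `E`. -/
def Wall (E : EdgeSet) (B : Box) (t : ℤ × ℤ) : Prop := side B t ∈ E

/-- The corner of the box `B` in the direction `a + b`, for a frame `a`, `b`. -/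
def corner (B : Box) (a b : ℤ × ℤ) : Vtx :=
  B + ((1 + a.1 + b.1) / 2, (1 + a.2 + b.2) / 2)

lemma IsUnitVec.neg {t : ℤ × ℤ} (h : IsUnitVec t) : IsUnitVec (-t) := by
  rcases h with rfl | rfl | rfl | rfl <;> simp [IsUnitVec]

lemma IsUnitVec.ne_zero {t : ℤ × ℤ} (h : IsUnitVec t) : t ≠ 0 := by
  rcases h with rfl | rfl | rfl | rfl <;> simp

lemma IsUnitVec.ne_neg {t : ℤ × ℤ} (h : IsUnitVec t) : t ≠ -t := by
  rcases h with rfl | rfl | rfl | rfl <;> simp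

lemma isFrame_cases {a b : ℤ × ℤ} (h : IsFrame a b) :
    (a = (1, 0) ∧ b = (0, 1)) ∨ (a = (1, 0) ∧ b = (0, -1)) ∨
    (a = (-1, 0) ∧ b = (0, 1)) ∨ (a = (-1, 0) ∧ b = (0, -1)) ∨
    (a = (0, 1) ∧ b = (1, 0)) ∨ (a = (0, 1) ∧ b = (-1, 0)) ∨
    (a = (0, -1) ∧ b = (1, 0)) ∨ (a = (0, -1) ∧ b = (-1, 0)) := by
  obtain ⟨h1, h2, h3⟩ := h
  rcases h1 with rfl | rfl | rfl | rfl <;> rcases h2 with rfl | rfl | rfl | rfl <;>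
    simp_all [dot]

lemma IsFrame.left {a b : ℤ × ℤ} (h : IsFrame a b) : IsUnitVec a := h.1

lemma IsFrame.right {a b : ℤ × ℤ} (h : IsFrame a b) : IsUnitVec b := h.2.1

lemma IsFrame.symm {a b : ℤ × ℤ} (h : IsFrame a b) : IsFrame b a := by
  refine ⟨h.2.1, h.1, ?_⟩
  have := h.2.2
  simp only [dot] at this ⊢
  linarith

lemma IsFrame.neg_left {a b : ℤ × ℤ} (h : IsFrame a b) : IsFrame (-a) b := by
  refine ⟨h.1.neg, h.2.1, ?_⟩
  have := h.2.2
  simp only [dot, Prod.fst_neg, Prod.snd_neg] at this ⊢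
  linarith

lemma IsFrame.neg_right {a b : ℤ × ℤ} (h : IsFrame a b) : IsFrame a (-b) := h.symm.neg_left.symm

lemma IsUnitVec.cases_of_isFrame {a b t : ℤ × ℤ} (ht : IsUnitVec t) (h : IsFrame a b) :
    t = a ∨ t = -a ∨ t = b ∨ t = -b := by
  rcases isFrame_cases h with ⟨rfl, rfl⟩ | ⟨rfl, rfl⟩ | ⟨rfl, rfl⟩ | ⟨rfl, rfl⟩ | ⟨rfl, rfl⟩ |
    ⟨rfl, rfl⟩ | ⟨rfl, rfl⟩ | ⟨rfl, rfl⟩ <;> rcases ht with rfl | rfl | rfl | rfl <;> simp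

lemma IsUnitVec.exists_isFrame {a : ℤ × ℤ} (h : IsUnitVec a) : ∃ b, IsFrame a b := by
  rcases h with rfl | rfl | rfl | rfl
  · exact ⟨(0, 1), by simp [IsFrame, IsUnitVec, dot]⟩
  · exact ⟨(0, 1), by simp [IsFrame, IsUnitVec, dot]⟩
  · exact ⟨(1, 0), by simp [IsFrame, IsUnitVec, dot]⟩
  · exact ⟨(1, 0), by simp [IsFrame, IsUnitVec, dot]⟩

/-- Two unit vectors are equal, opposite or perpendicular. -/
lemma IsUnitVec.trichotomy {a b : ℤ × ℤ} (ha : IsUnitVec a) (hb : IsUnitVec b) :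
    b = a ∨ b = -a ∨ IsFrame a b := by
  rcases ha with rfl | rfl | rfl | rfl <;> rcases hb with rfl | rfl | rfl | rfl <;>
    simp [IsFrame, IsUnitVec, dot]

lemma IsFrame.ne {a b : ℤ × ℤ} (h : IsFrame a b) : a ≠ b := by
  rcases isFrame_cases h with ⟨rfl, rfl⟩ | ⟨rfl, rfl⟩ | ⟨rfl, rfl⟩ | ⟨rfl, rfl⟩ | ⟨rfl, rfl⟩ |
    ⟨rfl, rfl⟩ | ⟨rfl, rfl⟩ | ⟨rfl, rfl⟩ <;> simp

lemma IsFrame.ne_neg {a b : ℤ × ℤ} (h : IsFrame a b) : a ≠ -b := h.neg_right.ne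

lemma side_neg {t : ℤ × ℤ} (ht : IsUnitVec t) (B : Box) : side (B + t) (-t) = side B t := by
  obtain ⟨x, y⟩ := B
  rcases ht with rfl | rfl | rfl | rfl <;> simp [side]

lemma wall_neg {t : ℤ × ℤ} (ht : IsUnitVec t) {E : EdgeSet} {B : Box} :
    Wall E (B + t) (-t) ↔ Wall E B t := by
  rw [Wall, side_neg ht, Wall]

lemma side_eq_side {t t' : ℤ × ℤ} (ht : IsUnitVec t) (ht' : IsUnitVec t') {B B' : Box} :
    side B t = side B' t' ↔ (B' = B ∧ t' = t) ∨ (B' = B + t ∧ t' = -t) := by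
  obtain ⟨x, y⟩ := B
  obtain ⟨x', y'⟩ := B'
  rcases ht with rfl | rfl | rfl | rfl <;> rcases ht' with rfl | rfl | rfl | rfl <;>
    simp [side] <;> omega

lemma mem_boxEdges {B : Box} {e : Sym2 Vtx} :
    e ∈ boxEdges B ↔ ∃ t, IsUnitVec t ∧ e = side B t := by
  obtain ⟨x, y⟩ := B
  simp only [boxEdges, horEdges, verEdges, Set.mem_union, Set.mem_insert_iff,
    Set.mem_singleton_iff]
  constructor
  · rintro ((rfl | rfl) | (rfl | rfl))
    · exact ⟨(0, -1), by simp [IsUnitVec], by simp [side]⟩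
    · exact ⟨(0, 1), by simp [IsUnitVec], by simp [side]⟩
    · exact ⟨(-1, 0), by simp [IsUnitVec], by simp [side]⟩
    · exact ⟨(1, 0), by simp [IsUnitVec], by simp [side]⟩
  · rintro ⟨t, rfl | rfl | rfl | rfl, rfl⟩ <;> simp [side]

lemma side_mem_boxEdges {t : ℤ × ℤ} (ht : IsUnitVec t) {B K : Box} :
    side B t ∈ boxEdges K ↔ K = B ∨ K = B + t := by
  rw [mem_boxEdges]
  constructor
  · rintro ⟨t', ht', h⟩
    rcases (side_eq_side ht ht').1 h with h | h
    exacts [Or.inl h.1, Or.inr h.1]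
  · rintro (rfl | rfl)
    · exact ⟨t, ht, rfl⟩
    · exact ⟨-t, ht.neg, (side_neg ht B).symm⟩

lemma exists_eq_corner {a b : ℤ × ℤ} (v : Vtx) : ∃ B, v = corner B a b :=
  ⟨v - ((1 + a.1 + b.1) / 2, (1 + a.2 + b.2) / 2), by simp [corner]⟩

lemma corner_symm (B : Box) (a b : ℤ × ℤ) : corner B a b = corner B b a := by
  simp only [corner, add_assoc, add_comm a.1, add_comm a.2]

section Corner

variable {a b : ℤ × ℤ}

lemma side_eq_corner (h : IsFrame a b) (B : Box) :
    side B a = s(corner B a b, corner B a b - b) := by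
  obtain ⟨x, y⟩ := B
  rcases isFrame_cases h with ⟨rfl, rfl⟩ | ⟨rfl, rfl⟩ | ⟨rfl, rfl⟩ | ⟨rfl, rfl⟩ | ⟨rfl, rfl⟩ |
    ⟨rfl, rfl⟩ | ⟨rfl, rfl⟩ | ⟨rfl, rfl⟩ <;> simp [side, corner]

lemma corner_add_neg (h : IsFrame a b) (B : Box) : corner (B + b) a (-b) = corner B a b := by
  obtain ⟨x, y⟩ := B
  rcases isFrame_cases h with ⟨rfl, rfl⟩ | ⟨rfl, rfl⟩ | ⟨rfl, rfl⟩ | ⟨rfl, rfl⟩ | ⟨rfl, rfl⟩ |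
    ⟨rfl, rfl⟩ | ⟨rfl, rfl⟩ | ⟨rfl, rfl⟩ <;> simp [corner]

lemma corner_neg (h : IsFrame a b) (B : Box) : corner B a (-b) = corner B a b - b := by
  obtain ⟨x, y⟩ := B
  rcases isFrame_cases h with ⟨rfl, rfl⟩ | ⟨rfl, rfl⟩ | ⟨rfl, rfl⟩ | ⟨rfl, rfl⟩ | ⟨rfl, rfl⟩ |
    ⟨rfl, rfl⟩ | ⟨rfl, rfl⟩ | ⟨rfl, rfl⟩ <;> simp [corner]

lemma side_eq_corner' (h : IsFrame a b) (B : Box) :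
    side B a = s(corner B a b, corner B a (-b)) := by
  rw [corner_neg h, side_eq_corner h]

lemma side_add_eq_corner (h : IsFrame a b) (B : Box) :
    side (B + b) a = s(corner B a b, corner B a b + b) := by
  rw [side_eq_corner h.neg_right (B + b), corner_add_neg h, sub_neg_eq_add]

lemma mem_boxVerts (h : IsFrame a b) {B : Box} {v : Vtx} :
    v ∈ boxVerts B ↔
      v = corner B a b ∨ v = corner B a (-b) ∨ v = corner B (-a) b ∨ v = corner B (-a) (-b) := by
  obtain ⟨x, y⟩ := B
  rcases isFrame_cases h with ⟨rfl, rfl⟩ | ⟨rfl, rfl⟩ | ⟨rfl, rfl⟩ | ⟨rfl, rfl⟩ | ⟨rfl, rfl⟩ |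
    ⟨rfl, rfl⟩ | ⟨rfl, rfl⟩ | ⟨rfl, rfl⟩ <;> simp [boxVerts, corner] <;> tauto

lemma corner_mem_boxVerts (h : IsFrame a b) (B : Box) : corner B a b ∈ boxVerts B :=
  (mem_boxVerts h).2 (Or.inl rfl)

/-- The four boxes around the vertex `corner B a b`. -/
lemma corner_mem_boxVerts_iff (h : IsFrame a b) {B B' : Box} :
    corner B a b ∈ boxVerts B' ↔ B' = B ∨ B' = B + a ∨ B' = B + b ∨ B' = B + a + b := by
  obtain ⟨x, y⟩ := B
  obtain ⟨x', y'⟩ := B'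
  rcases isFrame_cases h with ⟨rfl, rfl⟩ | ⟨rfl, rfl⟩ | ⟨rfl, rfl⟩ | ⟨rfl, rfl⟩ | ⟨rfl, rfl⟩ |
    ⟨rfl, rfl⟩ | ⟨rfl, rfl⟩ | ⟨rfl, rfl⟩ <;> simp [boxVerts, corner] <;> omega

end Corner

/-! ### Degrees -/

open Classical in
/-- The indicator of a proposition. -/
noncomputable def ind (p : Prop) : ℕ := if p then 1 else 0

@[simp] lemma ind_of_true {p : Prop} (h : p) : ind p = 1 := by simp [ind, h]

@[simp] lemma ind_of_false {p : Prop} (h : ¬p) : ind p = 0 := by simp [ind, h]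

lemma ind_le_one (p : Prop) : ind p ≤ 1 := by by_cases h : p <;> simp [h]

/-- The number of edges of `E` at `v`, for a set `E` of lattice edges. -/
noncomputable def deg (E : EdgeSet) (v : Vtx) : ℕ :=
  ind (s(v, v + (1, 0)) ∈ E) + ind (s(v, v + (-1, 0)) ∈ E) + ind (s(v, v + (0, 1)) ∈ E) +
    ind (s(v, v + (0, -1)) ∈ E)

/-- All edges in `E` are edges of the square lattice. -/
def IsLattice (E : EdgeSet) : Prop := ∀ v w, s(v, w) ∈ E → IsUnitVec (w - v)

lemma ncard_eq_deg {E : EdgeSet} (hE : IsLattice E) (v : Vtx) : {w | s(v, w) ∈ E}.ncard = deg E v := by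
  classical
  have h : {w | s(v, w) ∈ E} = ((({v + (1, 0), v + (-1, 0), v + (0, 1), v + (0, -1)} : Finset Vtx).filter
      (fun w => s(v, w) ∈ E) : Finset Vtx) : Set Vtx) := by
    ext w
    simp only [Set.mem_ofPred_eq, Finset.coe_filter, Finset.mem_insert, Finset.mem_singleton]
    refine ⟨fun h => ⟨?_, h⟩, fun h => h.2⟩
    rcases hE v w h with h | h | h | h <;> rw [sub_eq_iff_eq_add'] at h <;> simp [h]
  rw [h, Set.ncard_coe_finset, Finset.card_filter, Finset.sum_insert, Finset.sum_insert,
    Finset.sum_insert, Finset.sum_singleton, deg]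
  · simp only [ind]; ring
  all_goals simp

lemma deg_frame {a b : ℤ × ℤ} (h : IsFrame a b) (E : EdgeSet) (v : Vtx) :
    deg E v = ind (s(v, v - b) ∈ E) + ind (s(v, v - a) ∈ E) + ind (s(v, v + a) ∈ E) +
      ind (s(v, v + b) ∈ E) := by
  rcases isFrame_cases h with ⟨rfl, rfl⟩ | ⟨rfl, rfl⟩ | ⟨rfl, rfl⟩ | ⟨rfl, rfl⟩ | ⟨rfl, rfl⟩ |
    ⟨rfl, rfl⟩ | ⟨rfl, rfl⟩ | ⟨rfl, rfl⟩ <;> simp [deg, sub_eq_add_neg] <;> omega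

lemma deg_corner {a b : ℤ × ℤ} (h : IsFrame a b) (E : EdgeSet) (B : Box) :
    deg E (corner B a b) = ind (Wall E B a) + ind (Wall E B b) + ind (Wall E (B + a) b) +
      ind (Wall E (B + b) a) := by
  rw [deg_frame h, Wall, Wall, Wall, Wall, side_eq_corner h, side_add_eq_corner h,
    side_eq_corner h.symm, side_add_eq_corner h.symm, corner_symm B b a]

/-! ### The grid -/

section Grid

variable {m n : ℕ}

lemma corner_mem_gridVerts {B : Box} (hB : B ∈ gridBoxes m n) {a b : ℤ × ℤ} (h : IsFrame a b) :
    corner B a b ∈ gridVerts m n := by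
  obtain ⟨x, y⟩ := B
  rcases isFrame_cases h with ⟨rfl, rfl⟩ | ⟨rfl, rfl⟩ | ⟨rfl, rfl⟩ | ⟨rfl, rfl⟩ | ⟨rfl, rfl⟩ |
    ⟨rfl, rfl⟩ | ⟨rfl, rfl⟩ | ⟨rfl, rfl⟩ <;> simp [gridBoxes, gridVerts, corner] at hB ⊢ <;> omega

/-- The grid is a rectangle: a box is in it if its two neighbours at a corner and the box opposite
are. -/
lemma gridBoxes_rect {B : Box} {a b : ℤ × ℤ} (h : IsFrame a b) (ha : B + a ∈ gridBoxes m n)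
    (hb : B + b ∈ gridBoxes m n) : B ∈ gridBoxes m n ∧ B + a + b ∈ gridBoxes m n := by
  obtain ⟨x, y⟩ := B
  rcases isFrame_cases h with ⟨rfl, rfl⟩ | ⟨rfl, rfl⟩ | ⟨rfl, rfl⟩ | ⟨rfl, rfl⟩ | ⟨rfl, rfl⟩ |
    ⟨rfl, rfl⟩ | ⟨rfl, rfl⟩ | ⟨rfl, rfl⟩ <;> simp [gridBoxes] at ha hb ⊢ <;> omega

lemma isLattice_of_subset {H : EdgeSet} (hH : H ⊆ gridEdges m n) : IsLattice H := by
  intro v w h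
  obtain ⟨x, -, y, -, hxy, he⟩ := hH h
  rcases Sym2.eq_iff.1 he with ⟨rfl, rfl⟩ | ⟨rfl, rfl⟩ <;> rcases hxy with rfl | rfl <;>
    simp [IsUnitVec]

lemma mem_gridEdges {v t : ℤ × ℤ} (ht : IsUnitVec t) :
    s(v, v + t) ∈ gridEdges m n ↔ v ∈ gridVerts m n ∧ v + t ∈ gridVerts m n := by
  constructor
  · rintro ⟨x, hx, y, hy, hxy, he⟩
    rcases Sym2.eq_iff.1 he with ⟨rfl, rfl⟩ | ⟨rfl, rfl⟩
    exacts [⟨hx, hy⟩, ⟨hy, hx⟩]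
  · rintro ⟨h1, h2⟩
    rcases ht with rfl | rfl | rfl | rfl
    · exact ⟨v, h1, _, h2, Or.inl rfl, rfl⟩
    · exact ⟨_, h2, v, h1, Or.inl (by simp [add_assoc]), Sym2.eq_swap⟩
    · exact ⟨v, h1, _, h2, Or.inr rfl, rfl⟩
    · exact ⟨_, h2, v, h1, Or.inr (by simp [add_assoc]), Sym2.eq_swap⟩

lemma mem_gridVerts_of_mem {H : EdgeSet} (hH : H ⊆ gridEdges m n) {v w : Vtx} (h : s(v, w) ∈ H) :
    v ∈ gridVerts m n := by
  obtain ⟨x, hx, y, hy, -, he⟩ := hH h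
  rcases Sym2.eq_iff.1 he with ⟨rfl, rfl⟩ | ⟨rfl, rfl⟩
  exacts [hx, hy]

lemma side_mem_gridEdges {B : Box} (hB : B ∈ gridBoxes m n) {t : ℤ × ℤ} (ht : IsUnitVec t) :
    side B t ∈ gridEdges m n := by
  obtain ⟨b, hb⟩ := ht.exists_isFrame
  rw [side_eq_corner hb, sub_eq_add_neg, mem_gridEdges hb.right.neg, ← sub_eq_add_neg,
    ← corner_neg hb]
  exact ⟨corner_mem_gridVerts hB hb, corner_mem_gridVerts hB hb.neg_right⟩

lemma finite_gridVerts (m n : ℕ) : (gridVerts m n).Finite := by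
  refine ((Set.finite_Ico (0 : ℤ) m).prod (Set.finite_Ico (0 : ℤ) n)).subset ?_
  rintro ⟨x, y⟩ ⟨h1, h2, h3, h4⟩
  exact ⟨⟨h1, h2⟩, ⟨h3, h4⟩⟩

/-- A Hamiltonian cycle of the grid is the same as a connected two-regular spanning subgraph. -/
lemma isGridHamCycle_iff (hm : 0 < m) (hn : 0 < n) {H : EdgeSet} :
    IsGridHamCycle m n H ↔ H ⊆ gridEdges m n ∧ (∀ v ∈ gridVerts m n, deg H v = 2) ∧
      ∀ v ∈ gridVerts m n, ∀ w ∈ gridVerts m n, (fromEdgeSet H).Reachable v w := by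
  have hne : (gridVerts m n).Nonempty := ⟨(0, 0), by simp [gridVerts]; omega⟩
  rw [IsGridHamCycle, isHamCycle_iff (finite_gridVerts m n) hne]
  refine and_congr_right fun hH => ⟨fun h => ⟨fun v hv => ?_, h.conn⟩, fun h => ⟨?_, ?_, ?_, h.2⟩⟩
  · rw [← ncard_eq_deg (isLattice_of_subset hH), h.two v hv]
  · exact fun v w h => mem_gridVerts_of_mem hH h
  · intro v hv
    rw [ncard_eq_deg (isLattice_of_subset hH), h.1 v hv]
  · intro v hv
    simpa using (isLattice_of_subset hH v v hv).ne_zero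

end Grid

section Grid

variable {m n : ℕ} {H : EdgeSet}

lemma IsGridHamCycle.deg_eq_two (hH : IsGridHamCycle m n H) {v : Vtx} (hv : v ∈ gridVerts m n) :
    deg H v = 2 := by
  have h := hv
  simp only [gridVerts, Set.mem_ofPred_eq] at h
  exact ((isGridHamCycle_iff (by omega) (by omega)).1 hH).2.1 v hv

lemma IsGridHamCycle.reachable (hH : IsGridHamCycle m n H) {v w : Vtx} (hv : v ∈ gridVerts m n)
    (hw : w ∈ gridVerts m n) : (fromEdgeSet H).Reachable v w := by
  have h := hv
  simp only [gridVerts, Set.mem_ofPred_eq] at h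
  exact ((isGridHamCycle_iff (by omega) (by omega)).1 hH).2.2 v hv w hw

lemma deg_eq_zero (hH : H ⊆ gridEdges m n) {v : Vtx} (hv : v ∉ gridVerts m n) : deg H v = 0 := by
  have h : ∀ w, s(v, w) ∉ H := fun w hw => hv (mem_gridVerts_of_mem hH hw)
  simp [deg, h]

/-! ### The rules at the corners of a box -/

section CornerRules

variable {B : Box} {a b : ℤ × ℤ} (hH : IsGridHamCycle m n H) (hB : B ∈ gridBoxes m n)
  (hab : IsFrame a b)

include hH hB hab

/-- Exactly two of the four sides that meet at a vertex of the grid are walls. -/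
lemma corner_rule : ind (Wall H B a) + ind (Wall H B b) + ind (Wall H (B + a) b) +
    ind (Wall H (B + b) a) = 2 := by
  rw [← deg_corner hab]
  exact hH.deg_eq_two (corner_mem_gridVerts hB hab)

lemma corner_of_not_of_not (ha : ¬Wall H B a) (hb : ¬Wall H B b) :
    Wall H (B + a) b ∧ Wall H (B + b) a := by
  have h := corner_rule hH hB hab
  rw [ind_of_false ha, ind_of_false hb] at h
  constructor <;> by_contra hc <;> rw [ind_of_false hc] at h
  · have := ind_le_one (Wall H (B + b) a); omega
  · have := ind_le_one (Wall H (B + a) b); omega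

lemma corner_of_of (ha : Wall H B a) (hb : Wall H B b) :
    ¬Wall H (B + a) b ∧ ¬Wall H (B + b) a := by
  have h := corner_rule hH hB hab
  rw [ind_of_true ha, ind_of_true hb] at h
  constructor <;> intro hc <;> rw [ind_of_true hc] at h <;> omega

lemma corner_of_of_not (ha : Wall H B a) (hb : ¬Wall H B b) :
    Wall H (B + a) b ↔ ¬Wall H (B + b) a := by
  have h := corner_rule hH hB hab
  rw [ind_of_true ha, ind_of_false hb] at h
  by_cases h1 : Wall H (B + a) b <;> by_cases h2 : Wall H (B + b) a <;> simp [h1, h2] at h ⊢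

end CornerRules

/-! ### The two sides of a Hamiltonian cycle -/

/-- The parity of the number of edges of `H` crossed by the horizontal ray from the box `B` to the
left. -/
noncomputable def colour (H : EdgeSet) (B : Box) : ZMod 2 :=
  ∑ i ∈ Finset.range (B.1 + 1).toNat, (ind (s(((i : ℤ), B.2), ((i : ℤ), B.2 + 1)) ∈ H) : ZMod 2)

/-- The boxes in the interior of `H`. -/
def interiorBoxes (H : EdgeSet) : Set Box := {B | colour H B ≠ 0}

lemma not_mem_of_fst_neg (hH : H ⊆ gridEdges m n) {x y : ℤ} {w : Vtx} (hx : x < 0) :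
    s((x, y), w) ∉ H := by
  intro h
  have := mem_gridVerts_of_mem hH h
  simp only [gridVerts, Set.mem_ofPred_eq] at this
  omega

lemma colour_left (hH : H ⊆ gridEdges m n) (k l : ℤ) :
    colour H (k, l) = colour H (k - 1, l) + (ind (s((k, l), (k, l + 1)) ∈ H) : ZMod 2) := by
  unfold colour
  rcases lt_or_ge k 0 with hk | hk
  · rw [ind_of_false (not_mem_of_fst_neg hH hk)]
    simp only [sub_add_cancel]
    rw [Int.toNat_of_nonpos (by omega), Int.toNat_of_nonpos (by omega)]
    simp
  · simp only [sub_add_cancel]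
    obtain ⟨k, rfl⟩ := Int.eq_ofNat_of_zero_le hk
    rw [show ((k : ℤ) + 1).toNat = k + 1 by omega, Finset.sum_range_succ]
    simp

lemma colour_neg {k : ℤ} (l : ℤ) (hk : k < 0) : colour H (k, l) = 0 := by
  unfold colour
  rw [Int.toNat_of_nonpos (by simp; omega)]
  simp

lemma even_deg (hH : IsGridHamCycle m n H) (v : Vtx) : (deg H v : ZMod 2) = 0 := by
  by_cases hv : v ∈ gridVerts m n
  · rw [hH.deg_eq_two hv]; rfl
  · rw [deg_eq_zero hH.1 hv]; rfl

lemma colour_down (hH : IsGridHamCycle m n H) (k l : ℤ) :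
    colour H (k, l) = colour H (k, l - 1) + (ind (s((k, l), (k + 1, l)) ∈ H) : ZMod 2) := by
  rcases lt_or_ge k 0 with hk | hk
  · rw [ind_of_false (not_mem_of_fst_neg hH.1 hk), colour_neg _ hk, colour_neg _ hk]
    simp
  · obtain ⟨k, rfl⟩ := Int.eq_ofNat_of_zero_le hk
    have step : ∀ k : ℤ, colour H (k - 1, l) = colour H (k - 1, l - 1) +
        (ind (s((k - 1, l), (k, l)) ∈ H) : ZMod 2) →
        colour H (k, l) = colour H (k, l - 1) + (ind (s((k, l), (k + 1, l)) ∈ H) : ZMod 2) := by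
      intro k ih
      rw [colour_left hH.1 k l, colour_left hH.1 k (l - 1), ih]
      have h := even_deg hH (k, l)
      simp only [deg, Prod.mk_add_mk, add_zero, Nat.cast_add, sub_add_cancel] at h ⊢
      rw [show s((k - 1, l), (k, l)) = s((k, l), (k + -1, l)) by rw [Sym2.eq_swap, sub_eq_add_neg],
        show s((k, l - 1), (k, l)) = s((k, l), (k, l + -1)) by rw [Sym2.eq_swap, sub_eq_add_neg]]
      linear_combination h - CharTwo.two_eq_zero (R := ZMod 2) *
        (ind (s((k, l), (k + 1, l)) ∈ H) + ind (s((k, l), (k, l + -1)) ∈ H) : ZMod 2)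
    induction k with
    | zero =>
      apply step
      rw [ind_of_false (not_mem_of_fst_neg hH.1 (by omega)), colour_neg _ (by omega),
        colour_neg _ (by omega)]
      simp
    | succ k ih =>
      apply step
      have := ih (by omega)
      push_cast
      rw [add_sub_cancel_right]
      exact this

lemma colour_eq_zero_of_row (hH : H ⊆ gridEdges m n) {k l : ℤ} (hl : l < 0 ∨ (n : ℤ) ≤ l + 1) :
    colour H (k, l) = 0 := by
  unfold colour
  refine Finset.sum_eq_zero fun i _ => ?_
  rw [ind_of_false, Nat.cast_zero]
  intro h
  have h1 := mem_gridVerts_of_mem hH h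
  rw [Sym2.eq_swap] at h
  have h2 := mem_gridVerts_of_mem hH h
  simp only [gridVerts, Set.mem_ofPred_eq] at h1 h2
  omega

lemma colour_eq_zero (hH : IsGridHamCycle m n H) {B : Box} (hB : B ∉ gridBoxes m n) :
    colour H B = 0 := by
  obtain ⟨k, l⟩ := B
  rcases lt_or_ge k 0 with hk | hk
  · exact colour_neg _ hk
  rcases lt_or_ge l 0 with hl | hl
  · exact colour_eq_zero_of_row hH.1 (Or.inl hl)
  rcases le_or_gt (n : ℤ) (l + 1) with hl' | hl'
  · exact colour_eq_zero_of_row hH.1 (Or.inr hl')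
  have hk' : (m : ℤ) ≤ k + 1 := by
    by_contra hc
    exact hB ⟨hk, by simp only; omega, hl, by simp only; omega⟩
  obtain ⟨l, rfl⟩ := Int.eq_ofNat_of_zero_le hl
  clear hl hl' hB
  have hE : ∀ y : ℤ, s((k, y), (k + 1, y)) ∉ H := by
    intro y h
    rw [Sym2.eq_swap] at h
    have := mem_gridVerts_of_mem hH.1 h
    simp only [gridVerts, Set.mem_ofPred_eq] at this
    omega
  induction l with
  | zero =>
    rw [colour_down hH, ind_of_false (hE _), colour_eq_zero_of_row hH.1 (by omega)]
    simp
  | succ l ih =>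
    rw [colour_down hH, ind_of_false (hE _)]
    push_cast
    rw [add_sub_cancel_right, ih]
    simp

lemma mem_gridBoxes_of_mem_interior (hH : IsGridHamCycle m n H) {B : Box} (hB : B ∈ interiorBoxes H) :
    B ∈ gridBoxes m n := by
  by_contra h
  exact hB (colour_eq_zero hH h)

/-- Discrete Jordan curve theorem: a side of a box is in `H` if and only if exactly one of the two
boxes at this side is in the interior of `H`. -/
lemma wall_iff (hH : IsGridHamCycle m n H) {B : Box} {t : ℤ × ℤ} (ht : IsUnitVec t) :
    Wall H B t ↔ ¬(B ∈ interiorBoxes H ↔ B + t ∈ interiorBoxes H) := by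
  have key : ∀ (B : Box) (t : ℤ × ℤ), colour H (B + t) = colour H B + (ind (Wall H B t) : ZMod 2) →
      (Wall H B t ↔ ¬(B ∈ interiorBoxes H ↔ B + t ∈ interiorBoxes H)) := by
    intro B t h
    simp only [interiorBoxes, Set.mem_ofPred_eq]
    rw [h]
    by_cases hw : Wall H B t
    · simp only [hw, ind_of_true, Nat.cast_one, true_iff]
      generalize colour H B = c
      revert c
      decide
    · simp [hw]
  have key' : ∀ (B : Box) (t : ℤ × ℤ), IsUnitVec t →
      colour H B = colour H (B + t) + (ind (Wall H B t) : ZMod 2) →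
      (Wall H B t ↔ ¬(B ∈ interiorBoxes H ↔ B + t ∈ interiorBoxes H)) := by
    intro B t ht h
    have h1 := key (B + t) (-t)
    simp only [add_neg_cancel_right, wall_neg ht] at h1
    rw [h1 h]
    tauto
  obtain ⟨k, l⟩ := B
  rcases ht with rfl | rfl | rfl | rfl
  · refine key _ _ ?_
    simpa [Wall, side] using colour_left hH.1 (k + 1) l
  · refine key' _ _ (by simp [IsUnitVec]) ?_
    simpa [Wall, side, ← sub_eq_add_neg] using colour_left hH.1 k l
  · refine key _ _ ?_
    simpa [Wall, side] using colour_down hH k (l + 1)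
  · refine key' _ _ (by simp [IsUnitVec]) ?_
    simpa [Wall, side, ← sub_eq_add_neg] using colour_down hH k l

lemma mem_interior_iff_of_not_wall (hH : IsGridHamCycle m n H) {B : Box} {t : ℤ × ℤ}
    (ht : IsUnitVec t) (h : ¬Wall H B t) : B + t ∈ interiorBoxes H ↔ B ∈ interiorBoxes H := by
  rw [wall_iff hH ht, not_not] at h
  exact h.symm

lemma mem_interior_iff_of_wall (hH : IsGridHamCycle m n H) {B : Box} {t : ℤ × ℤ}
    (ht : IsUnitVec t) (h : Wall H B t) : B + t ∈ interiorBoxes H ↔ B ∉ interiorBoxes H := by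
  rw [wall_iff hH ht] at h
  tauto

/-! ### Adjacency of boxes -/

lemma latticeBoxGraph_adj {B B' : Box} :
    (latticeBoxGraph H).Adj B B' ↔ ∃ t, IsUnitVec t ∧ B' = B + t ∧ ¬Wall H B t := by
  constructor
  · rintro ⟨hne, e, h1, h2, h3⟩
    obtain ⟨t, ht, rfl⟩ := mem_boxEdges.1 h1
    rcases (side_mem_boxEdges ht).1 h2 with h | h
    · exact absurd h.symm hne
    · exact ⟨t, ht, h, h3⟩
  · rintro ⟨t, ht, rfl, h⟩
    refine ⟨fun h => ht.ne_zero (by simpa using h), side B t, ?_, ?_, h⟩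
    · exact (side_mem_boxEdges ht).2 (Or.inl rfl)
    · exact (side_mem_boxEdges ht).2 (Or.inr rfl)

lemma boxGraph_adj {B B' : Box} :
    (boxGraph m n H).Adj B B' ↔
      B ∈ gridBoxes m n ∧ B' ∈ gridBoxes m n ∧ ∃ t, IsUnitVec t ∧ B' = B + t ∧ ¬Wall H B t := by
  rw [← latticeBoxGraph_adj]
  rfl

lemma boxGraph_adj_add {B : Box} {t : ℤ × ℤ} (hB : B ∈ gridBoxes m n) (ht : IsUnitVec t)
    (hBt : B + t ∈ gridBoxes m n) (h : ¬Wall H B t) : (boxGraph m n H).Adj B (B + t) :=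
  boxGraph_adj.2 ⟨hB, hBt, t, ht, rfl, h⟩

lemma mem_interior_iff_of_adj (hH : IsGridHamCycle m n H) {B B' : Box}
    (h : (latticeBoxGraph H).Adj B B') : B' ∈ interiorBoxes H ↔ B ∈ interiorBoxes H := by
  obtain ⟨t, ht, rfl, hw⟩ := latticeBoxGraph_adj.1 h
  exact mem_interior_iff_of_not_wall hH ht hw

lemma not_mem_interior_of_inExt (hH : IsGridHamCycle m n H) {B : Box} (h : InExt m n H B) :
    B ∉ interiorBoxes H := by
  obtain ⟨B', hB', ⟨p⟩⟩ := h
  induction p with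
  | nil => exact fun h => hB' (mem_gridBoxes_of_mem_interior hH h)
  | cons hadj p ih =>
    rw [← mem_interior_iff_of_adj hH hadj]
    exact ih hB'

end Grid

/-! ### Closed sequences of boxes and the vertices they separate -/

section Winding

variable (z : ℕ → Box) (N : ℕ)

/-- The parity of the number of steps of the sequence `z` of boxes that cross the horizontal ray
from `v` to the right. -/
noncomputable def winding (v : Vtx) : ZMod 2 :=
  ∑ i ∈ Finset.range N, (ind (∃ k, v.1 ≤ k ∧
    side (z i) (z (i + 1) - z i) = s((k, v.2), (k + 1, v.2))) : ZMod 2)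

/-- The parity of the number of steps of the sequence `z` that cross the edge `e`. -/
noncomputable def crossings (e : Sym2 Vtx) : ZMod 2 :=
  ∑ i ∈ Finset.range N, (ind (side (z i) (z (i + 1) - z i) = e) : ZMod 2)

lemma winding_right (x y : ℤ) :
    winding z N (x, y) = winding z N (x + 1, y) + crossings z N s((x, y), (x + 1, y)) := by
  unfold winding crossings
  rw [← Finset.sum_add_distrib]
  refine Finset.sum_congr rfl fun i _ => ?_
  generalize side (z i) (z (i + 1) - z i) = e
  by_cases h : e = s((x, y), (x + 1, y))
  · have h1 : ∃ k, x ≤ k ∧ e = s((k, y), (k + 1, y)) := ⟨x, le_rfl, h⟩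
    have h2 : ¬∃ k, x + 1 ≤ k ∧ e = s((k, y), (k + 1, y)) := by
      rintro ⟨k, hk, hk'⟩
      rw [h, Sym2.eq_iff] at hk'
      simp only [Prod.mk.injEq] at hk'
      omega
    rw [ind_of_true h1, ind_of_false h2, ind_of_true h]
    simp
  · have h1 : (∃ k, x ≤ k ∧ e = s((k, y), (k + 1, y))) ↔
        ∃ k, x + 1 ≤ k ∧ e = s((k, y), (k + 1, y)) := by
      constructor
      · rintro ⟨k, hk, rfl⟩
        refine ⟨k, ?_, rfl⟩
        rcases hk.eq_or_lt with rfl | hk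
        · exact absurd rfl h
        · omega
      · rintro ⟨k, hk, rfl⟩
        exact ⟨k, by omega, rfl⟩
    simp only [h1, h, ind_of_false, not_false_eq_true]
    simp

variable {z N}

/-- A step of the sequence changes the membership in the quadrant strip `{(k, y) | x ≤ k}` exactly if
it crosses the boundary of this strip. -/
lemma winding_up (hclosed : z N = z 0) (hstep : ∀ i < N, IsUnitVec (z (i + 1) - z i)) (x y : ℤ) :
    winding z N (x, y) = winding z N (x, y + 1) + crossings z N s((x, y), (x, y + 1)) := by
  let f : ℕ → ZMod 2 := fun i => (ind ((z i).2 = y ∧ x ≤ (z i).1) : ZMod 2)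
  have hsum : ∑ i ∈ Finset.range N, (f (i + 1) - f i) = 0 := by
    rw [Finset.sum_range_sub]
    simp only [f, hclosed, sub_self]
  rw [← sub_eq_zero, ← hsum]
  unfold winding crossings
  rw [← Finset.sum_add_distrib, ← Finset.sum_sub_distrib]
  refine Finset.sum_congr rfl fun i hi => ?_
  have h := hstep i (Finset.mem_range.1 hi)
  simp only [f]
  obtain ⟨t, ht⟩ : ∃ t, z (i + 1) = z i + t := ⟨z (i + 1) - z i, by simp⟩
  rw [ht, add_sub_cancel_left] at h ⊢
  generalize z i = B
  obtain ⟨k, l⟩ := B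
  have two : (2 : ZMod 2) = 0 := rfl
  rcases h with rfl | rfl | rfl | rfl
  · have h1 : ∀ y', ¬∃ k', x ≤ k' ∧ side (k, l) (1, 0) = s((k', y'), (k' + 1, y')) := by
      rintro y' ⟨k', -, hk⟩
      simp [side] at hk
      omega
    have h2 : side (k, l) (1, 0) = s((x, y), (x, y + 1)) ↔ k + 1 = x ∧ l = y := by
      simp [side]; omega
    simp only [h1, h2, ind_of_false, not_false_eq_true, Prod.mk_add_mk, add_zero]
    by_cases hl : l = y
    · subst hl
      rcases lt_trichotomy (k + 1) x with hk | hk | hk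
      · simp [hk.ne, hk.not_ge, (show ¬x ≤ k by omega)]
      · simp [hk, (show ¬x ≤ k by omega)]
      · simp [hk.ne', hk.le, (show x ≤ k by omega)]
    · simp [hl]
  · have h1 : ∀ y', ¬∃ k', x ≤ k' ∧ side (k, l) (-1, 0) = s((k', y'), (k' + 1, y')) := by
      rintro y' ⟨k', -, hk⟩
      simp [side] at hk
      omega
    have h2 : side (k, l) (-1, 0) = s((x, y), (x, y + 1)) ↔ k = x ∧ l = y := by
      simp [side]; omega
    simp only [h1, h2, ind_of_false, not_false_eq_true, Prod.mk_add_mk, add_zero]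
    by_cases hl : l = y
    · subst hl
      rcases lt_trichotomy k x with hk | hk | hk
      · simp [hk.ne, hk.not_ge, (show ¬x ≤ k + -1 by omega)]
      · simp [hk]
      · simp [hk.ne', hk.le, (show x ≤ k + -1 by omega)]
    · simp [hl]
  · have h1 : ∀ y', (∃ k', x ≤ k' ∧ side (k, l) (0, 1) = s((k', y'), (k' + 1, y'))) ↔
        x ≤ k ∧ l + 1 = y' := by
      intro y'
      constructor
      · rintro ⟨k', h, hk⟩
        simp [side] at hk
        omega
      · rintro ⟨h, rfl⟩
        exact ⟨k, h, by simp [side]⟩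
    have h2 : ¬side (k, l) (0, 1) = s((x, y), (x, y + 1)) := by
      simp [side]; omega
    simp only [h1, h2, ind_of_false, not_false_eq_true, Prod.mk_add_mk, add_zero]
    by_cases hk : x ≤ k
    · rcases eq_or_ne l y with hl | hl
      · simp [hk, hl]
      · rcases eq_or_ne (l + 1) y with hl' | hl'
        · simp [hk, hl, hl']
        · simp [hk, hl, hl']
    · simp [hk]
  · have h1 : ∀ y', (∃ k', x ≤ k' ∧ side (k, l) (0, -1) = s((k', y'), (k' + 1, y'))) ↔
        x ≤ k ∧ l = y' := by
      intro y'
      constructor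
      · rintro ⟨k', h, hk⟩
        simp [side] at hk
        omega
      · rintro ⟨h, rfl⟩
        exact ⟨k, h, by simp [side]⟩
    have h2 : ¬side (k, l) (0, -1) = s((x, y), (x, y + 1)) := by
      simp [side]; omega
    simp only [h1, h2, ind_of_false, not_false_eq_true, Prod.mk_add_mk, add_zero]
    by_cases hk : x ≤ k
    · rcases eq_or_ne l y with hl | hl
      · simp [hk, hl]
      · rcases eq_or_ne l (y + 1) with hl' | hl'
        · simp [hk, hl']
        · simp [hk, hl, hl', (show ¬l + -1 = y by omega)]
    · simp [hk]

lemma winding_add (hclosed : z N = z 0) (hstep : ∀ i < N, IsUnitVec (z (i + 1) - z i)) (v : Vtx)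
    {t : ℤ × ℤ} (ht : IsUnitVec t) :
    winding z N (v + t) = winding z N v + crossings z N s(v, v + t) := by
  have two : (2 : ZMod 2) = 0 := rfl
  obtain ⟨x, y⟩ := v
  rcases ht with rfl | rfl | rfl | rfl
  · have := winding_right z N x y
    simp only [Prod.mk_add_mk, add_zero]
    linear_combination -this - two * crossings z N s((x, y), (x + 1, y))
  · have := winding_right z N (x - 1) y
    rw [sub_add_cancel, Sym2.eq_swap] at this
    simp only [Prod.mk_add_mk, add_zero, ← sub_eq_add_neg]
    exact this
  · have := winding_up hclosed hstep x y
    simp only [Prod.mk_add_mk, add_zero]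
    linear_combination -this - two * crossings z N s((x, y), (x, y + 1))
  · have := winding_up hclosed hstep x (y - 1)
    rw [sub_add_cancel, Sym2.eq_swap] at this
    simp only [Prod.mk_add_mk, add_zero, ← sub_eq_add_neg]
    exact this

/-- If a closed sequence of boxes crosses no edge of `E`, then it crosses an edge between vertices
that are connected in `E` an even number of times. -/
theorem crossings_eq_zero (hclosed : z N = z 0) (hstep : ∀ i < N, IsUnitVec (z (i + 1) - z i))
    {E : EdgeSet} (hlat : IsLattice E) (hE : ∀ i < N, side (z i) (z (i + 1) - z i) ∉ E)
    {v t : ℤ × ℤ} (ht : IsUnitVec t) (hr : (fromEdgeSet E).Reachable v (v + t)) :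
    crossings z N s(v, v + t) = 0 := by
  have key : ∀ v w, (fromEdgeSet E).Reachable v w → winding z N w = winding z N v := by
    rintro v w ⟨p⟩
    induction p with
    | nil => rfl
    | @cons a b c hab p ih =>
      rw [ih]
      rw [fromEdgeSet_adj] at hab
      have h := winding_add hclosed hstep a (hlat a b hab.1)
      rw [add_sub_cancel] at h
      rw [h]
      refine add_eq_left.2 (Finset.sum_eq_zero fun i hi => ?_)
      rw [ind_of_false, Nat.cast_zero]
      intro h
      exact hE i (Finset.mem_range.1 hi) (h ▸ hab.1)
  have h := winding_add hclosed hstep v ht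
  rw [key _ _ hr] at h
  simpa using h

/-- A closed sequence of boxes that crosses no edge of `E`, and crosses an edge `e` exactly once,
separates the ends of `e` from each other in `E`. -/
theorem not_reachable_of_crosses_once (hclosed : z N = z 0)
    (hstep : ∀ i < N, IsUnitVec (z (i + 1) - z i))
    {E : EdgeSet} (hlat : IsLattice E) (hE : ∀ i < N, side (z i) (z (i + 1) - z i) ∉ E)
    {v t : ℤ × ℤ} (ht : IsUnitVec t) {i : ℕ} (hi : i < N)
    (h1 : side (z i) (z (i + 1) - z i) = s(v, v + t))
    (h2 : ∀ k < N, side (z k) (z (k + 1) - z k) = s(v, v + t) → k = i) :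
    ¬(fromEdgeSet E).Reachable v (v + t) := by
  intro hr
  have h := crossings_eq_zero hclosed hstep hlat hE ht hr
  rw [crossings, Finset.sum_eq_single i, ind_of_true h1] at h
  · simp at h
  · intro k hk hki
    rw [ind_of_false, Nat.cast_zero]
    exact fun hc => hki (h2 k (Finset.mem_range.1 hk) hc)
  · exact fun h => absurd (Finset.mem_range.2 hi) h

end Winding

/-! ### The components of the box graph are trees -/

section Tree

variable {m n : ℕ} {H : EdgeSet}

lemma isAcyclic_boxGraph (hH : IsGridHamCycle m n H) : (boxGraph m n H).IsAcyclic := by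
  rw [isAcyclic_iff_forall_adj_isBridge]
  intro A B hAB
  rw [isBridge_iff]
  refine fun hr => ?_
  obtain ⟨p⟩ := hr.symm
  obtain ⟨hA, hB, t, ht, rfl, hw⟩ := boxGraph_adj.1 hAB
  let z : ℕ → Box := fun i => if i = 0 then A else p.getVert (i - 1)
  have hz : ∀ i, z (i + 1) = p.getVert i := fun i => by simp [z]
  have hz0 : z 0 = A := rfl
  have hadj : ∀ i, i < p.length → ∃ t', IsUnitVec t' ∧ z (i + 1 + 1) = z (i + 1) + t' ∧
      ¬Wall H (z (i + 1)) t' ∧ s(z (i + 1), z (i + 1 + 1)) ≠ s(A, A + t) := by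
    intro i hi
    rw [hz, hz]
    have := p.adj_getVert_succ hi
    rw [deleteEdges_adj] at this
    obtain ⟨-, -, t', ht', h1, h2⟩ := boxGraph_adj.1 this.1
    exact ⟨t', ht', h1, h2, fun h => this.2 h⟩
  have hstep : ∀ i < p.length + 1, IsUnitVec (z (i + 1) - z i) := by
    rintro (_ | i) hi
    · rw [hz, hz0]
      simpa using ht
    · obtain ⟨t', ht', h1, -⟩ := hadj i (by omega)
      rw [h1]
      simpa using ht'
  obtain ⟨b, hb⟩ := ht.exists_isFrame
  have hside : side A t = s(corner A t b, corner A t b + -b) := by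
    rw [side_eq_corner hb, sub_eq_add_neg]
  refine not_reachable_of_crosses_once (z := z) (N := p.length + 1) (E := H) (i := 0) ?_ hstep
    (isLattice_of_subset hH.1) ?_ hb.right.neg (by omega) (v := corner A t b) ?_ ?_
    (hH.reachable (corner_mem_gridVerts hA hb) ?_)
  · rw [hz, hz0, p.getVert_length]
  · rintro (_ | i) hi
    · rw [hz, hz0]
      simpa [Wall] using hw
    · obtain ⟨t', ht', h1, h2, -⟩ := hadj i (by omega)
      rw [h1]
      simpa [Wall] using h2
  · rw [hz, hz0, ← hside]
    simp
  · rintro (_ | i) hi h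
    · rfl
    · exfalso
      obtain ⟨t', ht', h1, -, h3⟩ := hadj i (by omega)
      rw [h1, ← hside, add_sub_cancel_left] at h
      rcases (side_eq_side ht' ht).1 h with ⟨h4, h5⟩ | ⟨h4, h5⟩
      · exact h3 (by rw [h1, h4, h5])
      · exact h3 (by rw [h1, h4, h5, Sym2.eq_swap]; simp)
  · rw [← sub_eq_add_neg, ← corner_neg hb]
    exact corner_mem_gridVerts hA hb.neg_right

/-- The finite sets of vertices that are obtained from a single vertex by adding neighbours one at
a time, that is, the finite nonempty connected sets. -/
inductive Grown {V : Type*} (G : SimpleGraph V) : Set V → Prop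
  | single (a : V) : Grown G {a}
  | insert {S : Set V} {A C : V} (hS : Grown G S) (hA : A ∈ S) (hC : C ∉ S) (h : G.Adj A C) :
      Grown G (insert C S)

lemma Grown.insert_of_mem {V : Type*} {G : SimpleGraph V} {S : Set V} {A C : V} (hS : Grown G S)
    (hA : A ∈ S) (h : G.Adj A C) : Grown G (Insert.insert C S) := by
  by_cases hC : C ∈ S
  · rwa [Set.insert_eq_of_mem hC]
  · exact hS.insert hA hC h

lemma Grown.exists_walk {V : Type*} {G : SimpleGraph V} {S : Set V} (hS : Grown G S) {a b : V}
    (ha : a ∈ S) (hb : b ∈ S) : ∃ p : G.Walk a b, ∀ x ∈ p.support, x ∈ S := by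
  induction hS generalizing a b with
  | single c =>
    obtain rfl : a = c := ha
    obtain rfl : b = a := hb
    exact ⟨.nil, by simp⟩
  | @insert S A C hS hA hC h ih =>
    have key : ∀ x ∈ Insert.insert C S, ∃ p : G.Walk x A, ∀ y ∈ p.support, y ∈ Insert.insert C S := by
      rintro x (rfl | hx)
      · refine ⟨.cons h.symm .nil, ?_⟩
        simp [hA]
      · obtain ⟨p, hp⟩ := ih hx hA
        exact ⟨p, fun y hy => Set.mem_insert_of_mem _ (hp y hy)⟩
    obtain ⟨p, hp⟩ := key a ha
    obtain ⟨q, hq⟩ := key b hb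
    refine ⟨p.append q.reverse, fun x hx => ?_⟩
    rw [Walk.mem_support_append_iff, Walk.support_reverse, List.mem_reverse] at hx
    exact hx.elim (hp x) (hq x)

/-- In a forest, a vertex outside a connected set has at most one neighbour in this set. -/
lemma Grown.eq_of_adj {V : Type*} {G : SimpleGraph V} (hG : G.IsAcyclic) {S : Set V}
    (hS : Grown G S) {A B C : V} (hA : A ∈ S) (hB : B ∈ S) (hC : C ∉ S) (hCA : G.Adj C A)
    (hCB : G.Adj C B) : A = B := by
  classical
  by_contra hne
  obtain ⟨p, hp⟩ := hS.exists_walk hA hB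
  have h1 : (Walk.cons hCA p.bypass).IsPath := by
    rw [Walk.cons_isPath_iff]
    exact ⟨p.bypass_isPath, fun h => hC (hp _ (p.support_bypass_subset_support h))⟩
  have h2 := (hG.subsingleton_path C B).elim ⟨_, h1⟩ (Path.singleton hCB)
  have h3 := congrArg (fun q : G.Path C B => (q : G.Walk C B).length) h2
  simp only [Walk.length_cons, Path.singleton, Walk.length_nil] at h3
  exact hne (Walk.eq_of_length_eq_zero (by omega : p.bypass.length = 0))

end Tree

/-! ### Switching boxes -/

section Switch

variable {m n : ℕ} {H : EdgeSet} {B : Box} {a b : ℤ × ℤ}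

/-- The sides of `B` in the directions `a` and `-a` are in `H`, those in the perpendicular
directions `b` and `-b` are not. -/
structure IsCorridor (H : EdgeSet) (B : Box) (a b : ℤ × ℤ) : Prop where
  frame : IsFrame a b
  wall : Wall H B a
  wall_neg : Wall H B (-a)
  not_wall : ¬Wall H B b
  not_wall_neg : ¬Wall H B (-b)

lemma wall_switch {t : ℤ × ℤ} (ht : IsUnitVec t) {K : Box} :
    Wall (switch H K) B t ↔ ¬(Wall H B t ↔ (K = B ∨ K = B + t)) := by
  rw [Wall, switch, Set.mem_symmDiff, side_mem_boxEdges ht, Wall]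
  tauto

lemma wall_switch_self {t : ℤ × ℤ} (ht : IsUnitVec t) : Wall (switch H B) B t ↔ ¬Wall H B t := by
  rw [wall_switch ht]
  simp

lemma wall_switch_of_ne {t : ℤ × ℤ} (ht : IsUnitVec t) {K : Box} (h1 : K ≠ B) (h2 : K ≠ B + t) :
    Wall (switch H K) B t ↔ Wall H B t := by
  rw [wall_switch ht]
  simp [h1, h2]

lemma IsUnitVec.side_pair {a : ℤ × ℤ} (h : IsUnitVec a) (B : Box) :
    ({side B a, side B (-a)} : EdgeSet) = horEdges B ∨
      ({side B a, side B (-a)} : EdgeSet) = verEdges B := by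
  obtain ⟨x, y⟩ := B
  rcases h with rfl | rfl | rfl | rfl
  · exact Or.inr (by simp [side, verEdges, Set.pair_comm])
  · exact Or.inr (by simp [side, verEdges])
  · exact Or.inl (by simp [side, horEdges, Set.pair_comm])
  · exact Or.inl (by simp [side, horEdges])

lemma IsCorridor.switchable (h : IsCorridor H B a b) : Switchable H B := by
  have key : boxEdges B ∩ H = {side B a, side B (-a)} := by
    ext e
    constructor
    · rintro ⟨he, heH⟩
      obtain ⟨t, ht, rfl⟩ := mem_boxEdges.1 he
      rcases ht.cases_of_isFrame h.frame with rfl | rfl | rfl | rfl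
      · exact Or.inl rfl
      · exact Or.inr rfl
      · exact absurd heH h.not_wall
      · exact absurd heH h.not_wall_neg
    · rintro (rfl | rfl)
      · exact ⟨mem_boxEdges.2 ⟨a, h.frame.left, rfl⟩, h.wall⟩
      · exact ⟨mem_boxEdges.2 ⟨-a, h.frame.left.neg, rfl⟩, h.wall_neg⟩
  rw [Switchable, key]
  exact h.frame.left.side_pair B

lemma IsCorridor.neg_left (h : IsCorridor H B a b) : IsCorridor H B (-a) b :=
  ⟨h.frame.neg_left, h.wall_neg, by rw [neg_neg]; exact h.wall, h.not_wall, h.not_wall_neg⟩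

lemma IsCorridor.neg_right (h : IsCorridor H B a b) : IsCorridor H B a (-b) :=
  ⟨h.frame.neg_right, h.wall, h.wall_neg, h.not_wall_neg, by rw [neg_neg]; exact h.not_wall⟩

lemma mem_boxVerts_of_mem_boxEdges {v w : Vtx} (h : s(v, w) ∈ boxEdges B) : v ∈ boxVerts B := by
  obtain ⟨t, ht, h⟩ := mem_boxEdges.1 h
  obtain ⟨s, hs⟩ := ht.exists_isFrame
  rw [side_eq_corner' hs] at h
  rcases Sym2.eq_iff.1 h with ⟨rfl, rfl⟩ | ⟨rfl, rfl⟩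
  · exact corner_mem_boxVerts hs B
  · exact corner_mem_boxVerts hs.neg_right B

lemma add_ne_self {t : ℤ × ℤ} (ht : IsUnitVec t) : B ≠ B + t := fun h => ht.ne_zero (by simpa using h)

lemma IsFrame.add_ne_zero (h : IsFrame a b) : a + b ≠ 0 := fun hc =>
  h.ne_neg (eq_neg_of_add_eq_zero_left hc)

lemma deg_switch_corner (h : IsFrame a b) (hab : Wall H B a ↔ ¬Wall H B b) :
    deg (switch H B) (corner B a b) = deg H (corner B a b) := by
  have hne : B ≠ B + a + b := by
    rw [add_assoc]
    exact fun hc => h.add_ne_zero (by simpa using hc)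
  rw [deg_corner h, deg_corner h, wall_switch_self h.left, wall_switch_self h.right,
    wall_switch_of_ne h.right (add_ne_self h.left) hne,
    wall_switch_of_ne h.left (add_ne_self h.right) (by rw [add_right_comm]; exact hne)]
  by_cases h1 : Wall H B a
  · simp [h1, hab.1 h1]
  · have h2 : Wall H B b := by tauto
    simp [h1, h2]

/-- Switching preserves the degrees. -/
lemma IsCorridor.deg_switch (h : IsCorridor H B a b) (v : Vtx) : deg (switch H B) v = deg H v := by
  obtain ⟨hf, h1, h2, h3, h4⟩ := h
  by_cases hv : v ∈ boxVerts B
  · rcases (mem_boxVerts hf).1 hv with rfl | rfl | rfl | rfl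
    · exact deg_switch_corner hf (by tauto)
    · exact deg_switch_corner hf.neg_right (by tauto)
    · exact deg_switch_corner hf.neg_left (by tauto)
    · exact deg_switch_corner hf.neg_left.neg_right (by tauto)
  · have : ∀ w, s(v, w) ∈ switch H B ↔ s(v, w) ∈ H := by
      intro w
      have : s(v, w) ∉ boxEdges B := fun hc => hv (mem_boxVerts_of_mem_boxEdges hc)
      rw [switch, Set.mem_symmDiff]
      tauto
    simp only [deg, this]

lemma switch_subset (hH : H ⊆ gridEdges m n) (hB : B ∈ gridBoxes m n) :
    switch H B ⊆ gridEdges m n := by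
  rintro e (⟨h, -⟩ | ⟨h, -⟩)
  · exact hH h
  · obtain ⟨t, ht, rfl⟩ := mem_boxEdges.1 h
    exact side_mem_gridEdges hB ht

/-- An edge of a box outside the switched one is not affected. -/
lemma mem_switch_of_notMem {e : Sym2 Vtx} (h : e ∉ boxEdges B) : e ∈ switch H B ↔ e ∈ H := by
  rw [switch, Set.mem_symmDiff]
  tauto

end Switch

section Reach

variable {V : Type*} {E : Set (Sym2 V)}

lemma reachable_mono {E' : Set (Sym2 V)} (h : E ⊆ E') {x y : V}
    (hr : (fromEdgeSet E).Reachable x y) : (fromEdgeSet E').Reachable x y :=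
  hr.mono (fromEdgeSet_mono h)

lemma reachable_of_forall {E' : Set (Sym2 V)} {x y : V} (hr : (fromEdgeSet E).Reachable x y)
    (h : ∀ v w, s(v, w) ∈ E → (fromEdgeSet E').Reachable v w) : (fromEdgeSet E').Reachable x y := by
  obtain ⟨p⟩ := hr
  induction p with
  | nil => exact Reachable.refl _
  | cons hab p ih => exact (h _ _ ((fromEdgeSet_adj _).1 hab).1).trans ih

lemma reachable_of_mem {x y : V} (h : s(x, y) ∈ E) : (fromEdgeSet E).Reachable x y := by
  by_cases hxy : x = y
  · rw [hxy]
  · exact Adj.reachable ((fromEdgeSet_adj _).2 ⟨h, hxy⟩)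

/-- A path whose start is not connected to the end `x` of an edge does not use this edge. -/
lemma reachable_diff_of_not_reachable {x y v w : V} (hr : (fromEdgeSet E).Reachable v w)
    (h : ¬(fromEdgeSet E).Reachable v x) : (fromEdgeSet (E \ {s(x, y)})).Reachable v w := by
  obtain ⟨p⟩ := hr
  induction p with
  | nil => exact Reachable.refl _
  | @cons a b c hab p ih =>
    have hb : ¬(fromEdgeSet E).Reachable b x := fun hc => h (hab.reachable.trans hc)
    refine Reachable.trans (reachable_of_mem ⟨((fromEdgeSet_adj _).1 hab).1, ?_⟩) (ih hb)
    intro hc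
    rcases Sym2.eq_iff.1 (Set.mem_singleton_iff.1 hc) with ⟨rfl, rfl⟩ | ⟨rfl, rfl⟩
    · exact h (Reachable.refl _)
    · exact hb (Reachable.refl _)

/-- After the deletion of an edge, every vertex is still connected to one of its ends. -/
lemma reachable_diff_or {x y v : V} (hr : (fromEdgeSet E).Reachable v x) :
    (fromEdgeSet (E \ {s(x, y)})).Reachable v x ∨
      (fromEdgeSet (E \ {s(x, y)})).Reachable v y := by
  obtain ⟨p⟩ := hr
  induction p with
  | nil => exact Or.inl (Reachable.refl _)
  | @cons a b c hab p ih =>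
    by_cases hc : s(a, b) = s(c, y)
    · rcases Sym2.eq_iff.1 hc with ⟨rfl, rfl⟩ | ⟨rfl, rfl⟩
      · exact Or.inl (Reachable.refl _)
      · exact Or.inr (Reachable.refl _)
    · have : (fromEdgeSet (E \ {s(c, y)})).Reachable a b :=
        reachable_of_mem ⟨((fromEdgeSet_adj _).1 hab).1, hc⟩
      exact ih.imp this.trans this.trans

end Reach

section Moves

variable {m n : ℕ} {H : EdgeSet}

lemma not_isBoundaryEdge {B : Box} {t : ℤ × ℤ} (ht : IsUnitVec t) (hB : B ∈ gridBoxes m n)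
    (hBt : B + t ∈ gridBoxes m n) : ¬IsBoundaryEdge m n (side B t) := by
  rintro ⟨-, B', hB', h⟩
  rcases (side_mem_boxEdges ht).1 h with rfl | rfl
  exacts [hB' hB, hB' hBt]

/-- A cookie can only be created by removing an edge of `H` on the boundary of the grid. -/
lemma not_createsCookie {H' : EdgeSet} (h : ∀ e, IsBoundaryEdge m n e → e ∈ H → e ∈ H') :
    ¬CreatesCookie m n H H' := by
  rintro ⟨J', N', e, -, ⟨-, -, he, heH'⟩, hno⟩
  have heH : e ∉ H := fun hc => heH' (h e he hc)
  obtain ⟨⟨B, hB, heB⟩, B', hB', heB'⟩ := he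
  refine hno ⟨{D | (boxGraph m n H).Reachable B D}, B, ⟨B, hB, ⟨B', hB', ?_⟩, rfl⟩,
    Reachable.refl _, heB, ⟨⟨B, hB, heB⟩, B', hB', heB'⟩, heH⟩
  refine Adj.reachable ⟨?_, e, heB, heB', heH⟩
  rintro rfl
  exact hB' hB

/-- The second switch of a double switch reconnects the cycle: if `z` is a path of boxes that
crosses no edge of `H`, between the two boxes at the sides of the corridor `M`, and if it crosses a
corridor `z k`, then switching first `M` and then `z k` yields a Hamiltonian cycle. -/
theorem isGridHamCycle_doubleSwitch (hH : IsGridHamCycle m n H) {M : Box} {w u : ℤ × ℤ}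
    (hM : IsCorridor H M w u) (hMG : M ∈ gridBoxes m n) {r : ℕ} {z : ℕ → Box}
    (hz0 : z 0 = M + w) (hzr : z r = M - w)
    (hstep : ∀ i < r, ∃ t, IsUnitVec t ∧ z (i + 1) = z i + t ∧ ¬Wall H (z i) t)
    (hzG : ∀ i ≤ r, z i ∈ gridBoxes m n) (hinj : ∀ i ≤ r, ∀ k ≤ r, z i = z k → i = k)
    {k : ℕ} (hk0 : 0 < k) (hkr : k < r) {e d : ℤ × ℤ} (hZ : IsCorridor H (z k) e d)
    (hnext : z (k + 1) = z k + d) :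
    IsGridHamCycle m n (switch (switch H M) (z k)) ∧ IsCorridor (switch H M) (z k) e d ∧
      Wall (switch (switch H M) (z k)) M (-u) := by
  have hw := hM.frame.left
  have hu := hM.frame.right
  have hd := hZ.frame.right
  have he := hZ.frame.left
  -- the boxes of the path are all on the side of `H` opposite to `M`
  have hcol : ∀ i ≤ r, (z i ∈ interiorBoxes H ↔ M ∉ interiorBoxes H) := by
    intro i
    induction i with
    | zero => exact fun _ => by rw [hz0]; exact mem_interior_iff_of_wall hH hw hM.wall
    | succ i ih =>
      intro hi
      obtain ⟨t, ht, h1, h2⟩ := hstep i (by omega)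
      rw [h1, mem_interior_iff_of_not_wall hH ht h2]
      exact ih (by omega)
  have hne : ∀ i ≤ r, M ≠ z i := by
    intro i hi h
    have := hcol i hi
    rw [← h] at this
    tauto
  have hneu : ∀ i ≤ r, ∀ t, t = u ∨ t = -u → M + t ≠ z i := by
    rintro i hi t ht h
    have h1 := hcol i hi
    rw [← h] at h1
    rcases ht with rfl | rfl
    · rw [mem_interior_iff_of_not_wall hH hu hM.not_wall] at h1
      tauto
    · rw [mem_interior_iff_of_not_wall hH hu.neg hM.not_wall_neg] at h1
      tauto
  have hneZ : ∀ t, IsUnitVec t → M ≠ z k + t := by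
    intro t ht h
    have h' : M + -t = z k := by rw [h]; simp
    rcases ht.neg.cases_of_isFrame hM.frame with h1 | h1 | h1 | h1 <;> rw [h1] at h'
    · have := hinj k hkr.le 0 (by omega) (by rw [← h', hz0])
      omega
    · have := hinj k hkr.le r le_rfl (by rw [← h', hzr, sub_eq_add_neg])
      omega
    · exact hneu k hkr.le u (Or.inl rfl) h'
    · exact hneu k hkr.le (-u) (Or.inr rfl) h'
  have hZ1 : IsCorridor (switch H M) (z k) e d := by
    have key : ∀ t, IsUnitVec t → (Wall (switch H M) (z k) t ↔ Wall H (z k) t) := fun t ht =>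
      wall_switch_of_ne ht (hne k hkr.le) (hneZ t ht)
    exact ⟨hZ.frame, (key _ he).2 hZ.wall, (key _ he.neg).2 hZ.wall_neg,
      fun h => hZ.not_wall ((key _ hd).1 h), fun h => hZ.not_wall_neg ((key _ hd.neg).1 h)⟩
  have hsub1 : switch H M ⊆ gridEdges m n := switch_subset hH.1 hMG
  have hsub2 : switch (switch H M) (z k) ⊆ gridEdges m n := switch_subset hsub1 (hzG k hkr.le)
  have hlat1 := isLattice_of_subset hsub1
  -- after the first switch, the closed path through `M` separates the ends of the side `d` of `z k`
  have hsep : ¬(fromEdgeSet (switch H M)).Reachable (corner (z k) d e) (corner (z k) d (-e)) := by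
    let y : ℕ → Box := fun i => if i = 0 then M else if i ≤ r + 1 then z (i - 1) else M
    have hy0 : y 0 = M := rfl
    have hy : ∀ i ≤ r, y (i + 1) = z i := fun i hi => by simp [y, hi]
    have hyr : y (r + 2) = M := by simp [y]
    have hys : ∀ i ≤ r + 1, ∃ t, IsUnitVec t ∧ y (i + 1) = y i + t ∧
        ¬Wall (switch H M) (y i) t ∧ (side (y i) t = side (z k) d → i = k + 1) := by
      rintro (_ | i) hi
      · refine ⟨w, hw, by rw [hy 0 (by omega), hy0, hz0], ?_, ?_⟩
        · rw [hy0, wall_switch_self hw, not_not]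
          exact hM.wall
        · intro h
          rw [hy0] at h
          rcases (side_eq_side hw hd).1 h with h | h
          · exact absurd h.1.symm (hne k hkr.le)
          · exact absurd (eq_add_of_sub_eq' (by rw [h.1]; simp)) (hneZ (-w) hw.neg)
      rcases Nat.lt_or_ge i r with hir | hir
      · obtain ⟨t, ht, h1, h2⟩ := hstep i hir
        rw [hy i hir.le, hy (i + 1) (by omega)]
        refine ⟨t, ht, h1, ?_, ?_⟩
        · rwa [wall_switch_of_ne ht (hne i hir.le) (by rw [← h1]; exact hne (i + 1) (by omega))]
        · intro h
          rcases (side_eq_side ht hd).1 h with h | h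
          · rw [hinj k hkr.le i hir.le h.1]
          · exfalso
            have h3 := hinj k hkr.le (i + 1) (by omega) (by rw [h1, h.1])
            have h4 := hinj (k + 1) (by omega) i hir.le (by rw [hnext, h.1, h.2]; simp)
            omega
      · obtain rfl : i = r := by omega
        rw [hy i le_rfl, hyr]
        refine ⟨w, hw, by rw [hzr]; simp, ?_, ?_⟩
        · have h1 : ¬Wall (switch H M) M (-w) := by
            rw [wall_switch_self hw.neg, not_not]
            exact hM.wall_neg
          rw [← wall_neg hw.neg, neg_neg, ← sub_eq_add_neg] at h1
          rwa [hzr]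
        · intro h
          rcases (side_eq_side hw hd).1 h with h | h
          · rw [hinj k hkr.le i le_rfl h.1]
          · exact absurd (by rw [h.1, hzr]; simp) (hne k hkr.le)
    have hside : side (z k) d = s(corner (z k) d e, corner (z k) d e + -e) := by
      rw [side_eq_corner hZ.frame.symm, sub_eq_add_neg]
    rw [corner_neg hZ.frame.symm, sub_eq_add_neg]
    refine not_reachable_of_crosses_once (z := y) (N := r + 2) (i := k + 1) ?_ ?_ hlat1 ?_ he.neg
      (by omega) ?_ ?_
    · rw [hyr, hy0]
    · intro i hi
      obtain ⟨t, ht, h1, -⟩ := hys i (by omega)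
      rw [h1]
      simpa using ht
    · intro i hi
      obtain ⟨t, ht, h1, h2, -⟩ := hys i (by omega)
      rw [h1, add_sub_cancel_left]
      exact h2
    · rw [hy k hkr.le, hy (k + 1) (by omega), hnext, add_sub_cancel_left, hside]
    · intro i hi h
      obtain ⟨t, ht, h1, h2, h3⟩ := hys i (by omega)
      rw [h1, add_sub_cancel_left, ← hside] at h
      exact h3 h
  have hdeg1 : ∀ v, deg (switch H M) v = deg H v := hM.deg_switch
  have hdeg2 : ∀ v, deg (switch (switch H M) (z k)) v = deg H v := fun v => by
    rw [hZ1.deg_switch, hdeg1]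
  have hm0 : 0 < m ∧ 0 < n := by
    have := hMG
    simp only [gridBoxes, Set.mem_ofPred_eq] at this
    omega
  -- the first switch yields a two-regular graph
  have hcyc : (fromEdgeSet (switch H M)).IsCycles := by
    have hirr : ∀ v, s(v, v) ∉ switch H M := fun v hv => by
      simpa using (hlat1 v v hv).ne_zero
    rintro v ⟨x, hx⟩
    have : (fromEdgeSet (switch H M)).neighborSet v = {x | s(v, x) ∈ switch H M} := by
      ext x
      exact adj_fromEdgeSet_of_irrefl hirr
    rw [this] at hx ⊢
    rw [ncard_eq_deg hlat1, hdeg1]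
    exact hH.deg_eq_two (mem_gridVerts_of_mem hsub1 hx)
  have hdel : ∀ e', e' = e ∨ e' = -e →
      (fromEdgeSet (switch (switch H M) (z k))).Reachable (corner (z k) e' d) (corner (z k) e' (-d)) := by
    intro e' he'
    have hC : IsCorridor (switch H M) (z k) e' d := by
      rcases he' with rfl | rfl
      exacts [hZ1, hZ1.neg_left]
    have hs : ¬(fromEdgeSet (switch H M)).Reachable (corner (z k) e' d) (corner (z k) (-e') d) := by
      rw [corner_symm _ e', corner_symm _ (-e')]
      rcases he' with rfl | rfl
      · exact hsep
      · rw [neg_neg]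
        exact fun h => hsep h.symm
    have hmem : s(corner (z k) e' d, corner (z k) e' (-d)) ∈ switch H M := by
      rw [← side_eq_corner' hC.frame]
      exact hC.wall
    have h1 := reachable_deleteEdges_of_isCycles (finite_gridVerts m n)
      (fun v x hvx => mem_gridVerts_of_mem hsub1 ((fromEdgeSet_adj _).1 hvx).1) hcyc
      ((fromEdgeSet_adj _).2 ⟨hmem, fun hc => hs (by
        have h2 := hlat1 _ _ hmem
        rw [← hc, sub_self] at h2
        exact absurd rfl h2.ne_zero)⟩)
    have h2 : (fromEdgeSet (switch H M)).deleteEdges {s(corner (z k) e' d, corner (z k) e' (-d))} =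
        fromEdgeSet (switch H M \ {side (z k) e'}) := by
      ext x y
      simp only [deleteEdges_adj, fromEdgeSet_adj, Set.mem_sdiff, side_eq_corner' hC.frame]
      tauto
    rw [h2] at h1
    have h3 : ¬(fromEdgeSet (switch H M \ {side (z k) e'})).Reachable (corner (z k) e' d)
        (corner (z k) (-e') d) := fun h => hs (reachable_mono Set.sdiff_subset h)
    refine reachable_mono ?_ (reachable_diff_of_not_reachable (y := corner (z k) (-e') (-d)) h1 h3)
    rintro x ⟨⟨hx1, hx2⟩, hx3⟩
    rw [← side_eq_corner' hC.frame.neg_left] at hx3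
    refine (mem_switch_of_notMem fun hc => ?_).2 hx1
    obtain ⟨t, ht, rfl⟩ := mem_boxEdges.1 hc
    rcases ht.cases_of_isFrame hC.frame with rfl | rfl | rfl | rfl
    · exact hx2 rfl
    · exact hx3 rfl
    · exact hC.not_wall hx1
    · exact hC.not_wall_neg hx1
  have hsides : ∀ d', d' = d ∨ d' = -d →
      (fromEdgeSet (switch (switch H M) (z k))).Reachable (corner (z k) e d') (corner (z k) (-e) d') := by
    intro d' hd'
    have hC : IsCorridor (switch H M) (z k) e d' := by
      rcases hd' with rfl | rfl
      exacts [hZ1, hZ1.neg_right]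
    rw [corner_symm _ e, corner_symm _ (-e)]
    refine reachable_of_mem ?_
    rw [← side_eq_corner' hC.frame.symm]
    exact (wall_switch_self hC.frame.right).2 hC.not_wall
  have hE1E2 : ∀ v x, (fromEdgeSet (switch H M)).Reachable v x →
      (fromEdgeSet (switch (switch H M) (z k))).Reachable v x := by
    intro v x hvx
    refine reachable_of_forall hvx fun v x hvx => ?_
    by_cases hc : s(v, x) ∈ boxEdges (z k)
    · obtain ⟨t, ht, h⟩ := mem_boxEdges.1 hc
      obtain ⟨e', he', rfl⟩ : ∃ e', (e' = e ∨ e' = -e) ∧ t = e' := by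
        rcases ht.cases_of_isFrame hZ.frame with rfl | rfl | rfl | rfl
        · exact ⟨_, Or.inl rfl, rfl⟩
        · exact ⟨_, Or.inr rfl, rfl⟩
        · exact absurd (h ▸ hvx : side (z k) t ∈ switch H M) hZ1.not_wall
        · exact absurd (h ▸ hvx : side (z k) (-d) ∈ switch H M) hZ1.not_wall_neg
      have hf : IsFrame t d := by
        rcases he' with rfl | rfl
        exacts [hZ.frame, hZ.frame.neg_left]
      rw [side_eq_corner' hf] at h
      rcases Sym2.eq_iff.1 h with ⟨rfl, rfl⟩ | ⟨rfl, rfl⟩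
      exacts [hdel t he', (hdel t he').symm]
    · exact reachable_of_mem ((mem_switch_of_notMem hc).2 hvx)
  -- before the second switch, every vertex is connected to one of the ends of the side `w` of `M`
  have htwo : ∀ v ∈ gridVerts m n,
      (fromEdgeSet (switch H M)).Reachable v (corner M w u) ∨
      (fromEdgeSet (switch H M)).Reachable v (corner M w (-u)) := by
    intro v hv
    have hreg := (isHamCycle_iff (finite_gridVerts m n) ⟨v, hv⟩).1 hH.2
    have h1 := hreg.reachable_diff (finite_gridVerts m n)
      (a := corner M (-w) u) (b := corner M (-w) (-u))
      (by rw [← side_eq_corner' hM.frame.neg_left]; exact hM.wall_neg) hv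
      (corner_mem_gridVerts hMG hM.frame)
    have hsub : (H \ {s(corner M (-w) u, corner M (-w) (-u))}) \
        {s(corner M w u, corner M w (-u))} ⊆ switch H M := by
      rintro x ⟨⟨hx1, hx2⟩, hx3⟩
      rw [← side_eq_corner' hM.frame.neg_left] at hx2
      rw [← side_eq_corner' hM.frame] at hx3
      refine (mem_switch_of_notMem fun hc => ?_).2 hx1
      obtain ⟨t, ht, rfl⟩ := mem_boxEdges.1 hc
      rcases ht.cases_of_isFrame hM.frame with rfl | rfl | rfl | rfl
      · exact hx3 rfl
      · exact hx2 rfl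
      · exact hM.not_wall hx1
      · exact hM.not_wall_neg hx1
    exact (reachable_diff_or (y := corner M w (-u)) h1).imp (reachable_mono hsub)
      (reachable_mono hsub)
  have hpp := hsides d (Or.inl rfl)
  have hp1 := htwo _ (corner_mem_gridVerts (hzG k hkr.le) hZ.frame)
  have hp2 := htwo _ (corner_mem_gridVerts (hzG k hkr.le) hZ.frame.neg_left)
  rw [corner_symm, corner_symm _ d] at hsep
  have hab : (fromEdgeSet (switch (switch H M) (z k))).Reachable (corner M w u) (corner M w (-u)) := by
    rcases hp1 with h1 | h1 <;> rcases hp2 with h2 | h2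
    · exact absurd (h1.trans h2.symm) hsep
    · exact ((hE1E2 _ _ h1).symm.trans hpp).trans (hE1E2 _ _ h2)
    · exact ((hE1E2 _ _ h2).symm.trans hpp.symm).trans (hE1E2 _ _ h1)
    · exact absurd (h1.trans h2.symm) hsep
  have hall : ∀ v ∈ gridVerts m n,
      (fromEdgeSet (switch (switch H M) (z k))).Reachable v (corner M w u) := fun v hv =>
    (htwo v hv).elim (hE1E2 _ _) fun h => (hE1E2 _ _ h).trans hab.symm
  refine ⟨(isGridHamCycle_iff hm0.1 hm0.2).2 ⟨hsub2, fun v hv => ?_, fun v hv x hx =>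
    (hall v hv).trans (hall x hx).symm⟩, hZ1, ?_⟩
  · rw [hdeg2, hH.deg_eq_two hv]
  · rw [wall_switch_of_ne hu.neg (hne k hkr.le).symm (hneu k hkr.le (-u) (Or.inr rfl)).symm,
      wall_switch_self hu.neg]
    exact hM.not_wall_neg

/-- If the corridor `z k` in `isGridHamCycle_doubleSwitch` is not at the boundary, then the double
switch is a step of a cascade. -/
theorem cascadeStep_doubleSwitch (hH : IsGridHamCycle m n H) {M : Box} {w u : ℤ × ℤ}
    (hM : IsCorridor H M w u) (hMG : M ∈ gridBoxes m n) {r : ℕ} {z : ℕ → Box}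
    (hz0 : z 0 = M + w) (hzr : z r = M - w)
    (hstep : ∀ i < r, ∃ t, IsUnitVec t ∧ z (i + 1) = z i + t ∧ ¬Wall H (z i) t)
    (hzG : ∀ i ≤ r, z i ∈ gridBoxes m n) (hinj : ∀ i ≤ r, ∀ k ≤ r, z i = z k → i = k)
    {k : ℕ} (hk0 : 0 < k) (hkr : k < r) {e d : ℤ × ℤ} (hZ : IsCorridor H (z k) e d)
    (hnext : z (k + 1) = z k + d) (he : z k + e ∈ gridBoxes m n) (he' : z k + -e ∈ gridBoxes m n) :
    ∃ H', CascadeStep m n H H' ∧ Wall H' M (-u) := by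
  obtain ⟨h1, h2, h3⟩ := isGridHamCycle_doubleSwitch hH hM hMG hz0 hzr hstep hzG hinj hk0 hkr hZ hnext
  refine ⟨_, ⟨M, z k, ⟨hMG, hzG k hkr.le, hM.switchable, h2.switchable, rfl⟩, h1, Or.inr ?_⟩, h3⟩
  refine not_createsCookie fun x hx hxH => ?_
  have hw := hM.frame.left
  have hM' : x ∉ boxEdges M := by
    intro hc
    obtain ⟨t, ht, rfl⟩ := mem_boxEdges.1 hc
    rcases ht.cases_of_isFrame hM.frame with rfl | rfl | rfl | rfl
    · exact not_isBoundaryEdge hw hMG (by rw [← hz0]; exact hzG 0 (by omega)) hx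
    · exact not_isBoundaryEdge hw.neg hMG
        (by rw [← sub_eq_add_neg, ← hzr]; exact hzG r le_rfl) hx
    · exact hM.not_wall hxH
    · exact hM.not_wall_neg hxH
  have hZ' : x ∉ boxEdges (z k) := by
    intro hc
    obtain ⟨t, ht, rfl⟩ := mem_boxEdges.1 hc
    rcases ht.cases_of_isFrame hZ.frame with rfl | rfl | rfl | rfl
    · exact not_isBoundaryEdge hZ.frame.left (hzG k hkr.le) he hx
    · exact not_isBoundaryEdge hZ.frame.left.neg (hzG k hkr.le) he' hx
    · exact hZ.not_wall hxH
    · exact hZ.not_wall_neg hxH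
  rw [mem_switch_of_notMem hZ', mem_switch_of_notMem hM']
  exact hxH

end Moves

/-! ### Collecting a small cookie -/

section Collect

variable {m n : ℕ} {H : EdgeSet}

lemma wall_double_switch {t : ℤ × ℤ} (ht : IsUnitVec t) {B K D : Box} :
    Wall (switch (switch H K) D) B t ↔
      ¬(¬(Wall H B t ↔ (K = B ∨ K = B + t)) ↔ (D = B ∨ D = B + t)) := by
  rw [wall_switch ht, wall_switch ht]

lemma IsFrame.add_ne (h : IsFrame a b) (B : Box) : B + a ≠ B + b :=
  fun hc => h.ne (by simpa using hc)

lemma IsFrame.add_ne_neg (h : IsFrame a b) (B : Box) : B + a ≠ B + -b :=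
  fun hc => h.ne_neg (by simpa using hc)

lemma corner_of_edge {a b v x : ℤ × ℤ} (hH : IsGridHamCycle m n H) {D : Box}
    (hD : D ∈ gridBoxes m n) (hf : IsFrame a b) (ha : Wall H D a) (hb : Wall H D b)
    (hv : v = corner D a b) (hx : s(v, x) ∈ H) :
    s(v, x) = side D a ∨ s(v, x) = side D b := by
  obtain ⟨h1, h2⟩ := corner_of_of hH hD hf ha hb
  rw [Wall, side_add_eq_corner hf.symm, corner_symm] at h1
  rw [Wall, side_add_eq_corner hf] at h2
  rw [side_eq_corner hf, side_eq_corner hf.symm, corner_symm D b a]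
  obtain ⟨t, rfl⟩ : ∃ t, x = v + t := ⟨x - v, by simp⟩
  have ht := isLattice_of_subset hH.1 _ _ hx
  rw [add_sub_cancel_left] at ht
  subst hv
  rcases ht.cases_of_isFrame hf with rfl | rfl | rfl | rfl
  · exact absurd hx h1
  · exact Or.inr (by rw [sub_eq_add_neg])
  · exact absurd hx h2
  · exact Or.inl (by rw [sub_eq_add_neg])

/-- A small cookie `D` that is opposite to a further edge of `H` can be collected: the cookie is
filled, and its two inner vertices are inserted into this edge. -/
theorem cascadeStep_collect {a b : ℤ × ℤ} (hH : IsGridHamCycle m n H) {D : Box}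
    (hf : IsFrame a b) (hD : D ∈ gridBoxes m n) (hK : D + b ∈ gridBoxes m n)
    (hDa : D + a ∈ gridBoxes m n) (hDa' : D + -a ∈ gridBoxes m n)
    (hKb : D + b + b ∈ gridBoxes m n)
    (h1 : Wall H D a) (h2 : Wall H D (-a)) (h3 : Wall H D b) (h4 : ¬Wall H D (-b))
    (h5 : Wall H (D + b) b) :
    CascadeStep m n H (switch (switch H (D + b)) D) := by
  classical
  have ha := hf.left
  have hb := hf.right
  have h6 : ¬Wall H (D + b) a := (corner_of_of hH hD hf h1 h3).2
  have h7 : ¬Wall H (D + b) (-a) := (corner_of_of hH hD hf.neg_left h2 h3).2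
  have hcK : IsCorridor H (D + b) b a := ⟨hf.symm, h5, (wall_neg hb).2 h3, h6, h7⟩
  have hne : D + b ≠ D := (add_ne_self hb).symm
  have hcD : IsCorridor (switch H (D + b)) D a b := by
    refine ⟨hf, ?_, ?_, ?_, ?_⟩
    · rwa [wall_switch_of_ne ha hne (hf.symm.add_ne D)]
    · rwa [wall_switch_of_ne ha.neg hne (hf.symm.add_ne_neg D)]
    · rw [wall_switch hb]
      simp [h3]
    · rwa [wall_switch_of_ne hb.neg hne (fun h => hb.ne_neg (by simpa using h))]
  have hsub1 : switch H (D + b) ⊆ gridEdges m n := switch_subset hH.1 hK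
  have hsub2 : switch (switch H (D + b)) D ⊆ gridEdges m n := switch_subset hsub1 hD
  set H' := switch (switch H (D + b)) D with hH'
  have w1 : Wall H' D (-b) := (wall_switch_self hb.neg).2 hcD.not_wall_neg
  have w2 : Wall H' D b := (wall_switch_self hb).2 hcD.not_wall
  have w3 : ∀ t, t = a ∨ t = -a → Wall H' (D + b) t := by
    intro t ht
    have ht' : IsUnitVec t := by rcases ht with rfl | rfl; exacts [ha, ha.neg]
    have hft : IsFrame t b := by rcases ht with rfl | rfl; exacts [hf, hf.neg_left]
    rw [hH', wall_switch_of_ne ht' hne.symm, wall_switch_self ht']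
    · rcases ht with rfl | rfl; exacts [h6, h7]
    · rw [add_assoc]
      exact fun h => hft.symm.add_ne_zero (by simpa using h)
  have hkeep : ∀ e, e ∉ boxEdges D → e ∉ boxEdges (D + b) → (e ∈ H' ↔ e ∈ H) := by
    intro e he he'
    rw [hH', mem_switch_of_notMem he, mem_switch_of_notMem he']
  -- the edges of the two boxes that are in `H`
  have hedges : ∀ e ∈ H, e ∈ boxEdges D ∨ e ∈ boxEdges (D + b) →
      e = side D a ∨ e = side D (-a) ∨ e = side D b ∨ e = side (D + b) b := by
    rintro e heH (he | he)
    · obtain ⟨t, ht, rfl⟩ := mem_boxEdges.1 he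
      rcases ht.cases_of_isFrame hf with rfl | rfl | rfl | rfl
      · simp
      · simp
      · simp
      · exact absurd heH h4
    · obtain ⟨t, ht, rfl⟩ := mem_boxEdges.1 he
      rcases ht.cases_of_isFrame hf with rfl | rfl | rfl | rfl
      · exact absurd heH h6
      · exact absurd heH h7
      · simp
      · rw [side_neg hb]
        simp
  have hH'cyc : IsGridHamCycle m n H' := by
    have hm0 : 0 < m ∧ 0 < n := by
      have := hD
      simp only [gridBoxes, Set.mem_ofPred_eq] at this
      omega
    -- the retraction of the two inner vertices of the cookie to its outer vertices
    let f : Vtx → Vtx := fun v => if v = corner D a b then corner D a (-b) else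
      if v = corner D (-a) b then corner D (-a) (-b) else v
    have hf1 : f (corner D a b) = corner D a (-b) := if_pos rfl
    have hane : corner D (-a) b ≠ corner D a b := by
      rw [corner_symm, corner_neg hf.symm, corner_symm]
      exact fun h => ha.ne_zero (by simpa using h)
    have hf2 : f (corner D (-a) b) = corner D (-a) (-b) := by
      simp only [f, if_neg hane, if_true]
    have hf3 : ∀ v, v ≠ corner D a b → v ≠ corner D (-a) b → f v = v := fun v hv hv' => by
      simp only [f, if_neg hv, if_neg hv']
    have hw1 : (fromEdgeSet H').Reachable (corner D a (-b)) (corner D (-a) (-b)) := by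
      refine reachable_of_mem ?_
      rw [corner_symm, corner_symm _ (-a), ← side_eq_corner' hf.symm.neg_left]
      exact w1
    have key : ∀ v x, s(v, x) ∈ H → s(v, x) ≠ side (D + b) b →
        (fromEdgeSet H').Reachable (f v) (f x) := by
      intro v x hvx hne
      by_cases hc : s(v, x) ∈ boxEdges D ∨ s(v, x) ∈ boxEdges (D + b)
      · rcases hedges _ hvx hc with h | h | h | h
        · rw [side_eq_corner' hf] at h
          have h' : f (corner D a (-b)) = corner D a (-b) := by
            refine hf3 _ ?_ ?_ <;> rw [corner_neg hf]
            · exact fun h => hb.ne_zero (by simpa using h)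
            · rw [corner_symm D (-a), corner_neg hf.symm, corner_symm]
              exact fun h => hf.ne (by simpa using h.symm)
          rcases Sym2.eq_iff.1 h with ⟨rfl, rfl⟩ | ⟨rfl, rfl⟩ <;> rw [hf1, h']
        · rw [side_eq_corner' hf.neg_left] at h
          have h' : f (corner D (-a) (-b)) = corner D (-a) (-b) := by
            refine hf3 _ ?_ ?_ <;> rw [corner_neg hf.neg_left]
            · rw [corner_symm D (-a), corner_neg hf.symm, corner_symm, sub_sub]
              exact fun h => hf.add_ne_zero (by simpa using h)
            · exact fun h => hb.ne_zero (by simpa using h)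
          rcases Sym2.eq_iff.1 h with ⟨rfl, rfl⟩ | ⟨rfl, rfl⟩ <;> rw [hf2, h']
        · rw [side_eq_corner' hf.symm, corner_symm, corner_symm _ b] at h
          rcases Sym2.eq_iff.1 h with ⟨rfl, rfl⟩ | ⟨rfl, rfl⟩ <;> rw [hf1, hf2]
          exacts [hw1, hw1.symm]
        · exact absurd h hne
      · rw [not_or] at hc
        have hoff : ∀ v x, s(v, x) ∈ H → s(v, x) ∉ boxEdges D → f v = v := by
          intro v x hvx hc
          refine hf3 v (fun hv => ?_) (fun hv => ?_)
          · rcases corner_of_edge hH hD hf h1 h3 hv hvx with h | h <;> rw [h] at hc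
            · exact hc (mem_boxEdges.2 ⟨a, ha, rfl⟩)
            · exact hc (mem_boxEdges.2 ⟨b, hb, rfl⟩)
          · rcases corner_of_edge hH hD hf.neg_left h2 h3 hv hvx with h | h <;> rw [h] at hc
            · exact hc (mem_boxEdges.2 ⟨-a, ha.neg, rfl⟩)
            · exact hc (mem_boxEdges.2 ⟨b, hb, rfl⟩)
        rw [hoff v x hvx hc.1, hoff x v (by rwa [Sym2.eq_swap]) (by rw [Sym2.eq_swap]; exact hc.1)]
        exact reachable_of_mem ((hkeep _ hc.1 hc.2).2 hvx)
    have hall : ∀ v ∈ gridVerts m n,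
        (fromEdgeSet H').Reachable (f v) (f (corner (D + b) a b)) := by
      intro v hv
      have hreg := (isHamCycle_iff (finite_gridVerts m n) ⟨v, hv⟩).1 hH.2
      obtain ⟨p⟩ := hreg.reachable_diff (finite_gridVerts m n)
        (a := corner (D + b) b a) (b := corner (D + b) b (-a))
        (by rw [← side_eq_corner' hf.symm]; exact h5) hv (corner_mem_gridVerts hK hf)
      generalize corner (D + b) a b = x at p
      clear hv
      induction p with
      | nil => exact Reachable.refl _
      | cons hxy p ih =>
        rw [fromEdgeSet_adj, ← side_eq_corner' hf.symm] at hxy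
        exact (key _ _ hxy.1.1 hxy.1.2).trans ih
    have hcK1 : corner (D + b) a (-b) = corner D a b := corner_add_neg hf D
    have hcK2 : corner (D + b) (-a) (-b) = corner D (-a) b := corner_add_neg hf.neg_left D
    have hKa : corner (D + b) a b = corner D a b + b := by
      rw [← hcK1, corner_neg hf, sub_add_cancel]
    have hKa' : corner (D + b) (-a) b = corner D (-a) b + b := by
      rw [← hcK2, corner_neg hf.neg_left, sub_add_cancel]
    have hDD : corner D (-a) b = corner D a b - a := by
      rw [corner_symm, corner_neg hf.symm, corner_symm]
    have hr1 : (fromEdgeSet H').Reachable (corner D a b) (corner (D + b) a b) := by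
      refine reachable_of_mem ?_
      rw [← hcK1, Sym2.eq_swap, ← side_eq_corner' hf]
      exact w3 a (Or.inl rfl)
    have hr2 : (fromEdgeSet H').Reachable (corner D (-a) b) (corner (D + b) (-a) b) := by
      refine reachable_of_mem ?_
      rw [← hcK2, Sym2.eq_swap, ← side_eq_corner' hf.neg_left]
      exact w3 (-a) (Or.inr rfl)
    have hfx : f (corner (D + b) a b) = corner (D + b) a b := by
      refine hf3 _ ?_ ?_ <;> rw [hKa]
      · exact fun h => hb.ne_zero (by simpa using h)
      · rw [hDD, sub_eq_add_neg]
        exact fun h => hf.symm.ne_neg (by simpa using h)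
    have hfy : f (corner (D + b) (-a) b) = corner (D + b) (-a) b := by
      refine hf3 _ ?_ ?_ <;> rw [hKa']
      · rw [hDD]
        exact fun h => hf.ne (by rwa [sub_add, sub_eq_self, sub_eq_zero] at h)
      · exact fun h => hb.ne_zero (by simpa using h)
    have hall' : ∀ v ∈ gridVerts m n, (fromEdgeSet H').Reachable v (corner (D + b) a b) := by
      intro v hv
      by_cases hv1 : v = corner D a b
      · rw [hv1]
        exact hr1
      by_cases hv2 : v = corner D (-a) b
      · rw [hv2]
        refine hr2.trans ?_
        have := hall _ (corner_mem_gridVerts hK hf.neg_left)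
        rwa [hfx, hfy] at this
      · have := hall v hv
        rwa [hfx, hf3 v hv1 hv2] at this
    refine (isGridHamCycle_iff hm0.1 hm0.2).2 ⟨hsub2, fun v hv => ?_, fun v hv x hx =>
      (hall' v hv).trans (hall' x hx).symm⟩
    rw [hH', hcD.deg_switch, hcK.deg_switch, hH.deg_eq_two hv]
  refine ⟨D + b, D, ⟨hK, hD, hcK.switchable, hcD.switchable, hH'⟩, hH'cyc, Or.inr ?_⟩
  refine not_createsCookie fun e he heH => ?_
  by_cases hc : e ∈ boxEdges D ∨ e ∈ boxEdges (D + b)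
  · exfalso
    rcases hedges e heH hc with rfl | rfl | rfl | rfl
    · exact not_isBoundaryEdge ha hD hDa he
    · exact not_isBoundaryEdge ha.neg hD hDa' he
    · exact not_isBoundaryEdge hb hD hK he
    · exact not_isBoundaryEdge hb hK hKb he
  · rw [not_or] at hc
    exact (hkeep e hc.1 hc.2).2 heH

end Collect

/-! ### Paths between the end-boxes of an `A₁`-type -/

section Loop

variable {m n : ℕ} {H : EdgeSet}

lemma corner_of_not_of_not' {B : Box} {a b : ℤ × ℤ} (hH : IsGridHamCycle m n H)
    (hB : B ∈ gridBoxes m n) (hab : IsFrame a b) (ha : ¬Wall H B a) (hb : ¬Wall H (B + a) b) :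
    Wall H B b ∧ Wall H (B + b) a := by
  have h := corner_rule hH hB hab
  rw [ind_of_false ha, ind_of_false hb] at h
  constructor <;> by_contra hc <;> rw [ind_of_false hc] at h
  · have := ind_le_one (Wall H (B + b) a); omega
  · have := ind_le_one (Wall H B b); omega

lemma mem_slide {B : Box} {a b : ℤ × ℤ} (h : IsFrame a b) (ha : B + a ∈ gridBoxes m n)
    (hb : B + b ∈ gridBoxes m n) : B + a + b ∈ gridBoxes m n :=
  (gridBoxes_rect h ha hb).2

lemma notMem_slide {B : Box} {a b : ℤ × ℤ} (h : IsFrame a b) (hB : B ∈ gridBoxes m n)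
    (hb : B + b ∉ gridBoxes m n) : B + a + b ∉ gridBoxes m n := by
  intro hc
  refine hb (gridBoxes_rect (B := B + b) (a := a) (b := -b) h.neg_right ?_ ?_).1
  · rwa [add_right_comm]
  · rwa [add_neg_cancel_right]

lemma mem_gridBoxes_of_interior_of_not_wall (hH : IsGridHamCycle m n H) {B : Box} {t : ℤ × ℤ}
    (ht : IsUnitVec t) (hB : B ∈ interiorBoxes H) (h : ¬Wall H B t) : B + t ∈ gridBoxes m n :=
  mem_gridBoxes_of_mem_interior hH ((mem_interior_iff_of_not_wall hH ht h).2 hB)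

lemma not_wall_of_notMem_interior (hH : IsGridHamCycle m n H) {B : Box} {t : ℤ × ℤ}
    (ht : IsUnitVec t) (hB : B ∉ interiorBoxes H) (h : B + t ∉ interiorBoxes H) : ¬Wall H B t := by
  rw [wall_iff hH ht]
  tauto

/-- The `H`-path `z 0, …, z r` in the grid joins the two boxes at the sides of the middle box `M` of
an `A₁`-type, whose legs point in the direction `u`, and there is no cascade of length at most three after which the lower side of `M` is
in the Hamiltonian cycle. -/
structure IsLoop (m n : ℕ) (H : EdgeSet) (w u : ℤ × ℤ) (M : Box) (r : ℕ) (z : ℕ → Box) :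
    Prop where
  ham : IsGridHamCycle m n H
  corridor : IsCorridor H M w u
  mem_mid : M ∈ gridBoxes m n
  mem_above : M + u ∈ gridBoxes m n
  wing : Wall H (M + w) (-u)
  wing' : Wall H (M + -w) (-u)
  leg : Wall H (M + u) w
  leg' : Wall H (M + u) (-w)
  start : z 0 = M + w
  finish : z r = M + -w
  step : ∀ i < r, ∃ t, IsUnitVec t ∧ z (i + 1) = z i + t ∧ ¬Wall H (z i) t
  mem : ∀ i ≤ r, z i ∈ gridBoxes m n
  inj : ∀ i ≤ r, ∀ k ≤ r, z i = z k → i = k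
  noWeak : ∀ l H', l ≤ 3 → Cascade m n l H H' → ¬Wall H' M (-u)

namespace IsLoop

variable {w u : ℤ × ℤ} {M : Box} {r : ℕ} {z : ℕ → Box} (L : IsLoop m n H w u M r z)

include L

/-- The mirror image of the situation: the path is run through from its end to its start. -/
lemma flip : IsLoop m n H (-w) u M r (fun i => z (r - i)) where
  ham := L.ham
  corridor := L.corridor.neg_left
  mem_mid := L.mem_mid
  mem_above := L.mem_above
  wing := L.wing'
  wing' := by rw [neg_neg]; exact L.wing
  leg := L.leg'
  leg' := by rw [neg_neg]; exact L.leg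
  start := by simpa using L.finish
  finish := by simpa using L.start
  step := by
    intro i hi
    obtain ⟨t, ht, h1, h2⟩ := L.step (r - (i + 1)) (by omega)
    rw [show r - (i + 1) + 1 = r - i by omega] at h1
    refine ⟨-t, ht.neg, by simp only [h1, add_neg_cancel_right], ?_⟩
    simp only [h1]
    rwa [wall_neg ht]
  mem := fun i _ => L.mem _ (by omega)
  inj := by
    intro i hi k hk h
    have := L.inj _ (by omega) _ (by omega) h
    omega
  noWeak := L.noWeak

lemma wall_start : Wall H (M + w) (-w) := (wall_neg L.corridor.frame.left).2 L.corridor.wall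

lemma not_wall_start : ¬Wall H (M + w) u := fun h =>
  (corner_of_of_not L.ham L.mem_mid L.corridor.frame L.corridor.wall L.corridor.not_wall).1 h L.leg

lemma pos : 0 < r := by
  by_contra h
  have h1 := L.start.symm.trans ((congrArg z (by omega : 0 = r)).trans L.finish)
  exact L.corridor.frame.left.ne_neg (by simpa using h1)

lemma open_step {i : ℕ} {a : ℤ × ℤ} (hi : i < r) (h : z (i + 1) = z i + a) :
    IsUnitVec a ∧ ¬Wall H (z i) a ∧ ¬Wall H (z (i + 1)) (-a) := by
  obtain ⟨t, ht, h1, h2⟩ := L.step i hi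
  obtain rfl : a = t := by rw [h] at h1; simpa using h1
  refine ⟨ht, h2, ?_⟩
  rwa [h, wall_neg ht]

lemma next {i : ℕ} {a b : ℤ × ℤ} (hf : IsFrame a b) (hi : i + 1 < r) (h : z (i + 1) = z i + a) :
    (z (i + 2) = z (i + 1) + a ∧ ¬Wall H (z (i + 1)) a) ∨
    (z (i + 2) = z (i + 1) + b ∧ ¬Wall H (z (i + 1)) b) ∨
    (z (i + 2) = z (i + 1) + -b ∧ ¬Wall H (z (i + 1)) (-b)) := by
  obtain ⟨t, ht, h1, h2⟩ := L.step (i + 1) hi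
  rcases ht.cases_of_isFrame hf with rfl | rfl | rfl | rfl
  · exact Or.inl ⟨h1, h2⟩
  · have := L.inj (i + 2) (by omega) i (by omega) (by rw [h1, h]; abel)
    omega
  · exact Or.inr (Or.inl ⟨h1, h2⟩)
  · exact Or.inr (Or.inr ⟨h1, h2⟩)

/-- An inner box of the path cannot have walls on two opposite sides inside the grid: a single
double switch would place the lower side of `M` in the cycle. -/
lemma not_walls {k : ℕ} {e : ℤ × ℤ} (hk0 : 0 < k) (hkr : k < r) (he : IsUnitVec e)
    (h1 : Wall H (z k) e) (h2 : Wall H (z k) (-e)) (g1 : z k + e ∈ gridBoxes m n)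
    (g2 : z k + -e ∈ gridBoxes m n) : False := by
  obtain ⟨i, rfl⟩ : ∃ i, k = i + 1 := ⟨k - 1, by omega⟩
  obtain ⟨a, ha, h3, h4⟩ := L.step i (by omega)
  have h5 := (L.open_step (by omega) h3).2.2
  have hf : IsFrame a e := by
    rcases he.trichotomy ha with rfl | rfl | hf
    · exact absurd h2 h5
    · exact absurd h1 (by rwa [neg_neg] at h5)
    · exact hf.symm
  rcases L.next hf hkr h3 with ⟨h6, h7⟩ | ⟨-, h7⟩ | ⟨-, h7⟩
  · obtain ⟨H', h8, h9⟩ := cascadeStep_doubleSwitch L.ham L.corridor L.mem_mid L.start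
      (by rw [L.finish, sub_eq_add_neg]) L.step L.mem L.inj hk0 hkr (e := e) (d := a)
      ⟨hf.symm, h1, h2, h7, h5⟩ h6 g1 g2
    exact L.noWeak 1 H' (by omega) (Cascade.cons h8 (Cascade.nil _)) h9
  · exact h7 h1
  · exact h7 h2

/-- If two consecutive boxes at the end of the path are joined in the direction `d`, it is impossible
that the last one has both walls parallel to `d` and the one before has none: the leg of the
`A₁`-type is in the way. -/
lemma not_walls_finish {k : ℕ} {d e : ℤ × ℤ} (hf : IsFrame d e) (hk : k + 1 = r)
    (h : z (k + 1) = z k + d) (h1 : Wall H (z (k + 1)) e) (h2 : Wall H (z (k + 1)) (-e))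
    (n1 : ¬Wall H (z k) e) (n2 : ¬Wall H (z k) (-e)) : False := by
  subst hk
  have h3 := (L.open_step k.lt_succ_self h).2.2
  rw [L.finish] at h1 h2 h h3
  have hu : ¬Wall H (M + -w) u := L.flip.not_wall_start
  have hw : Wall H (M + -w) w := by simpa using L.flip.wall_start
  have hu' := L.wing'
  have hk' : z k = M + -w + -d := by rw [h, add_neg_cancel_right]
  have hleg : Wall H (M + -w + u) w := by
    have := (wall_neg L.corridor.frame.left.neg).2 L.leg'
    rwa [neg_neg, add_right_comm] at this
  rw [hk'] at n1 n2
  rcases hf.left.cases_of_isFrame L.corridor.frame with rfl | rfl | rfl | rfl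
  · rcases hf.right.cases_of_isFrame L.corridor.frame with rfl | rfl | rfl | rfl
    · exact hf.ne rfl
    · exact hf.ne_neg (by simp)
    · exact hu h1
    · exact hu (by simpa using h2)
  · rw [neg_neg] at h3
    exact h3 hw
  · exact h3 hu'
  · rw [neg_neg] at n1 n2
    rcases hf.right.cases_of_isFrame L.corridor.frame with rfl | rfl | rfl | rfl
    · exact n1 hleg
    · exact n2 (by simpa using hleg)
    · exact hf.ne_neg (by simp)
    · exact hf.ne rfl

/-- A version of `not_walls` that also covers the last box of the path. -/
lemma walls_prev {k : ℕ} {d e : ℤ × ℤ} (hf : IsFrame d e) (hk : k < r) (h : z (k + 1) = z k + d)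
    (h1 : Wall H (z (k + 1)) e) (h2 : Wall H (z (k + 1)) (-e))
    (g1 : z (k + 1) + e ∈ gridBoxes m n) (g2 : z (k + 1) + -e ∈ gridBoxes m n)
    (n1 : ¬Wall H (z k) e) (n2 : ¬Wall H (z k) (-e)) : False := by
  rcases Nat.lt_or_ge (k + 1) r with hlt | hge
  · exact L.not_walls (by omega) hlt hf.right h1 h2 g1 g2
  · exact L.not_walls_finish hf (by omega) h h1 h2 n1 n2

lemma adj_step {i : ℕ} (hi : i < r) : (boxGraph m n H).Adj (z i) (z (i + 1)) := by
  obtain ⟨t, ht, h1, h2⟩ := L.step i hi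
  exact boxGraph_adj.2 ⟨L.mem i hi.le, L.mem _ hi, t, ht, h1, h2⟩

lemma grown {k : ℕ} (hk : k ≤ r) : Grown (boxGraph m n H) {x | ∃ i ≤ k, z i = x} := by
  induction k with
  | zero =>
    convert Grown.single (z 0)
    ext x
    simp [eq_comm]
  | succ k ih =>
    convert (ih (by omega)).insert (A := z k) (C := z (k + 1)) ⟨k, le_rfl, rfl⟩ ?_
      (L.adj_step (by omega))
    · ext x
      constructor
      · rintro ⟨i, hi, rfl⟩
        rcases Nat.lt_or_ge i (k + 1) with h | h
        · exact Or.inr ⟨i, by omega, rfl⟩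
        · obtain rfl : i = k + 1 := by omega
          exact Or.inl rfl
      · rintro (rfl | ⟨i, hi, rfl⟩)
        · exact ⟨k + 1, le_rfl, rfl⟩
        · exact ⟨i, by omega, rfl⟩
    · rintro ⟨i, hi, h⟩
      have := L.inj i (by omega) (k + 1) hk h
      omega

/-- The path has no chords, since the box graph is a forest. -/
lemma eq_succ_of_adj {l k : ℕ} (hk : k ≤ r) (hlk : l < k) (h : (boxGraph m n H).Adj (z k) (z l)) :
    k = l + 1 := by
  obtain ⟨i, rfl⟩ : ∃ i, k = i + 1 := ⟨k - 1, by omega⟩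
  have h1 : z l = z i := (L.grown (k := i) (by omega)).eq_of_adj (isAcyclic_boxGraph L.ham)
    ⟨l, by omega, rfl⟩ ⟨i, le_rfl, rfl⟩ (by
      rintro ⟨x, hx, hx'⟩
      have := L.inj x (by omega) _ hk hx'
      omega) h (L.adj_step (by omega)).symm
  rw [L.inj l (by omega) i (by omega) h1]

lemma adj_consecutive {l k : ℕ} (hl : l ≤ r) (hk : k ≤ r) (h : (boxGraph m n H).Adj (z l) (z k)) :
    l = k + 1 ∨ k = l + 1 := by
  rcases lt_trichotomy l k with hlk | rfl | hlk
  · exact Or.inr (L.eq_succ_of_adj hk hlk h.symm)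
  · exact absurd h ((boxGraph m n H).irrefl)
  · exact Or.inl (L.eq_succ_of_adj hl hlk h)

lemma interior_iff {i : ℕ} (hi : i ≤ r) : z i ∈ interiorBoxes H ↔ M ∉ interiorBoxes H := by
  induction i with
  | zero => rw [L.start]; exact mem_interior_iff_of_wall L.ham L.corridor.frame.left L.corridor.wall
  | succ i ih =>
    obtain ⟨t, ht, h1, h2⟩ := L.step i hi
    rw [h1, mem_interior_iff_of_not_wall L.ham ht h2]
    exact ih (by omega)

end IsLoop

end Loop

/-! ### Paths along the boundary of the grid -/

section Hugging

variable {m n : ℕ} {H : EdgeSet}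

lemma notMem_add_add {B : Box} {t : ℤ × ℤ} (ht : IsUnitVec t) (hB : B ∈ gridBoxes m n)
    (h : B + t ∉ gridBoxes m n) : B + t + t ∉ gridBoxes m n := by
  obtain ⟨x, y⟩ := B
  rcases ht with rfl | rfl | rfl | rfl <;> simp [gridBoxes] at hB h ⊢ <;> omega

lemma mem_add_add_of_boundary (hm : 5 ≤ m) (hn : 5 ≤ n) {B : Box} {t : ℤ × ℤ} (ht : IsUnitVec t)
    (hB : B ∈ gridBoxes m n) (h : B + -t ∉ gridBoxes m n) : B + t + t ∈ gridBoxes m n := by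
  obtain ⟨x, y⟩ := B
  rcases ht with rfl | rfl | rfl | rfl <;> simp [gridBoxes] at hB h ⊢ <;> omega

/-- An exterior box `D` in a row at the boundary is open to the outside. By the corner rule at the
boundary it has walls along the row, so that the boxes beside it are in the interior. -/
lemma small_cookie_walls (hH : IsGridHamCycle m n H) {D : Box} {a b : ℤ × ℤ} (hf : IsFrame a b)
    (hD : D ∈ gridBoxes m n) (hDb : D + -b ∉ gridBoxes m n) (hDI : D ∉ interiorBoxes H) :
    ¬Wall H D (-b) ∧ Wall H D a ∧ D + a ∈ interiorBoxes H := by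
  have hout : ∀ {B : Box}, B ∉ gridBoxes m n → B ∉ interiorBoxes H := fun h h' =>
    h (mem_gridBoxes_of_mem_interior hH h')
  have h1 : ¬Wall H D (-b) := not_wall_of_notMem_interior hH hf.right.neg hDI (hout hDb)
  have h2 : D + -b + a ∉ gridBoxes m n := by
    rw [add_right_comm]
    exact notMem_slide hf.neg_right hD hDb
  have h3 := (corner_of_not_of_not' hH hD hf.neg_right.symm h1
    (not_wall_of_notMem_interior hH hf.left (hout hDb) (hout h2))).1
  exact ⟨h1, h3, (mem_interior_iff_of_wall hH hf.left h3).2 hDI⟩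

/-- The path enters in the direction `a` a box on the boundary, which has a wall on the inner side
`b`. -/
structure IsHugging (m n : ℕ) (H : EdgeSet) (r : ℕ) (z : ℕ → Box) (i : ℕ) (a b : ℤ × ℤ) : Prop where
  frame : IsFrame a b
  lt : i < r
  step : z (i + 1) = z i + a
  boundary : z (i + 1) + -b ∉ gridBoxes m n
  wall : Wall H (z (i + 1)) b

/-- The path passes in the direction `a`, in the second row from the boundary, around a small
cookie. -/
structure IsPassing (m n : ℕ) (H : EdgeSet) (r : ℕ) (z : ℕ → Box) (i : ℕ) (a b : ℤ × ℤ) : Prop where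
  frame : IsFrame a b
  lt : i < r
  step : z (i + 1) = z i + a
  wall : Wall H (z (i + 1)) b
  not_wall : ¬Wall H (z (i + 1)) (-b)
  mem : z (i + 1) + -b ∈ gridBoxes m n
  boundary : z (i + 1) + -b + -b ∉ gridBoxes m n
  wall_below : Wall H (z (i + 1) + -b) (-a)

namespace IsLoop

variable {w u : ℤ × ℤ} {M : Box} {r : ℕ} {z : ℕ → Box} (L : IsLoop m n H w u M r z)

include L

/-- The boxes of the path in the two rows next to a side of the grid are inner boxes. -/
lemma inner (hfar : ∀ e, IsUnitVec e → M + w + e + e ∈ gridBoxes m n ∧ M + -w + e + e ∈ gridBoxes m n)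
    {k : ℕ} (hk : k ≤ r) {e : ℤ × ℤ} (he : IsUnitVec e) (h : z k + e + e ∉ gridBoxes m n) :
    0 < k ∧ k < r := by
  constructor
  · by_contra hc
    obtain rfl : k = 0 := by omega
    rw [L.start] at h
    exact h (hfar e he).1
  · by_contra hc
    obtain rfl : k = r := by omega
    rw [L.finish] at h
    exact h (hfar e he).2

lemma ne_of_notMem {B : Box} (hI : M ∉ interiorBoxes H) (hB : B ∉ interiorBoxes H) {k : ℕ} (hk : k ≤ r) :
    B ≠ z k := by
  rintro rfl
  exact hB ((L.interior_iff hk).2 hI)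

/-- If the path turns inward next to a small cookie `D` and the box `D + b` has a wall on its inner
side, collecting the small cookie prepares a double switch of `M` with the box before the turn. -/
lemma not_collect (hI : M ∉ interiorBoxes H) {k : ℕ} {a b : ℤ × ℤ} (hf : IsFrame a b)
    (hk : k + 1 < r) (hprev : z (k + 1) = z k + b) (hnext : z (k + 2) = z (k + 1) + b)
    {D : Box} (hD : D = z k + a) (hDG : D ∈ gridBoxes m n) (hDa : D + a ∈ gridBoxes m n)
    (hDb : D + -b ∉ gridBoxes m n) (hDI : D ∉ interiorBoxes H) (h1 : Wall H D a)
    (h2 : Wall H D (-a)) (h3 : Wall H D b) (h4 : ¬Wall H D (-b)) (h5 : Wall H (D + b) b)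
    (h6 : Wall H (z (k + 1)) (-a)) (h7 : ¬Wall H (z (k + 1)) a)
    (hZ : z (k + 1) + -a ∈ gridBoxes m n) : False := by
  have ha := hf.left
  have hb := hf.right
  have hK : D + b = z (k + 1) + a := by rw [hprev, hD, add_right_comm]
  have hKI : D + b ∈ interiorBoxes H := (mem_interior_iff_of_wall L.ham hb h3).2 hDI
  have hKG := mem_gridBoxes_of_mem_interior L.ham hKI
  have hKb : D + b + b ∈ gridBoxes m n := by
    rw [hK]
    exact mem_slide hf (by rwa [← hK]) (by rw [← hnext]; exact L.mem _ hk)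
  have hDz : ∀ l ≤ r, D ≠ z l := fun l hl => L.ne_of_notMem hI hDI hl
  have hKz : ∀ l ≤ r, D + b ≠ z l := by
    intro l hl h
    have hadj : (boxGraph m n H).Adj (z (k + 1)) (z l) := by
      rw [← h, hK]
      exact boxGraph_adj_add (L.mem _ hk.le) ha (by rwa [← hK]) h7
    rcases L.adj_consecutive hk.le hl hadj with h' | rfl
    · obtain rfl : l = k := by omega
      have : a = -b := by simpa [hprev, add_assoc, add_eq_zero_iff_eq_neg'] using hK.symm.trans h
      exact hf.ne_neg this
    · rw [hK, hnext] at h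
      exact hf.ne (by simpa using h)
  have hstep := cascadeStep_collect L.ham hf hDG hKG hDa
    (by rw [hD, add_neg_cancel_right]; exact L.mem _ (by omega)) hKb h1 h2 h3 h4 h5
  obtain ⟨-, -, -, hham, -⟩ := id hstep
  have hkeep : ∀ {B : Box} {t : ℤ × ℤ}, IsUnitVec t → D ≠ B → D ≠ B + t → D + b ≠ B →
      D + b ≠ B + t → (Wall (switch (switch H (D + b)) D) B t ↔ Wall H B t) := by
    intro B t ht g1 g2 g3 g4
    rw [wall_double_switch ht]
    tauto
  have hMK : D + b ≠ M := fun h => hI (h ▸ hKI)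
  have hMD : D ≠ M := by
    rintro rfl
    have hu := L.corridor.not_wall
    have hu' := L.corridor.not_wall_neg
    rcases L.corridor.frame.right.cases_of_isFrame hf with h | h | h | h
    · exact hu (h ▸ h1)
    · exact hu (h ▸ h2)
    · exact hu (h ▸ h3)
    · exact hu' (by rw [h, neg_neg]; exact h3)
  have hMt : ∀ {s : ℤ × ℤ}, IsUnitVec s → ¬Wall H M s →
      (Wall (switch (switch H (D + b)) D) M s ↔ Wall H M s) := by
    intro s hs hs'
    refine hkeep hs hMD ?_ hMK ?_
    · rintro rfl
      have h8 : ¬Wall H (M + s) (-s) := by rwa [wall_neg hs]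
      rcases hs.neg.cases_of_isFrame hf with h | h | h | h
      · exact h8 (h ▸ h1)
      · exact h8 (h ▸ h2)
      · exact h8 (h ▸ h3)
      · rw [neg_inj] at h
        subst h
        rw [add_neg_cancel_right] at hDb
        exact hDb L.mem_mid
    · intro h
      exact hI ((mem_interior_iff_of_not_wall L.ham hs hs').1 (h ▸ hKI))
  have hc := L.corridor
  have h0 := L.start ▸ hDz 0 (by omega)
  have h0' := L.start ▸ hKz 0 (by omega)
  have hr := L.finish ▸ hDz r le_rfl
  have hr' := L.finish ▸ hKz r le_rfl
  have hcor : IsCorridor (switch (switch H (D + b)) D) M w u :=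
    ⟨hc.frame, (hkeep hc.frame.left hMD h0 hMK h0').2 hc.wall,
      (hkeep hc.frame.left.neg hMD hr hMK hr').2 hc.wall_neg,
      fun h => hc.not_wall ((hMt hc.frame.right hc.not_wall).1 h),
      fun h => hc.not_wall_neg ((hMt hc.frame.right.neg hc.not_wall_neg).1 h)⟩
  have hzstep : ∀ i < r, ∃ t, IsUnitVec t ∧ z (i + 1) = z i + t ∧
      ¬Wall (switch (switch H (D + b)) D) (z i) t := by
    intro i hi
    obtain ⟨t, ht, h8, h9⟩ := L.step i hi
    refine ⟨t, ht, h8, ?_⟩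
    rwa [hkeep ht (hDz _ hi.le) (h8 ▸ hDz _ hi) (hKz _ hi.le) (h8 ▸ hKz _ hi)]
  have hDeq : D = z (k + 1) + a + -b := by rw [← hK, add_neg_cancel_right]
  have hcorZ : IsCorridor (switch (switch H (D + b)) D) (z (k + 1)) a b := by
    refine ⟨hf, ?_, ?_, ?_, ?_⟩
    · rw [wall_double_switch ha]
      have g1 := hDz (k + 1) hk.le
      have g2 : D ≠ z (k + 1) + a := by
        rw [← hK]
        simpa using hb.ne_zero
      tauto
    · refine (hkeep ha.neg (hDz _ hk.le) ?_ (hKz _ hk.le) ?_).2 h6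
      · rw [hDeq, add_assoc]
        intro h
        have h8 : a + -b = -a := by simpa using h
        have := hf.ne
        rcases isFrame_cases hf with ⟨rfl, rfl⟩ | ⟨rfl, rfl⟩ | ⟨rfl, rfl⟩ | ⟨rfl, rfl⟩ | ⟨rfl, rfl⟩ |
          ⟨rfl, rfl⟩ | ⟨rfl, rfl⟩ | ⟨rfl, rfl⟩ <;> simp at h8
      · rw [hK]
        intro h
        exact ha.ne_neg (by simpa using h)
    · rw [hkeep hb (hDz _ hk.le) (hnext ▸ hDz _ hk) (hKz _ hk.le) (hnext ▸ hKz _ hk)]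
      exact (L.open_step (i := k + 1) hk hnext).2.1
    · have h8 : z (k + 1) + -b = z k := by rw [hprev, add_neg_cancel_right]
      rw [hkeep hb.neg (hDz _ hk.le) (h8 ▸ hDz k (by omega)) (hKz _ hk.le)
        (h8 ▸ hKz k (by omega))]
      exact (L.open_step (i := k) (by omega) hprev).2.2
  obtain ⟨H', h8, h9⟩ := cascadeStep_doubleSwitch hham hcor L.mem_mid L.start
    (by rw [L.finish, sub_eq_add_neg]) hzstep L.mem L.inj (k := k + 1) (by omega) hk hcorZ hnext
    (by rw [← hK]; exact hKG) hZ
  exact L.noWeak 2 H' (by omega) (Cascade.cons hstep (Cascade.cons h8 (Cascade.nil _))) h9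

/-- If the path runs into the box `D + b` above a small cookie `D`, in the direction `a`, it goes on
around the cookie. -/
lemma exists_isPassing (hm : 5 ≤ m) (hn : 5 ≤ n) (hI : M ∉ interiorBoxes H)
    (hfar : ∀ e, IsUnitVec e → M + w + e + e ∈ gridBoxes m n ∧ M + -w + e + e ∈ gridBoxes m n)
    {i : ℕ} {a b : ℤ × ℤ} (hf : IsFrame a b) (hi : i < r) (hstep : z (i + 1) = z i + a)
    {D : Box} (hDG : D ∈ gridBoxes m n) (hDb : D + -b ∉ gridBoxes m n)
    (hDI : D ∉ interiorBoxes H) (h2 : Wall H D b)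
    (hK : z (i + 1) = D + b) : IsPassing m n H r z (i + 1) a b := by
  have ha := hf.left
  have hb := hf.right
  obtain ⟨-, h3, h4⟩ := small_cookie_walls L.ham hf hDG hDb hDI
  have hlt : i + 1 < r := (L.inner hfar (k := i + 1) hi hb.neg (by
    rw [hK, add_neg_cancel_right]; exact hDb)).2
  have hKb : D + b + b ∈ gridBoxes m n := mem_add_add_of_boundary hm hn hb hDG hDb
  have h5 : ¬Wall H (z (i + 1)) b := fun h5 =>
    L.not_walls (by omega) hlt hb h5 (by rwa [hK, wall_neg hb]) (by rwa [hK])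
      (by rwa [hK, add_neg_cancel_right])
  obtain ⟨h6, h7⟩ := corner_of_of L.ham hDG hf h3 h2
  rw [← hK] at h7
  have hback := (L.open_step hi hstep).2.2
  have hKG := L.mem (i + 1) hi
  obtain ⟨h8, h9⟩ := corner_of_not_of_not L.ham hKG hf h7 h5
  have h10 := (corner_of_not_of_not L.ham hKG hf.neg_left hback h5).2
  have hzI := (L.interior_iff (i := i + 1) hi).2 hI
  have hg1 := mem_gridBoxes_of_interior_of_not_wall L.ham ha hzI h7
  have hg2 := mem_gridBoxes_of_interior_of_not_wall L.ham ha.neg hzI hback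
  rcases L.next hf hlt hstep with ⟨h11, -⟩ | ⟨h11, -⟩ | ⟨-, h11⟩
  · refine ⟨hf, hlt, h11, by rwa [h11], ?_, ?_, ?_, ?_⟩
    · rw [h11, hK, add_right_comm, wall_neg hb]
      exact h6
    · rw [h11, hK, add_right_comm, add_neg_cancel_right]
      exact mem_gridBoxes_of_mem_interior L.ham h4
    · rw [h11, hK, add_right_comm D b a, add_neg_cancel_right]
      exact notMem_slide hf.neg_right hDG hDb
    · rw [h11, hK, add_right_comm, add_neg_cancel_right, wall_neg ha]
      exact h3
  · refine (L.walls_prev hf.symm hlt h11 (by rwa [h11]) (by rwa [h11]) ?_ ?_ h7 hback).elim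
    · rw [h11]
      exact mem_slide hf.symm (by rwa [hK]) hg1
    · rw [h11]
      exact mem_slide hf.symm.neg_right (by rwa [hK]) hg2
  · rw [hK, wall_neg hb] at h11
    exact absurd h2 h11

/-- A path that enters a box on the boundary, with a wall on its inner side, goes on along the
boundary, or turns at a corner of the grid, or passes around a small cookie. -/
lemma next_of_isHugging (hm : 5 ≤ m) (hn : 5 ≤ n) (hI : M ∉ interiorBoxes H)
    (hfar : ∀ e, IsUnitVec e → M + w + e + e ∈ gridBoxes m n ∧ M + -w + e + e ∈ gridBoxes m n)
    {i : ℕ} {a b : ℤ × ℤ} (h : IsHugging m n H r z i a b) :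
    ∃ i' > i, ∃ a' b', IsHugging m n H r z i' a' b' ∨ IsPassing m n H r z i' a' b' := by
  have hf := h.frame
  have ha := hf.left
  have hb := hf.right
  have hZG := L.mem (i + 1) h.lt
  have hlt : i + 1 < r := (L.inner hfar (k := i + 1) h.lt hb.neg
    (notMem_add_add hb.neg hZG h.boundary)).2
  rcases L.next hf hlt h.step with ⟨h1, h1'⟩ | ⟨-, h1⟩ | ⟨h1, -⟩
  · have hZ'G := L.mem (i + 2) hlt
    have hbd : z (i + 2) + -b ∉ gridBoxes m n := by
      rw [h1]
      exact notMem_slide hf.neg_right hZG h.boundary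
    have hlt' : i + 2 < r := (L.inner hfar (k := i + 2) hlt hb.neg
      (notMem_add_add hb.neg hZ'G hbd)).2
    rcases L.next hf hlt' h1 with ⟨h2, h2'⟩ | ⟨h2, h2'⟩ | ⟨h2, -⟩
    · by_cases h3 : Wall H (z (i + 2)) b
      · exact ⟨i + 1, by omega, a, b, Or.inl ⟨hf, hlt, h1, hbd, h3⟩⟩
      · refine ⟨i + 2, by omega, a, b, Or.inl ⟨hf, hlt', h2, ?_, ?_⟩⟩
        · rw [h2]
          exact notMem_slide hf.neg_right hZ'G hbd
        · rw [h2]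
          exact (corner_of_not_of_not L.ham hZ'G hf h2' h3).1
    · have h3 : Wall H (z (i + 3)) (-a) := by
        have h4 : z (i + 3) = z (i + 1) + b + a := by rw [h2, h1, add_right_comm]
        rw [h4, wall_neg ha]
        exact (corner_of_of_not L.ham hZG hf.symm h.wall h1').2 (by rwa [← h1])
      have hback := (L.open_step (i := i + 1) hlt h1).2.2
      have hZb : z (i + 3) + -a ∈ gridBoxes m n := by
        rw [h2]
        exact mem_slide hf.symm.neg_right (h2 ▸ L.mem (i + 3) hlt')
          (by rw [h1, add_neg_cancel_right]; exact hZG)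
      -- the path turns inward at `z (i + 2)`, in front of a corner, a small cookie or an open side
      by_cases h4 : Wall H (z (i + 2)) a
      · by_cases hDG : z (i + 2) + a ∈ gridBoxes m n
        · have hDb : z (i + 2) + a + -b ∉ gridBoxes m n := notMem_slide hf.neg_right hZ'G hbd
          have hDI : z (i + 2) + a ∉ interiorBoxes H := fun h5 =>
            (mem_interior_iff_of_wall L.ham ha h4).1 h5 ((L.interior_iff (i := i + 2) hlt).2 hI)
          obtain ⟨h5, h6, h7⟩ := small_cookie_walls L.ham hf hDG hDb hDI
          have hlt'' : i + 3 < r := (L.inner hfar (k := i + 3) hlt' hb.neg (by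
            rw [h2, add_neg_cancel_right]; exact hbd)).2
          have hK : z (i + 3) + a = z (i + 2) + a + b := by rw [h2, add_right_comm]
          have hZa : z (i + 3) + a ∈ gridBoxes m n := by
            rw [h2]
            exact mem_slide hf.symm (h2 ▸ L.mem (i + 3) hlt') hDG
          have h8 : ¬Wall H (z (i + 3)) a := fun h8 =>
            L.not_walls (by omega) hlt'' ha h8 h3 hZa hZb
          have h9 : Wall H (z (i + 2) + a) b :=
            (corner_of_of_not L.ham hZ'G hf h4 h2').2 (by rwa [← h2])
          rcases L.next hf.symm hlt'' h2 with ⟨h10, h11⟩ | ⟨h10, -⟩ | ⟨-, h10⟩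
          · have h12 : Wall H (z (i + 2) + a + b) b := by
              rw [← hK]
              by_contra hc
              exact h11 (corner_of_not_of_not' L.ham (L.mem _ hlt') hf h8 hc).1
            exact (L.not_collect hI hf (k := i + 2) hlt'' h2 h10 rfl hDG
              (mem_gridBoxes_of_mem_interior L.ham h7) hDb hDI h6 (by rwa [wall_neg ha]) h9 h5 h12
              h3 h8 hZb).elim
          · exact ⟨i + 4, by omega, a, b, Or.inr (L.exists_isPassing hm hn hI hfar hf hlt'' h10 hDG
              hDb hDI h9 (by rw [h10, hK]))⟩
          · exact absurd h3 h10
        · -- a corner of the grid: the path goes on along the next side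
          refine ⟨i + 2, by omega, b, -a, Or.inl ⟨hf.symm.neg_right, hlt', h2, ?_, h3⟩⟩
          rw [neg_neg, h2]
          exact notMem_slide hf.symm hZ'G hDG
      · -- without a wall in front, `z (i + 3)` has walls on both sides, inside the grid
        have h5 := (corner_of_not_of_not L.ham hZ'G hf h4 h2').2
        have hZ'I := (L.interior_iff (i := i + 2) hlt).2 hI
        refine (L.walls_prev hf.symm hlt' h2 (by rwa [h2]) h3 ?_ hZb h4 hback).elim
        rw [h2]
        exact mem_slide hf.symm (h2 ▸ L.mem (i + 3) hlt')
          (mem_gridBoxes_of_interior_of_not_wall L.ham ha hZ'I h4)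
    · exact absurd (h2 ▸ L.mem (i + 3) hlt') hbd
  · exact absurd h.wall h1
  · exact absurd (h1 ▸ L.mem (i + 2) hlt) h.boundary

/-- A path that passes around a small cookie returns to the boundary behind it, or meets another small
cookie there. -/
lemma next_of_isPassing (hm : 5 ≤ m) (hn : 5 ≤ n) (hI : M ∉ interiorBoxes H)
    (hfar : ∀ e, IsUnitVec e → M + w + e + e ∈ gridBoxes m n ∧ M + -w + e + e ∈ gridBoxes m n)
    {i : ℕ} {a b : ℤ × ℤ} (h : IsPassing m n H r z i a b) :
    ∃ i' > i, ∃ a' b', IsHugging m n H r z i' a' b' ∨ IsPassing m n H r z i' a' b' := by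
  have hf := h.frame
  have ha := hf.left
  have hb := hf.right
  have hQG := L.mem (i + 1) h.lt
  have hlt : i + 1 < r := (L.inner hfar (k := i + 1) h.lt hb.neg h.boundary).2
  rcases L.next hf hlt h.step with ⟨h1, h1'⟩ | ⟨-, h1⟩ | ⟨h1, -⟩
  · obtain ⟨h2, h3⟩ := corner_of_not_of_not L.ham hQG hf.neg_right h1' h.not_wall
    have hDG : z (i + 1) + -b + a ∈ gridBoxes m n :=
      mem_slide hf.symm.neg_left h.mem (by rw [← h1]; exact L.mem (i + 2) hlt)
    have hK : z (i + 2) = z (i + 1) + -b + a + b := by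
      rw [h1, add_right_comm (z (i + 1)) (-b) a, neg_add_cancel_right]
    have hDb : z (i + 1) + -b + a + -b ∉ gridBoxes m n := by
      rw [add_right_comm]
      have := notMem_slide hf.neg_right h.mem h.boundary
      rwa [add_right_comm] at this
    have h4 : Wall H (z (i + 1) + -b + a) b := by
      rw [← wall_neg hb, ← hK, h1]
      exact h2
    have hDI : z (i + 1) + -b + a ∉ interiorBoxes H := by
      intro hc
      have h5 := (mem_interior_iff_of_wall L.ham hb h4).1
      rw [← hK] at h5
      exact h5 ((L.interior_iff (i := i + 2) hlt).2 hI) hc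
    exact ⟨i + 2, by omega, a, b, Or.inr (L.exists_isPassing hm hn hI hfar hf hlt h1 hDG
      hDb hDI h4 hK)⟩
  · exact absurd h.wall h1
  · have hbd : z (i + 2) + -b ∉ gridBoxes m n := by
      rw [h1]
      exact h.boundary
    have hZG := L.mem (i + 2) hlt
    have hlt' : i + 2 < r := (L.inner hfar (k := i + 2) hlt hb.neg
      (notMem_add_add hb.neg hZG hbd)).2
    rcases L.next hf.symm.neg_left hlt' h1 with ⟨h2, -⟩ | ⟨h2, h2'⟩ | ⟨-, h2⟩
    · exact absurd (h2 ▸ L.mem (i + 3) hlt') hbd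
    · have hback := (L.open_step (i := i + 1) hlt h1).2.2
      rw [neg_neg] at hback
      refine ⟨i + 2, by omega, a, b, Or.inl ⟨hf, hlt', h2, ?_, ?_⟩⟩
      · rw [h2]
        exact notMem_slide hf.neg_right hZG hbd
      · rw [h2]
        exact (corner_of_not_of_not L.ham hZG hf h2' hback).1
    · rw [h1] at h2
      exact absurd h.wall_below h2

/-- The path is finite, so it never runs along the boundary between two walls. -/
lemma not_isHugging (hm : 5 ≤ m) (hn : 5 ≤ n) (hI : M ∉ interiorBoxes H)
    (hfar : ∀ e, IsUnitVec e → M + w + e + e ∈ gridBoxes m n ∧ M + -w + e + e ∈ gridBoxes m n)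
    (i : ℕ) (a b : ℤ × ℤ) : ¬IsHugging m n H r z i a b := by
  have key : ∀ s i, r ≤ i + s → ∀ a b, ¬IsHugging m n H r z i a b ∧ ¬IsPassing m n H r z i a b := by
    intro s
    induction s with
    | zero => exact fun i hi a b => ⟨fun h => by have := h.lt; omega, fun h => by have := h.lt; omega⟩
    | succ s ih =>
      refine fun i hi a b => ⟨fun h => ?_, fun h => ?_⟩
      · obtain ⟨i', hi', a', b', h'⟩ := L.next_of_isHugging hm hn hI hfar h
        have := ih i' (by omega) a' b'
        tauto
      · obtain ⟨i', hi', a', b', h'⟩ := L.next_of_isPassing hm hn hI hfar h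
        have := ih i' (by omega) a' b'
        tauto
  exact (key r i (by omega) a b).1

/-- No inner box of the path has walls on two opposite sides. -/
theorem not_wall_of_wall (hm : 5 ≤ m) (hn : 5 ≤ n)
    (hfar : M ∉ interiorBoxes H →
      ∀ e, IsUnitVec e → M + w + e + e ∈ gridBoxes m n ∧ M + -w + e + e ∈ gridBoxes m n)
    {k : ℕ} {e : ℤ × ℤ} (hk0 : 0 < k) (hkr : k < r) (he : IsUnitVec e) (h1 : Wall H (z k) e) :
    ¬Wall H (z k) (-e) := by
  intro h2
  by_cases hI : M ∈ interiorBoxes H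
  · have hzI : z k ∉ interiorBoxes H := fun h => (L.interior_iff hkr.le).1 h hI
    exact L.not_walls hk0 hkr he h1 h2
      (mem_gridBoxes_of_mem_interior L.ham ((mem_interior_iff_of_wall L.ham he h1).2 hzI))
      (mem_gridBoxes_of_mem_interior L.ham ((mem_interior_iff_of_wall L.ham he.neg h2).2 hzI))
  · obtain ⟨i, rfl⟩ : ∃ i, k = i + 1 := ⟨k - 1, by omega⟩
    obtain ⟨a, ha, h3, h4⟩ := L.step i (by omega)
    have h5 := (L.open_step (by omega) h3).2.2
    have hf : IsFrame a e := by
      rcases he.trichotomy ha with rfl | rfl | hf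
      · exact absurd h2 h5
      · exact absurd h1 (by rwa [neg_neg] at h5)
      · exact hf.symm
    by_cases g2 : z (i + 1) + -e ∈ gridBoxes m n
    · by_cases g1 : z (i + 1) + e ∈ gridBoxes m n
      · exact L.not_walls hk0 hkr he h1 h2 g1 g2
      · exact L.not_isHugging hm hn hI (hfar hI) i a (-e)
          ⟨hf.neg_right, by omega, h3, by rwa [neg_neg], h2⟩
    · exact L.not_isHugging hm hn hI (hfar hI) i a e ⟨hf, by omega, h3, g2, h1⟩

end IsLoop

end Hugging

/-! ### Stacks of `A₀`-types that start at the boundary -/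

section Stack

variable {m n : ℕ} {H : EdgeSet} {q w u : ℤ × ℤ} {j : ℕ}

lemma pt_mem_of_le (hf : IsFrame w u) {x y x₁ y₁ x₂ y₂ : ℤ} (h₁ : pt q w u x₁ y₁ ∈ gridVerts m n)
    (h₂ : pt q w u x₂ y₂ ∈ gridVerts m n) (hx : x₁ ≤ x) (hx' : x ≤ x₂) (hy : y₁ ≤ y) (hy' : y ≤ y₂) :
    pt q w u x y ∈ gridVerts m n := by
  rcases isFrame_cases hf with ⟨rfl, rfl⟩ | ⟨rfl, rfl⟩ | ⟨rfl, rfl⟩ | ⟨rfl, rfl⟩ | ⟨rfl, rfl⟩ |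
    ⟨rfl, rfl⟩ | ⟨rfl, rfl⟩ | ⟨rfl, rfl⟩ <;> simp [gridVerts, pt] at h₁ h₂ ⊢ <;> omega

lemma pt_mem_rect (hf : IsFrame w u) {x y x₁ y₁ : ℤ} (h₁ : pt q w u x y₁ ∈ gridVerts m n)
    (h₂ : pt q w u x₁ y ∈ gridVerts m n) : pt q w u x y ∈ gridVerts m n := by
  rcases isFrame_cases hf with ⟨rfl, rfl⟩ | ⟨rfl, rfl⟩ | ⟨rfl, rfl⟩ | ⟨rfl, rfl⟩ | ⟨rfl, rfl⟩ |
    ⟨rfl, rfl⟩ | ⟨rfl, rfl⟩ | ⟨rfl, rfl⟩ <;> simp [gridVerts, pt] at h₁ h₂ ⊢ <;> omega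

lemma boxAt_add_mem (hf : IsFrame w u) {x y : ℤ} (h₁ : pt q w u x y ∈ gridVerts m n)
    (h₂ : pt q w u (x + 1) (y + 1) ∈ gridVerts m n) :
    boxAt q w u + x • w + y • u ∈ gridBoxes m n := by
  rcases isFrame_cases hf with ⟨rfl, rfl⟩ | ⟨rfl, rfl⟩ | ⟨rfl, rfl⟩ | ⟨rfl, rfl⟩ | ⟨rfl, rfl⟩ |
    ⟨rfl, rfl⟩ | ⟨rfl, rfl⟩ | ⟨rfl, rfl⟩ <;>
    simp [gridVerts, gridBoxes, boxAt, pt] at h₁ h₂ ⊢ <;> omega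

/-- The number of edges of `H` (zero or one) from `(x, y)` to `(x + 1, y)`, in coordinates. -/
noncomputable def hor (H : EdgeSet) (q w u : ℤ × ℤ) (x y : ℤ) : ℕ :=
  ind (s(pt q w u x y, pt q w u (x + 1) y) ∈ H)

/-- The number of edges of `H` (zero or one) from `(x, y)` to `(x, y + 1)`, in coordinates. -/
noncomputable def ver (H : EdgeSet) (q w u : ℤ × ℤ) (x y : ℤ) : ℕ :=
  ind (s(pt q w u x y, pt q w u x (y + 1)) ∈ H)

lemma hor_add_ver (hH : IsGridHamCycle m n H) (hf : IsFrame w u) {x y : ℤ}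
    (h : pt q w u x y ∈ gridVerts m n) :
    hor H q w u x y + hor H q w u (x - 1) y + ver H q w u x y + ver H q w u x (y - 1) = 2 := by
  have h1 := hH.deg_eq_two h
  rw [deg_frame hf] at h1
  have e1 : pt q w u x y + w = pt q w u (x + 1) y := by simp only [pt]; module
  have e2 : pt q w u x y - w = pt q w u (x - 1) y := by simp only [pt]; module
  have e3 : pt q w u x y + u = pt q w u x (y + 1) := by simp only [pt]; module
  have e4 : pt q w u x y - u = pt q w u x (y - 1) := by simp only [pt]; module
  rw [e1, e2, e3, e4] at h1
  simp only [hor, ver, sub_add_cancel]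
  rw [Sym2.eq_swap (a := pt q w u (x - 1) y), Sym2.eq_swap (a := pt q w u x (y - 1))]
  omega

lemma hor_eq_zero (hH : IsGridHamCycle m n H) {x y : ℤ} (h : pt q w u (x + 1) y ∉ gridVerts m n) :
    hor H q w u x y = 0 :=
  ind_of_false fun hc => h (mem_gridVerts_of_mem hH.1 (Sym2.eq_swap ▸ hc))

lemma ver_eq_zero (hH : IsGridHamCycle m n H) {x y : ℤ} (h : pt q w u x y ∉ gridVerts m n) :
    ver H q w u x y = 0 :=
  ind_of_false fun hc => h (mem_gridVerts_of_mem hH.1 hc)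

lemma ver_eq_zero' (hH : IsGridHamCycle m n H) {x y : ℤ} (h : pt q w u x (y + 1) ∉ gridVerts m n) :
    ver H q w u x y = 0 :=
  ind_of_false fun hc => h (mem_gridVerts_of_mem hH.1 (Sym2.eq_swap ▸ hc))

/-- A `j`-stack of `A₀`-types, followed by an `A₁`-type, that starts at the boundary of the grid, in
terms of its edges in the coordinates of the frame `w`, `u` at `q`. -/
structure IsStack (m n : ℕ) (H : EdgeSet) (q w u : ℤ × ℤ) (j : ℕ) : Prop where
  ham : IsGridHamCycle m n H
  frame : IsFrame w u
  wing : ∀ i : ℕ, i ≤ j → hor H q w u 1 (2 * i) = 1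
  wing' : ∀ i : ℕ, i ≤ j → hor H q w u (-1) (2 * i) = 1
  leg : ∀ i : ℕ, i ≤ j → ver H q w u 1 (2 * i) = 1
  leg' : ∀ i : ℕ, i ≤ j → ver H q w u 0 (2 * i) = 1
  top : ∀ i : ℕ, i < j → hor H q w u 0 (2 * i + 1) = 1
  upper : ver H q w u 1 (2 * j + 1) = 1
  upper' : ver H q w u 0 (2 * j + 1) = 1
  bottom : pt q w u 0 (-1) ∉ gridVerts m n

namespace IsStack

variable (S : IsStack m n H q w u j)

include S

lemma flip : IsStack m n H (q + w) (-w) u j := by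
  have hp : ∀ x y, pt (q + w) (-w) u x y = pt q w u (1 - x) y := by
    intro x y
    simp only [pt]
    module
  have hh : ∀ x y, hor H (q + w) (-w) u x y = hor H q w u (-x) y := by
    intro x y
    simp only [hor, hp]
    rw [Sym2.eq_swap]
    congr 4 <;> ring
  have hv : ∀ x y, ver H (q + w) (-w) u x y = ver H q w u (1 - x) y := by
    intro x y
    simp only [ver, hp]
  refine ⟨S.ham, S.frame.neg_left, ?_, ?_, ?_, ?_, ?_, ?_, ?_, ?_⟩
  · intro i hi
    simpa [hh] using S.wing' i hi
  · intro i hi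
    simpa [hh] using S.wing i hi
  · intro i hi
    simpa [hv] using S.leg' i hi
  · intro i hi
    simpa [hv] using S.leg i hi
  · intro i hi
    simpa [hh] using S.top i hi
  · simpa [hv] using S.upper'
  · simpa [hv] using S.upper
  · rw [hp]
    intro h
    refine S.bottom (pt_mem_rect S.frame (y₁ := 0) (x₁ := 1 - 0) ?_ h)
    have := S.leg' 0 (by omega)
    by_contra hc
    rw [ver_eq_zero S.ham (by simpa using hc)] at this
    omega

lemma mem_of_hor {x y : ℤ} (h : hor H q w u x y = 1) :
    pt q w u x y ∈ gridVerts m n ∧ pt q w u (x + 1) y ∈ gridVerts m n := by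
  constructor
  · by_contra hc
    have h1 := hor_eq_zero S.ham (x := x - 1) (y := y) (by rwa [sub_add_cancel])
    rw [hor, ind_of_false fun hc' => hc (mem_gridVerts_of_mem S.ham.1 hc')] at h
    omega
  · by_contra hc
    rw [hor_eq_zero S.ham hc] at h
    omega

lemma mem_top : pt q w u 0 (2 * j + 2) ∈ gridVerts m n := by
  by_contra hc
  have h := S.upper'
  rw [ver_eq_zero' S.ham (by rwa [add_assoc])] at h
  omega

lemma mem {x y : ℤ} (hx : -1 ≤ x) (hx' : x ≤ 2) (hy : 0 ≤ y) (hy' : y ≤ 2 * j + 2) :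
    pt q w u x y ∈ gridVerts m n := by
  have h1 := (S.mem_of_hor (S.wing' 0 (by omega))).1
  have h2 := (S.mem_of_hor (S.wing 0 (by omega))).2
  norm_num at h1 h2
  exact pt_mem_of_le S.frame h1 (pt_mem_rect S.frame h2 S.mem_top) hx hx' hy hy'

lemma notMem_neg (x : ℤ) : pt q w u x (-1) ∉ gridVerts m n := fun h =>
  S.bottom (pt_mem_rect S.frame (S.mem (x := 0) (y := 0) (by omega) (by omega) (by omega) (by omega)) h)

lemma deg_eq (x y : ℤ) (h : pt q w u x y ∈ gridVerts m n) :
    hor H q w u x y + hor H q w u (x - 1) y + ver H q w u x y + ver H q w u x (y - 1) = 2 :=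
  hor_add_ver S.ham S.frame h

lemma notMem_col {x : ℤ} (hx : pt q w u x 0 ∉ gridVerts m n) (y : ℤ) :
    pt q w u x y ∉ gridVerts m n := fun h =>
  hx (pt_mem_rect S.frame h (S.mem (x := 0) (y := 0) (by omega) (by omega) (by omega) (by omega)))

/-- If column `2` were the last one, the degrees at its vertices next to the two lowest `A₀`-types
could not all be two. -/
lemma mem_three (hj : 2 ≤ j) : pt q w u 3 0 ∈ gridVerts m n := by
  by_contra hc
  have z : ∀ y, hor H q w u 2 y = 0 := fun y => hor_eq_zero S.ham (S.notMem_col hc y)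
  have z0 := z 0; have z1 := z 1; have z2 := z 2; have z3 := z 3
  have b := ver_eq_zero S.ham (S.notMem_neg 2)
  have d1 := S.deg_eq 1 1 (S.mem (by omega) (by omega) (by omega) (by omega))
  have d2 := S.deg_eq 1 3 (S.mem (by omega) (by omega) (by omega) (by omega))
  have d3 := S.deg_eq 2 0 (S.mem (by omega) (by omega) (by omega) (by omega))
  have d4 := S.deg_eq 2 1 (S.mem (by omega) (by omega) (by omega) (by omega))
  have d5 := S.deg_eq 2 2 (S.mem (by omega) (by omega) (by omega) (by omega))
  have d6 := S.deg_eq 2 3 (S.mem (by omega) (by omega) (by omega) (by omega))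
  have f1 := S.wing 0 (by omega)
  have f2 := S.wing 1 (by omega)
  have f3 := S.leg 0 (by omega)
  have f4 := S.leg 1 (by omega)
  have f5 := S.top 0 (by omega)
  have f6 := S.top 1 (by omega)
  norm_num at d1 d2 d3 d4 d5 d6 f1 f2 f3 f4 f5 f6
  have v3 : ver H q w u 2 3 ≤ 1 := ind_le_one _
  omega

/-- If column `3` were the last one, the vertex `(3, 2)` would have degree at most one. -/
lemma mem_four (hj : 2 ≤ j) : pt q w u 4 0 ∈ gridVerts m n := by
  by_contra hc
  have z : ∀ y, hor H q w u 3 y = 0 := fun y => hor_eq_zero S.ham (S.notMem_col hc y)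
  have z0 := z 0; have z1 := z 1; have z2 := z 2
  have b2 := ver_eq_zero S.ham (S.notMem_neg 2)
  have b3 := ver_eq_zero S.ham (S.notMem_neg 3)
  have m3 : ∀ y : ℤ, 0 ≤ y → y ≤ 2 → pt q w u 3 y ∈ gridVerts m n := fun y h1 h2 =>
    pt_mem_rect S.frame (S.mem_three hj) (S.mem (x := 0) (by omega) (by omega) h1 (by omega))
  have d1 := S.deg_eq 1 1 (S.mem (by omega) (by omega) (by omega) (by omega))
  have d2 := S.deg_eq 2 0 (S.mem (by omega) (by omega) (by omega) (by omega))
  have d3 := S.deg_eq 2 1 (S.mem (by omega) (by omega) (by omega) (by omega))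
  have d4 := S.deg_eq 2 2 (S.mem (by omega) (by omega) (by omega) (by omega))
  have d5 := S.deg_eq 3 0 (m3 0 (by omega) (by omega))
  have d6 := S.deg_eq 3 1 (m3 1 (by omega) (by omega))
  have d7 := S.deg_eq 3 2 (m3 2 (by omega) (by omega))
  have f1 := S.wing 0 (by omega)
  have f2 := S.wing 1 (by omega)
  have f3 := S.leg 0 (by omega)
  have f5 := S.top 0 (by omega)
  norm_num at d1 d2 d3 d4 d5 d6 d7 f1 f2 f3 f5
  have v1 : hor H q w u 2 0 ≤ 1 := ind_le_one _
  have v2 : ver H q w u 3 0 ≤ 1 := ind_le_one _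
  have v3 : ver H q w u 2 1 ≤ 1 := ind_le_one _
  have v4 : hor H q w u 2 1 ≤ 1 := ind_le_one _
  have v5 : ver H q w u 3 2 ≤ 1 := ind_le_one _
  omega

lemma hor_odd {i : ℕ} (hi : i ≤ j) : hor H q w u 1 (2 * i + 1) = 0 := by
  have d := S.deg_eq 1 (2 * i + 1) (S.mem (by omega) (by omega) (by omega) (by omega))
  have f := S.leg i hi
  rw [add_sub_cancel_right] at d
  rcases hi.lt_or_eq with h | rfl
  · have := S.top i h
    norm_num at d
    omega
  · have := S.upper
    omega

/-- The alternating number of edges that join the columns `x` and `x + 1`, in the rows up to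
`2 * j + 2`. -/
noncomputable def altSum (H : EdgeSet) (q w u : ℤ × ℤ) (j : ℕ) (x : ℤ) : ℤ :=
  ∑ y ∈ Finset.range (2 * j + 3), (-1) ^ y * (hor H q w u x y : ℤ)

omit S in
lemma sum_neg_one_pow (V : ℤ → ℕ) (N : ℕ) :
    ∑ y ∈ Finset.range N, (-1 : ℤ) ^ y * ((V y : ℤ) + V (y - 1)) =
      V (-1) - (-1) ^ N * V (N - 1) := by
  induction N with
  | zero => simp
  | succ N ih =>
    rw [Finset.sum_range_succ, ih]
    push_cast
    rw [add_sub_cancel_right]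
    ring

omit S in
lemma sum_neg_one_pow_odd (k : ℕ) : ∑ y ∈ Finset.range (2 * k + 1), (-1 : ℤ) ^ y = 1 := by
  induction k with
  | zero => simp
  | succ k ih =>
    rw [show 2 * (k + 1) + 1 = 2 * k + 1 + 1 + 1 by ring, Finset.sum_range_succ,
      Finset.sum_range_succ, ih]
    ring

/-- Between the columns `1` and `2` the edges at even heights up to `2 * j` are in `H`, those at odd
heights are not. -/
lemma altSum_one : (j : ℤ) + 1 ≤ altSum H q w u j 1 := by
  have key : ∀ k : ℕ, k ≤ j + 1 →
      ∑ y ∈ Finset.range (2 * k), (-1 : ℤ) ^ y * (hor H q w u 1 y : ℤ) = k := by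
    intro k
    induction k with
    | zero => simp
    | succ k ih =>
      intro hk
      have h1 := S.wing k (by omega)
      have h2 := S.hor_odd (i := k) (by omega)
      rw [show 2 * (k + 1) = 2 * k + 1 + 1 by ring, Finset.sum_range_succ, Finset.sum_range_succ,
        ih (by omega)]
      push_cast
      rw [h1, h2]
      simp
  rw [altSum, show 2 * j + 3 = 2 * (j + 1) + 1 by ring, Finset.sum_range_succ, key _ le_rfl,
    pow_mul]
  push_cast
  simp

/-- If the row `2 * j + 3` is outside the grid, the alternating sums on both sides of a column add
up to `2`, since the vertical edges of the column cancel. -/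
lemma altSum_add (htop : pt q w u 0 (2 * j + 3) ∉ gridVerts m n) {x : ℤ}
    (hx : pt q w u x 0 ∈ gridVerts m n) : altSum H q w u j x + altSum H q w u j (x - 1) = 2 := by
  have h1 : ∑ y ∈ Finset.range (2 * j + 3), (-1 : ℤ) ^ y * (hor H q w u x y + hor H q w u (x - 1) y +
      ver H q w u x y + ver H q w u x (y - 1) : ℕ) = 2 := by
    rw [Finset.sum_congr rfl (g := fun y : ℕ => (-1 : ℤ) ^ y * 2), ← Finset.sum_mul,
      show 2 * j + 3 = 2 * (j + 1) + 1 by ring, sum_neg_one_pow_odd]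
    · simp
    · intro y hy
      rw [Finset.mem_range] at hy
      rw [S.deg_eq x y (pt_mem_rect S.frame hx (S.mem (x := 0) (by omega) (by omega) (by omega)
        (by omega)))]
      rfl
  have h2 := sum_neg_one_pow (fun y => ver H q w u x y) (2 * j + 3)
  have h3 : ver H q w u x (-1) = 0 := ver_eq_zero S.ham (S.notMem_neg x)
  have h4 : ver H q w u x ((2 * j + 3 : ℕ) - 1) = 0 := by
    refine ver_eq_zero' S.ham fun hc => htop ?_
    have := pt_mem_rect S.frame (S.mem (x := 0) (y := 0) (by omega) (by omega) (by omega)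
      (by omega)) hc
    push_cast at this
    rwa [sub_add_cancel] at this
  simp only [h3, h4] at h2
  rw [altSum, altSum, ← Finset.sum_add_distrib, ← h1, ← sub_eq_zero, ← Finset.sum_sub_distrib,
    ← neg_eq_zero, ← Finset.sum_neg_distrib]
  simp only [Nat.cast_zero, mul_zero, sub_zero] at h2
  rw [← h2]
  refine Finset.sum_congr rfl fun y _ => ?_
  push_cast
  ring

/-- Otherwise the alternating sums would alternate between two nonzero values in all columns to the
right, so that the grid would be unbounded. -/
lemma mem_above (hj : 2 ≤ j) : pt q w u 0 (2 * j + 3) ∈ gridVerts m n := by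
  by_contra htop
  have h0 : ∀ x, altSum H q w u j x ≠ 0 → pt q w u (x + 1) 0 ∈ gridVerts m n := by
    intro x hx
    by_contra hc
    refine hx (Finset.sum_eq_zero fun y _ => ?_)
    rw [hor_eq_zero S.ham (S.notMem_col hc y)]
    simp
  have h1 := S.altSum_one
  have key : ∀ k : ℕ, altSum H q w u j (1 + 2 * k) = altSum H q w u j 1 := by
    intro k
    induction k with
    | zero => simp
    | succ k ih =>
      have h2 := S.altSum_add htop (h0 (1 + 2 * k) (by omega))
      rw [add_sub_cancel_right] at h2
      have h3 := S.altSum_add htop (h0 (1 + 2 * k + 1) (by omega))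
      rw [add_sub_cancel_right] at h3
      push_cast
      rw [show (1 : ℤ) + 2 * (k + 1) = 1 + 2 * k + 1 + 1 by ring]
      omega
  have hbig : ∀ k : ℕ, pt q w u (1 + 2 * k + 1) 0 ∈ gridVerts m n := fun k =>
    h0 _ (by rw [key]; omega)
  have h5 := hbig (m + n)
  have h6 := hbig 0
  rcases isFrame_cases S.frame with ⟨rfl, rfl⟩ | ⟨rfl, rfl⟩ | ⟨rfl, rfl⟩ | ⟨rfl, rfl⟩ |
    ⟨rfl, rfl⟩ | ⟨rfl, rfl⟩ | ⟨rfl, rfl⟩ | ⟨rfl, rfl⟩ <;>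
    simp [gridVerts, pt] at h5 h6 <;> omega

/-- There are at least two boxes of the grid beyond the end-boxes, in each direction. -/
theorem far (hj : 2 ≤ j) {M : Box} (hM : M = boxAt q w u + (2 * (j : ℤ)) • u) {e : ℤ × ℤ}
    (he : IsUnitVec e) : M + w + e + e ∈ gridBoxes m n ∧ M + -w + e + e ∈ gridBoxes m n := by
  have hl : pt q w u (-3) 0 ∈ gridVerts m n := by
    have := S.flip.mem_four hj
    rw [show pt (q + w) (-w) u 4 0 = pt q w u (-3) 0 by simp only [pt]; module] at this
    exact this
  have hr := pt_mem_rect S.frame (S.mem_four hj) (S.mem_above hj)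
  have hin : ∀ x y : ℤ, -3 ≤ x → x + 1 ≤ 4 → 0 ≤ y → y + 1 ≤ 2 * j + 3 →
      boxAt q w u + x • w + y • u ∈ gridBoxes m n := fun x y h1 h2 h3 h4 =>
    boxAt_add_mem S.frame (pt_mem_of_le S.frame hl hr (by omega) (by omega) (by omega) (by omega))
      (pt_mem_of_le S.frame hl hr (by omega) (by omega) (by omega) (by omega))
  have key : ∀ x y : ℤ, -3 ≤ x → x + 1 ≤ 4 → -2 ≤ y → y ≤ 2 →
      M + x • w + y • u ∈ gridBoxes m n := by
    intro x y h1 h2 h3 h4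
    have := hin x (2 * j + y) h1 h2 (by omega) (by omega)
    rw [hM]
    convert this using 1
    module
  rcases he.cases_of_isFrame S.frame with rfl | rfl | rfl | rfl <;> constructor
  · convert key 3 0 (by omega) (by omega) (by omega) (by omega) using 1; module
  · convert key 1 0 (by omega) (by omega) (by omega) (by omega) using 1; module
  · convert key (-1) 0 (by omega) (by omega) (by omega) (by omega) using 1; module
  · convert key (-3) 0 (by omega) (by omega) (by omega) (by omega) using 1; module
  · convert key 1 2 (by omega) (by omega) (by omega) (by omega) using 1; module
  · convert key (-1) 2 (by omega) (by omega) (by omega) (by omega) using 1; module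
  · convert key 1 (-2) (by omega) (by omega) (by omega) (by omega) using 1; module
  · convert key (-1) (-2) (by omega) (by omega) (by omega) (by omega) using 1; module

end IsStack

end Stack

/-! ### Looping fat paths as paths between end-boxes -/

section Setup

variable {m n : ℕ} {H : EdgeSet} {q w u p : ℤ × ℤ} {j : ℕ}

lemma side_left_eq (hf : IsFrame w u) (x y : ℤ) :
    side (boxAt q w u + x • w + y • u) (-w) = s(pt q w u x y, pt q w u x (y + 1)) := by
  obtain ⟨k, l⟩ := q
  rcases isFrame_cases hf with ⟨rfl, rfl⟩ | ⟨rfl, rfl⟩ | ⟨rfl, rfl⟩ | ⟨rfl, rfl⟩ | ⟨rfl, rfl⟩ |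
    ⟨rfl, rfl⟩ | ⟨rfl, rfl⟩ | ⟨rfl, rfl⟩ <;> simp [side, boxAt, pt, add_assoc]

lemma boxAt_symm (q w u : ℤ × ℤ) : boxAt q w u = boxAt q u w := by
  simp only [boxAt, add_right_comm]

lemma pt_symm (q w u : ℤ × ℤ) (x y : ℤ) : pt q w u x y = pt q u w y x := by
  simp only [pt, add_right_comm]

lemma side_down_eq (hf : IsFrame w u) (x y : ℤ) :
    side (boxAt q w u + x • w + y • u) (-u) = s(pt q w u x y, pt q w u (x + 1) y) := by
  rw [boxAt_symm, pt_symm, pt_symm q w u (x + 1), add_right_comm, side_left_eq hf.symm]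

lemma wall_left_iff (hf : IsFrame w u) (x y : ℤ) :
    Wall H (boxAt q w u + x • w + y • u) (-w) ↔ s(pt q w u x y, pt q w u x (y + 1)) ∈ H := by
  rw [Wall, side_left_eq hf]

lemma wall_down_iff (hf : IsFrame w u) (x y : ℤ) :
    Wall H (boxAt q w u + x • w + y • u) (-u) ↔ s(pt q w u x y, pt q w u (x + 1) y) ∈ H := by
  rw [Wall, side_down_eq hf]

lemma boxAt_pt (hf : IsFrame w u) (x y : ℤ) :
    boxAt (pt q w u x y) w u = boxAt q w u + x • w + y • u := by
  obtain ⟨k, l⟩ := q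
  rcases isFrame_cases hf with ⟨rfl, rfl⟩ | ⟨rfl, rfl⟩ | ⟨rfl, rfl⟩ | ⟨rfl, rfl⟩ | ⟨rfl, rfl⟩ |
    ⟨rfl, rfl⟩ | ⟨rfl, rfl⟩ | ⟨rfl, rfl⟩ <;> simp [boxAt, pt] <;> omega

lemma hor_eq_one_iff {x y : ℤ} :
    hor H q w u x y = 1 ↔ s(pt q w u x y, pt q w u (x + 1) y) ∈ H := by
  by_cases h : s(pt q w u x y, pt q w u (x + 1) y) ∈ H <;> simp [hor, h]

lemma ver_eq_one_iff {x y : ℤ} :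
    ver H q w u x y = 1 ↔ s(pt q w u x y, pt q w u x (y + 1)) ∈ H := by
  by_cases h : s(pt q w u x y, pt q w u x (y + 1)) ∈ H <;> simp [ver, h]

/-- If three sides of a small cookie are walls, the fourth one is on the boundary of the grid: the
cookie reaches the outside, and it has no neighbours in the grid. -/
lemma notMem_of_isSmallCookie {C : Box} (h : IsSmallCookie m n H C) {w u : ℤ × ℤ} (hf : IsFrame w u)
    (h1 : Wall H C w) (h2 : Wall H C (-w)) (h3 : Wall H C u) : C + -u ∉ gridBoxes m n := by
  obtain ⟨B, hB, ⟨B', hB', ⟨W⟩⟩, hC⟩ := h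
  obtain rfl : B = C := by
    have : B ∈ ({C} : Set Box) := by rw [hC]; exact Reachable.refl B
    exact this
  cases W with
  | nil => exact absurd hB hB'
  | cons hadj _ =>
    obtain ⟨t, ht, rfl, hw⟩ := latticeBoxGraph_adj.1 hadj
    rcases ht.cases_of_isFrame hf with rfl | rfl | rfl | rfl
    · exact absurd h1 hw
    · exact absurd h2 hw
    · exact absurd h3 hw
    · intro hG
      have : B + -u ∈ ({B} : Set Box) := by
        rw [hC]
        exact (boxGraph_adj_add hB hf.right.neg hG hw).reachable
      exact add_ne_self hf.right.neg this.symm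

lemma pt_pt (q w u : ℤ × ℤ) (k x y : ℤ) : pt (q + k • u) w u x y = pt q w u x (k + y) := by
  simp only [pt]
  module

lemma isStack_of_anchored (hH : IsGridHamCycle m n H) (hf : IsFrame w u)
    (hC : IsSmallCookie m n H (boxAt q w u)) (hj : 1 ≤ j) (hstack : stackEdges q w u j ⊆ H)
    (hp : p = q + (2 * ((j : ℤ) - 1)) • u) (hA : a1Edges p w u ⊆ H) : IsStack m n H q w u j := by
  have e0 : ∀ i : ℕ, i < j → ∀ e, e ∈ a0Edges (q + (2 * (i : ℤ)) • u) w u → e ∈ H :=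
    fun i hi e he => hstack ⟨i, hi, he⟩
  have hA' : ∀ e ∈ a1Edges p w u, e ∈ H := fun e he => hA he
  simp only [a0Edges, leafEdges, pt_pt, Set.mem_union, Set.mem_insert_iff, Set.mem_singleton_iff,
    add_zero] at e0
  simp only [a1Edges, hp, pt_pt, Set.mem_insert_iff, Set.mem_singleton_iff] at hA'
  have r2 : 2 * ((j : ℤ) - 1) + 2 = 2 * j := by ring
  have r3 : 2 * ((j : ℤ) - 1) + 3 = 2 * j + 1 := by ring
  have r4 : 2 * ((j : ℤ) - 1) + 4 = 2 * j + 1 + 1 := by ring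
  rw [r2, r3, r4] at hA'
  have leg : ∀ i : ℕ, i ≤ j → ver H q w u 1 (2 * i) = 1 := by
    intro i hi
    rw [ver_eq_one_iff]
    rcases hi.lt_or_eq with h | rfl
    · rw [Sym2.eq_swap]
      exact e0 i h _ (by simp)
    · exact hA' _ (by simp)
  have leg' : ∀ i : ℕ, i ≤ j → ver H q w u 0 (2 * i) = 1 := by
    intro i hi
    rw [ver_eq_one_iff]
    rcases hi.lt_or_eq with h | rfl
    · exact e0 i h _ (by simp)
    · exact hA' _ (by simp)
  have top : ∀ i : ℕ, i < j → hor H q w u 0 (2 * i + 1) = 1 := fun i hi =>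
    hor_eq_one_iff.2 (e0 i hi _ (by simp))
  have up : pt q w u 0 0 ∈ gridVerts m n ∧ pt q w u 1 0 ∈ gridVerts m n := by
    have h1 := leg 0 (by omega)
    have h2 := leg' 0 (by omega)
    rw [ver_eq_one_iff] at h1 h2
    exact ⟨by simpa using mem_gridVerts_of_mem hH.1 h2, by simpa using mem_gridVerts_of_mem hH.1 h1⟩
  refine ⟨hH, hf, ?_, ?_, leg, leg', top, ?_, ?_, ?_⟩
  · intro i hi
    rw [hor_eq_one_iff]
    rcases hi.lt_or_eq with h | rfl
    · exact e0 i h _ (by norm_num)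
    · exact hA' _ (by norm_num)
  · intro i hi
    rw [hor_eq_one_iff]
    rcases hi.lt_or_eq with h | rfl
    · exact e0 i h _ (by norm_num)
    · exact hA' _ (by norm_num)
  · exact ver_eq_one_iff.2 (hA' _ (by simp))
  · exact ver_eq_one_iff.2 (hA' _ (by simp))
  · intro hb
    refine notMem_of_isSmallCookie hC hf ?_ ?_ ?_ ?_
    · have h := leg 0 (by omega)
      rw [ver_eq_one_iff, ← wall_left_iff hf] at h
      rw [← wall_neg hf.left]
      simpa using h
    · have h := leg' 0 (by omega)
      rw [ver_eq_one_iff, ← wall_left_iff hf] at h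
      simpa using h
    · have h := top 0 (by omega)
      rw [hor_eq_one_iff, ← wall_down_iff hf] at h
      rw [← wall_neg hf.right]
      simpa using h
    · have h := boxAt_add_mem hf hb (m := m) (n := n) (by norm_num; exact up.2)
      simpa using h

lemma IsStack.hor_even (S : IsStack m n H q w u j) {i : ℕ} (hi : i ≤ j) :
    hor H q w u 0 (2 * i) = 0 := by
  have h := S.deg_eq 1 (2 * i) (S.mem (by omega) (by omega) (by omega) (by omega))
  have h1 := S.wing i hi
  have h2 := S.leg i hi
  norm_num at h
  omega

lemma IsStack.hor_top (S : IsStack m n H q w u j) : hor H q w u 0 (2 * j + 1) = 0 := by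
  have h := S.deg_eq 1 (2 * j + 1) (S.mem (by omega) (by omega) (by omega) (by omega))
  have h1 := S.upper
  have h2 := S.leg j le_rfl
  norm_num at h
  omega

lemma not_wall_down_iff (hf : IsFrame w u) (x y : ℤ) :
    ¬Wall H (boxAt q w u + x • w + y • u) (-u) ↔ hor H q w u x y = 0 := by
  rw [wall_down_iff hf]
  by_cases h : s(pt q w u x y, pt q w u (x + 1) y) ∈ H <;> simp [hor, h]

/-- For `j = 1` the middle box of the `A₁`-type is in the interior, as it is separated from the small
cookie at the start of the stack by a single wall. -/
lemma IsStack.two_le (S : IsStack m n H q w u j) (hj : 1 ≤ j)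
    (hC : IsSmallCookie m n H (boxAt q w u))
    (hM : boxAt q w u + (2 * (j : ℤ)) • u ∉ interiorBoxes H) : 2 ≤ j := by
  by_contra hc
  obtain rfl : j = 1 := by omega
  have hu := S.frame.right
  obtain ⟨B, hB, hext, hC'⟩ := hC
  obtain rfl : B = boxAt q w u := by
    have : B ∈ ({boxAt q w u} : Set Box) := by rw [hC']; exact Reachable.refl B
    exact this
  have h0 := not_mem_interior_of_inExt S.ham hext
  have h1 : Wall H (boxAt q w u) u := by
    have h := S.top 0 (by omega)
    rw [hor_eq_one_iff, ← wall_down_iff S.frame] at h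
    rw [← wall_neg hu]
    simpa using h
  have h2 : ¬Wall H (boxAt q w u + u) u := by
    have h := (not_wall_down_iff S.frame 0 _).2 (S.hor_even le_rfl)
    rw [← wall_neg hu]
    convert h using 2
    push_cast
    module
  refine hM ?_
  have h3 := (mem_interior_iff_of_wall S.ham hu h1).2 h0
  have h4 := (mem_interior_iff_of_not_wall S.ham hu h2).2 h3
  convert h4 using 1
  push_cast
  module

lemma endBoxX_eq (hf : IsFrame w u) (hp : p = q + (2 * ((j : ℤ) - 1)) • u) :
    endBoxX p w u = boxAt q w u + (2 * (j : ℤ)) • u + w := by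
  rw [endBoxX, hp, pt_pt, boxAt_pt hf]
  module

lemma endBoxY_eq (hf : IsFrame w u) (hp : p = q + (2 * ((j : ℤ) - 1)) • u) :
    endBoxY p w u = boxAt q w u + (2 * (j : ℤ)) • u + -w := by
  rw [endBoxY, hp, pt_pt, boxAt_pt hf]
  module

/-- The boxes of a looping fat path anchored at the stack form a path as in `IsLoop`. -/
theorem IsStack.isLoop (S : IsStack m n H q w u j) (hp : p = q + (2 * ((j : ℤ) - 1)) • u)
    (P : (boxGraph m n H).Walk (endBoxX p w u) (endBoxY p w u)) (hP : P.IsPath)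
    (hW : ¬HasShortWeakening m n H p w u) :
    IsLoop m n H w u (boxAt q w u + (2 * (j : ℤ)) • u) P.length P.getVert := by
  have hf := S.frame
  have hw := hf.left
  have hu := hf.right
  set M : Box := boxAt q w u + (2 * (j : ℤ)) • u with hM
  have hbox : ∀ x : ℤ, boxAt q w u + x • w + (2 * (j : ℤ)) • u = M + x • w := fun x => by
    rw [hM]
    module
  have hbox' : ∀ x : ℤ, boxAt q w u + x • w + (2 * (j : ℤ) + 1) • u = M + x • w + u := fun x => by
    rw [hM]
    module
  have c1 := S.leg j le_rfl
  have c2 := S.leg' j le_rfl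
  have c3 := S.wing j le_rfl
  have c4 := S.wing' j le_rfl
  have c5 := S.upper
  have c6 := S.upper'
  have c7 := S.hor_even le_rfl
  have c8 := S.hor_top
  rw [ver_eq_one_iff, ← wall_left_iff hf] at c1 c2 c5 c6
  rw [hor_eq_one_iff, ← wall_down_iff hf] at c3 c4
  rw [← not_wall_down_iff hf] at c7 c8
  rw [hbox] at c1 c2 c3 c4 c7
  rw [hbox'] at c5 c6 c8
  simp only [one_smul, zero_smul, neg_smul, add_zero] at c1 c2 c3 c4 c5 c6 c7 c8
  rw [wall_neg hw] at c1
  rw [add_right_comm, wall_neg hw] at c5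
  rw [wall_neg hu] at c8
  refine ⟨S.ham, ⟨hf, c1, c2, c8, c7⟩, ?_, ?_, c3, c4, c5, c6, ?_, ?_, ?_, ?_, ?_, ?_⟩
  · have h := boxAt_add_mem hf (S.mem (x := 0) (y := 2 * j) (by omega) (by omega) (by omega)
      (by omega)) (S.mem (by omega) (by omega) (by omega) (by omega))
    simpa [hM] using h
  · have h := boxAt_add_mem hf (S.mem (x := 0) (y := 2 * j + 1) (by omega) (by omega) (by omega)
      (by omega)) (S.mem (by omega) (by omega) (by omega) (by omega))
    rw [hbox'] at h
    simpa using h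
  · rw [P.getVert_zero, endBoxX_eq hf hp, hM]
  · rw [P.getVert_length, endBoxY_eq hf hp, hM]
  · intro i hi
    exact (boxGraph_adj.1 (P.adj_getVert_succ hi)).2.2
  · intro i hi
    rcases i with _ | i
    · exact (boxGraph_adj.1 (P.adj_getVert_succ (i := 0) (Nat.pos_of_ne_zero fun h0 => by
        have h1 := P.getVert_zero.symm.trans ((congrArg P.getVert h0.symm).trans P.getVert_length)
        rw [endBoxX_eq hf hp, endBoxY_eq hf hp] at h1
        exact hw.ne_neg (by simpa [add_assoc] using h1)))).1
    · exact (boxGraph_adj.1 (P.adj_getVert_succ (i := i) (by omega))).2.1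
  · intro i hi k hk h
    exact hP.getVert_injOn hi hk h
  · intro l H' hl hc h
    refine hW ⟨l, H', hl, hc, ?_⟩
    have h1 := (wall_down_iff (H := H') (q := q) hf 0 (2 * j)).1 (by
      rw [hbox]
      simpa using h)
    rw [hp, pt_pt, pt_pt]
    convert h1 using 4 <;> ring

end Setup

/-! ### The shape of the path and of its neighbourhood -/

section Region

variable {m n : ℕ} {H : EdgeSet}

/-- A path between the end-boxes of an `A₁`-type without an inner box that has two opposite walls. -/
structure IsTight (m n : ℕ) (H : EdgeSet) (w u : ℤ × ℤ) (M : Box) (r : ℕ) (z : ℕ → Box) : Prop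
    extends IsLoop m n H w u M r z where
  no_parallel : ∀ k e, 0 < k → k < r → IsUnitVec e → Wall H (z k) e → ¬Wall H (z k) (-e)

/-- The boxes of the path `z 0, …, z r` and their neighbours. -/
def region (m n : ℕ) (H : EdgeSet) (r : ℕ) (z : ℕ → Box) : Set Box :=
  {x | ∃ i ≤ r, z i = x ∨ (boxGraph m n H).Adj (z i) x}

lemma region_flip (r : ℕ) (z : ℕ → Box) :
    region m n H r (fun i => z (r - i)) = region m n H r z := by
  ext x
  constructor
  · rintro ⟨i, hi, h⟩
    exact ⟨r - i, by omega, h⟩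
  · rintro ⟨i, hi, h⟩
    refine ⟨r - i, by omega, ?_⟩
    simpa only [show r - (r - i) = i by omega] using h

lemma Grown.union {V : Type*} {G : SimpleGraph V} {S T : Set V} (hS : Grown G S) (hT : T.Finite)
    (h : ∀ x ∈ T, ∃ A ∈ S, G.Adj A x) : Grown G (S ∪ T) := by
  induction T, hT using Set.Finite.induction_on with
  | empty => rwa [Set.union_empty]
  | @insert x T _ _ ih =>
    rw [Set.union_insert]
    obtain ⟨A, hA, hAx⟩ := h x (Set.mem_insert _ _)
    exact (ih fun y hy => h y (Set.mem_insert_of_mem _ hy)).insert_of_mem (Or.inl hA) hAx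

lemma finite_gridBoxes (m n : ℕ) : (gridBoxes m n).Finite := by
  refine (finite_gridVerts m n).subset fun B hB => ?_
  simp only [gridBoxes, gridVerts, Set.mem_ofPred_eq] at hB ⊢
  omega

namespace IsTight

variable {w u : ℤ × ℤ} {M : Box} {r : ℕ} {z : ℕ → Box} (T : IsTight m n H w u M r z)

include T

lemma flip : IsTight m n H (-w) u M r (fun i => z (r - i)) :=
  ⟨T.toIsLoop.flip, fun k e h1 h2 he => T.no_parallel (r - k) e (by omega) (by omega) he⟩

lemma frame : IsFrame w u := T.corridor.frame

lemma not_walls_next {k : ℕ} {d e : ℤ × ℤ} (hf : IsFrame d e) (hk : k < r)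
    (h : z (k + 1) = z k + d) (h1 : Wall H (z (k + 1)) e) (h2 : Wall H (z (k + 1)) (-e))
    (n1 : ¬Wall H (z k) e) (n2 : ¬Wall H (z k) (-e)) : False := by
  rcases Nat.lt_or_ge (k + 1) r with hlt | hge
  · exact T.no_parallel _ e (by omega) hlt hf.right h1 h2
  · exact T.not_walls_finish hf (by omega) h h1 h2 n1 n2

lemma not_walls_prev {k : ℕ} {d e : ℤ × ℤ} (hf : IsFrame d e) (hk : k < r)
    (h : z (k + 1) = z k + d) (h1 : Wall H (z k) e) (h2 : Wall H (z k) (-e))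
    (n1 : ¬Wall H (z (k + 1)) e) (n2 : ¬Wall H (z (k + 1)) (-e)) : False := by
  have e1 : r - (r - (k + 1)) = k + 1 := by omega
  have e2 : r - (r - (k + 1) + 1) = k := by omega
  refine T.flip.not_walls_next (k := r - (k + 1)) hf.neg_left (by omega) ?_ ?_ ?_ ?_ ?_ <;>
    simp only [e1, e2]
  · rw [h, add_neg_cancel_right]
  all_goals assumption

/-- Where the path turns, both outer sides of the box are walls; otherwise the box before or after it
would have walls on both sides. -/
lemma turn {k : ℕ} {a b : ℤ × ℤ} (hf : IsFrame a b) (hk : k + 1 < r) (h : z (k + 1) = z k + a)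
    (h' : z (k + 2) = z (k + 1) + b) : Wall H (z (k + 1)) a ∧ Wall H (z (k + 1)) (-b) := by
  obtain ⟨-, h1, h2⟩ := T.open_step (by omega) h
  obtain ⟨-, h3, h4⟩ := T.open_step hk h'
  have hG := T.mem (k + 1) hk.le
  have hk0 : z (k + 1) + -a = z k := by rw [h, add_neg_cancel_right]
  constructor
  · by_contra hc
    have g1 := (corner_of_not_of_not T.ham hG hf hc h3).2
    have g2 := (corner_of_not_of_not T.ham hG hf.neg_left h2 h3).2
    rw [← h'] at g1 g2
    exact T.not_walls_next hf.symm hk h' g1 g2 hc h2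
  · by_contra hc
    have g1 := (corner_of_not_of_not T.ham hG hf.neg_left h2 h3).1
    have g2 := (corner_of_not_of_not T.ham hG hf.neg_left.neg_right h2 hc).1
    rw [hk0] at g1 g2
    exact T.not_walls_prev hf (by omega) h g1 g2 h3 hc

/-- Exactly one of the two sides along the direction in which the path leaves an inner box is a
wall. -/
lemma wall_iff_of_next {k : ℕ} {a b : ℤ × ℤ} (hf : IsFrame a b) (hk0 : 0 < k) (hk : k < r)
    (h : z (k + 1) = z k + a) : Wall H (z k) b ↔ ¬Wall H (z k) (-b) := by
  refine ⟨T.no_parallel _ b hk0 hk hf.right, fun hb' => ?_⟩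
  by_contra hb
  have hG := T.mem k hk.le
  have h1 := (T.open_step hk h).2.1
  have g1 := (corner_of_not_of_not T.ham hG hf h1 hb).1
  have g2 := (corner_of_not_of_not T.ham hG hf.neg_right h1 hb').1
  rw [← h] at g1 g2
  exact T.not_walls_next hf hk h g1 g2 hb hb'

lemma leg_start : Wall H (M + w + u) (-w) := by
  rw [add_right_comm, wall_neg T.frame.left]
  exact T.leg

lemma mem_start : M + w ∈ gridBoxes m n := T.start ▸ T.mem 0 (by omega)

/-- The path leaves the end-box `M + w` in the direction `w`, if it can. -/
lemma start_next : (Wall H (M + w) w ∧ z 1 = M + w + u) ∨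
    (¬Wall H (M + w) w ∧ z 1 = M + w + w ∧ Wall H (M + w + u) w) := by
  obtain ⟨t, ht, h1, h2⟩ := T.step 0 T.pos
  rw [zero_add, T.start] at h1
  rw [T.start] at h2
  have key : ¬Wall H (M + w) w → Wall H (M + w + u) w := fun h =>
    (corner_of_not_of_not T.ham T.mem_start T.frame h T.not_wall_start).2
  rcases ht.cases_of_isFrame T.frame with rfl | rfl | rfl | rfl
  · exact Or.inr ⟨h2, h1, key h2⟩
  · exact absurd T.wall_start h2
  · by_cases h : Wall H (M + w) w
    · exact Or.inl ⟨h, h1⟩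
    · have hr : 1 < r := by
        by_contra hc
        obtain rfl : r = 1 := by have := T.pos; omega
        have h3 := h1.symm.trans T.finish
        rw [add_assoc, add_right_inj] at h3
        rcases isFrame_cases T.frame with ⟨rfl, rfl⟩ | ⟨rfl, rfl⟩ | ⟨rfl, rfl⟩ | ⟨rfl, rfl⟩ |
          ⟨rfl, rfl⟩ | ⟨rfl, rfl⟩ | ⟨rfl, rfl⟩ | ⟨rfl, rfl⟩ <;> simp at h3
      have h4 := T.leg_start
      rw [← h1] at h4
      exact absurd h4 (T.no_parallel 1 w (by omega) hr T.frame.left (by rw [h1]; exact key h))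
  · exact absurd T.wing h2

lemma mem_of_not_wall_of_adj (hI : M ∈ interiorBoxes H) {k l : ℕ} (hk : k ≤ r) (hl : l ≤ r)
    {d e : ℤ × ℤ} (hf : IsFrame d e) (hd : z l = z k + d) (h1 : ¬Wall H (z k) d)
    (h2 : ¬Wall H (z k) e) : z k + e ∈ gridBoxes m n := by
  by_contra hc
  have hl' : z l ∉ interiorBoxes H := fun h => (T.interior_iff hl).1 h hI
  have h3 := (corner_of_not_of_not T.ham (T.mem k hk) hf h1 h2).1
  rw [← hd] at h3
  refine not_wall_of_notMem_interior T.ham hf.right hl' (fun h => ?_) h3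
  have h4 := mem_gridBoxes_of_mem_interior T.ham h
  rw [hd] at h4
  exact notMem_slide hf (T.mem k hk) hc h4

/-- Even if the path is in the exterior, it does not pass along an open boundary edge. -/
lemma mem_of_not_wall {k : ℕ} (hk : k ≤ r) {e : ℤ × ℤ} (he : IsUnitVec e)
    (h : ¬Wall H (z k) e) : z k + e ∈ gridBoxes m n := by
  by_cases hI : M ∈ interiorBoxes H
  swap
  · exact mem_gridBoxes_of_interior_of_not_wall T.ham he ((T.interior_iff hk).2 hI) h
  have hstart : ∀ {w z} (T : IsTight m n H w u M r z), ¬Wall H (z 0) e →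
      z 0 + e ∈ gridBoxes m n := by
    intro w z T h
    rcases T.start_next with ⟨h1, h2⟩ | ⟨h1, h2, -⟩
    · rw [T.start] at h
      have h3 := T.mem 1 T.pos
      rw [h2] at h3
      rcases he.cases_of_isFrame T.frame with rfl | rfl | rfl | rfl
      · exact absurd h1 h
      · exact absurd T.wall_start h
      · rwa [T.start]
      · exact absurd T.wing h
    · rcases he.cases_of_isFrame T.frame with rfl | rfl | rfl | rfl
      · rw [T.start, ← h2]
        exact T.mem 1 T.pos
      · exact absurd T.wall_start (by rwa [← T.start])
      · exact T.mem_of_not_wall_of_adj hI (k := 0) (l := 1) (by omega) T.pos T.frame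
          (by rw [T.start, h2]) (by rwa [T.start]) h
      · exact absurd T.wing (by rwa [← T.start])
  rcases Nat.eq_zero_or_pos k with rfl | hk0
  · exact hstart T h
  rcases hk.lt_or_eq with hkr | rfl
  · obtain ⟨i, rfl⟩ : ∃ i, k = i + 1 := ⟨k - 1, by omega⟩
    obtain ⟨a, ha, h1, h2⟩ := T.step i (by omega)
    have h3 := (T.open_step (by omega) h1).2.2
    have h4 : z i = z (i + 1) + -a := by rw [h1, add_neg_cancel_right]
    obtain ⟨t, ht, h5, h6⟩ := T.step (i + 1) hkr
    rcases ha.trichotomy he with rfl | rfl | hf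
    · rcases he.trichotomy ht with rfl | rfl | hf
      · exact h5 ▸ T.mem (i + 2) hkr
      · have := T.inj (i + 2) (by omega) i (by omega) (h5.trans h4.symm)
        omega
      · exact T.mem_of_not_wall_of_adj hI hk (l := i + 2) (by omega) hf.symm h5 h6 h
    · exact h4 ▸ T.mem i (by omega)
    · exact T.mem_of_not_wall_of_adj hI hk (l := i) (by omega) hf.neg_left h4 h3 h
  · have := hstart T.flip
    simp only [Nat.sub_zero] at this
    exact this h

lemma mem_region_of_not_wall {k : ℕ} (hk : k ≤ r) {e : ℤ × ℤ} (he : IsUnitVec e)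
    (h : ¬Wall H (z k) e) : z k + e ∈ region m n H r z :=
  ⟨k, hk, Or.inr (boxGraph_adj_add (T.mem k hk) he (T.mem_of_not_wall hk he h) h)⟩

lemma region_subset : region m n H r z ⊆ gridBoxes m n := by
  rintro x ⟨i, hi, rfl | h⟩
  · exact T.mem i hi
  · exact (boxGraph_adj.1 h).2.1

lemma grown_region : Grown (boxGraph m n H) (region m n H r z) := by
  convert (T.grown (k := r) le_rfl).union (T := region m n H r z \ {x | ∃ i ≤ r, z i = x})
    (((finite_gridBoxes m n).subset T.region_subset).subset Set.sdiff_subset) ?_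
  · rw [Set.union_sdiff_cancel]
    rintro x ⟨i, hi, h⟩
    exact ⟨i, hi, Or.inl h⟩
  · rintro x ⟨⟨i, hi, h | h⟩, hx⟩
    · exact absurd ⟨i, hi, h⟩ hx
    · exact ⟨z i, ⟨i, hi, rfl⟩, h⟩

lemma mem_interior_of_region {x : Box} (hx : x ∈ region m n H r z) :
    x ∈ interiorBoxes H ↔ M ∉ interiorBoxes H := by
  obtain ⟨i, hi, rfl | h⟩ := hx
  · exact T.interior_iff hi
  · rw [mem_interior_iff_of_adj T.ham h.2.2]
    exact T.interior_iff hi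

/-- A neighbour of the path that is not on the path has walls on both sides. -/
lemma leaf_walls {k : ℕ} (hk : k ≤ r) {e d : ℤ × ℤ} (hf : IsFrame e d) (h : ¬Wall H (z k) e)
    (hx : ∀ i ≤ r, z i ≠ z k + e) : Wall H (z k + e) d ∧ Wall H (z k + e) (-d) := by
  have hstart : ∀ {w z} (T : IsTight m n H w u M r z), ¬Wall H (z 0) e →
      (∀ i ≤ r, z i ≠ z 0 + e) → Wall H (z 0 + e) d ∧ Wall H (z 0 + e) (-d) := by
    intro w z T h hx
    rw [T.start] at h hx ⊢
    rcases T.start_next with ⟨h1, h2⟩ | ⟨h1, h2, h3⟩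
    · rcases hf.left.cases_of_isFrame T.frame with rfl | rfl | rfl | rfl
      · exact absurd h1 h
      · exact absurd T.wall_start h
      · exact absurd h2 (hx 1 T.pos)
      · exact absurd T.wing h
    · rcases hf.left.cases_of_isFrame T.frame with rfl | rfl | rfl | rfl
      · exact absurd h2 (hx 1 T.pos)
      · exact absurd T.wall_start h
      · rcases hf.right.cases_of_isFrame T.frame with rfl | rfl | rfl | rfl
        · exact ⟨h3, T.leg_start⟩
        · exact ⟨T.leg_start, by rwa [neg_neg]⟩
        · exact absurd rfl hf.ne
        · exact absurd (by simp) hf.ne_neg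
      · exact absurd T.wing h
  rcases Nat.eq_zero_or_pos k with rfl | hk0
  · exact hstart T h hx
  rcases hk.lt_or_eq with hkr | rfl
  · obtain ⟨i, rfl⟩ : ∃ i, k = i + 1 := ⟨k - 1, by omega⟩
    obtain ⟨a, ha, h1, h2⟩ := T.step i (by omega)
    have h3 := (T.open_step (by omega) h1).2.2
    have h4 : z i = z (i + 1) + -a := by rw [h1, add_neg_cancel_right]
    have hG := T.mem (i + 1) hk
    obtain ⟨t, ht, h5, h6⟩ := T.step (i + 1) hkr
    rcases ha.trichotomy ht with rfl | rfl | hft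
    · have hfe : IsFrame t e := by
        rcases ht.trichotomy hf.left with rfl | rfl | hfe
        · exact absurd h5 (hx _ hkr)
        · exact absurd h4 (hx _ (by omega))
        · exact hfe
      have g1 := (corner_of_not_of_not T.ham hG hfe h6 h).2
      have g2 := (corner_of_not_of_not T.ham hG hfe.neg_left h3 h).2
      rcases hf.right.cases_of_isFrame hfe with rfl | rfl | rfl | rfl
      · exact ⟨g1, g2⟩
      · exact ⟨g2, by rwa [neg_neg]⟩
      · exact absurd rfl hf.ne
      · exact absurd (by simp) hf.ne_neg
    · have := T.inj (i + 2) (by omega) i (by omega) (h5.trans h4.symm)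
      omega
    · obtain ⟨g1, g2⟩ := T.turn hft hkr h1 h5
      rcases hf.left.cases_of_isFrame hft with rfl | rfl | rfl | rfl
      · exact absurd g1 h
      · exact absurd h4 (hx _ (by omega))
      · exact absurd h5 (hx _ hkr)
      · exact absurd g2 h
  · have := hstart T.flip
    simp only [Nat.sub_zero] at this
    exact this h fun i hi => hx _ (by omega)

end IsTight

end Region

/-! ### Shadows of connected sets of boxes -/

section Shadow

variable {m n : ℕ} {H : EdgeSet} {S : Set Box}

lemma Grown.mem_interior_iff (hH : IsGridHamCycle m n H) (hS : Grown (boxGraph m n H) S) {A B : Box}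
    (hA : A ∈ S) (hB : B ∈ S) : A ∈ interiorBoxes H ↔ B ∈ interiorBoxes H := by
  obtain ⟨p, -⟩ := hS.exists_walk hA hB
  clear hA hB
  induction p with
  | nil => rfl
  | cons h p ih => rw [← mem_interior_iff_of_adj hH h.2.2, ih]

lemma Grown.not_wall (hH : IsGridHamCycle m n H) (hS : Grown (boxGraph m n H) S) {A : Box}
    {t : ℤ × ℤ} (ht : IsUnitVec t) (hA : A ∈ S) (hB : A + t ∈ S) : ¬Wall H A t := by
  rw [wall_iff hH ht, not_not]
  exact hS.mem_interior_iff hH hA hB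

/-- The shadow consists of the sides between boxes in `S` and boxes not in `S`. -/
lemma side_mem_shadowEdges (hH : IsGridHamCycle m n H) (hS : Grown (boxGraph m n H) S) {B : Box}
    {t : ℤ × ℤ} (ht : IsUnitVec t) :
    side B t ∈ shadowEdges H S ↔ ¬(B ∈ S ↔ B + t ∈ S) := by
  have h1 : (∃ Z ∈ S, side B t ∈ boxEdges Z) ↔ (B ∈ S ∨ B + t ∈ S) := by
    simp only [side_mem_boxEdges ht]
    constructor
    · rintro ⟨Z, hZ, rfl | rfl⟩
      · exact Or.inl hZ
      · exact Or.inr hZ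
    · rintro (h | h)
      · exact ⟨_, h, Or.inl rfl⟩
      · exact ⟨_, h, Or.inr rfl⟩
  have h2 : (∃ Z, Z ∉ S ∧ side B t ∈ boxEdges Z) ↔ (B ∉ S ∨ B + t ∉ S) := by
    simp only [side_mem_boxEdges ht]
    constructor
    · rintro ⟨Z, hZ, rfl | rfl⟩
      · exact Or.inl hZ
      · exact Or.inr hZ
    · rintro (h | h)
      · exact ⟨_, h, Or.inl rfl⟩
      · exact ⟨_, h, Or.inr rfl⟩
  have h3 : B ∈ S → B + t ∈ S → side B t ∉ H := fun h h' => hS.not_wall hH ht h h'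
  simp only [shadowEdges, inducedEdges, shadowBorder, Set.mem_union, Set.mem_ofPred_eq]
  rw [h1, h2]
  tauto

lemma exists_side_of_mem_shadowEdges {e : Sym2 Vtx} (h : e ∈ shadowEdges H S) :
    ∃ B ∈ S, ∃ t, IsUnitVec t ∧ e = side B t := by
  have : ∃ Z ∈ S, e ∈ boxEdges Z := h.elim (fun h => h.1) fun h => h.2.1
  obtain ⟨Z, hZ, he⟩ := this
  exact ⟨Z, hZ, mem_boxEdges.1 he⟩

/-- Two boxes of `S` that meet in a corner only are joined within `S` by a third box at this
corner. -/
lemma Grown.mem_of_diagonal (hH : IsGridHamCycle m n H) (hS : Grown (boxGraph m n H) S)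
    (hG : S ⊆ gridBoxes m n) {B : Box} {a b : ℤ × ℤ} (hf : IsFrame a b) (h1 : B ∈ S)
    (h2 : B + a + b ∈ S) : B + a ∈ S ∨ B + b ∈ S := by
  have key : ∀ {a b : ℤ × ℤ}, IsFrame a b → B + a + b ∈ S → B + a ∉ S → Wall H B a ∧
      Wall H (B + a) b := by
    intro a b hf h2 h3
    have ha := hf.left
    have hb := hf.right
    have hI := hS.mem_interior_iff hH h1 h2
    have hBa : B + a ∈ gridBoxes m n := (gridBoxes_rect (B := B + a) (a := -a) (b := b) hf.neg_left
      (by rw [add_neg_cancel_right]; exact hG h1) (hG h2)).1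
    rw [wall_iff hH ha, wall_iff hH hb]
    by_contra hc
    have h4 : ¬Wall H B a ∧ ¬Wall H (B + a) b := by
      rw [wall_iff hH ha, wall_iff hH hb]
      tauto
    have h5 := hS.eq_of_adj (isAcyclic_boxGraph hH) h1 h2 h3
      (boxGraph_adj_add (hG h1) ha hBa h4.1).symm (boxGraph_adj_add hBa hb (hG h2) h4.2)
    rw [add_assoc] at h5
    exact hf.add_ne_zero (by simpa using h5.symm)
  by_contra hc
  push Not at hc
  have h3 := key hf h2 hc.1
  have h4 := key hf.symm (by rwa [add_right_comm]) hc.2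
  exact (corner_of_of hH (hG h1) hf h3.1 h4.1).1 h3.2

lemma isLattice_shadowEdges : IsLattice (shadowEdges H S) := by
  intro v x h
  obtain ⟨B, -, t, ht, h⟩ := exists_side_of_mem_shadowEdges h
  obtain ⟨b, hb⟩ := ht.exists_isFrame
  rw [side_eq_corner hb] at h
  rcases Sym2.eq_iff.1 h with ⟨rfl, rfl⟩ | ⟨rfl, rfl⟩
  · simpa using hb.right.neg
  · simpa using hb.right

lemma deg_shadowEdges (hH : IsGridHamCycle m n H) (hS : Grown (boxGraph m n H) S)
    (hG : S ⊆ gridBoxes m n) {v : Vtx} (hv : v ∈ vertsOf S) : deg (shadowEdges H S) v = 2 := by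
  have hf : IsFrame (1, 0) (0, 1) := by simp [IsFrame, IsUnitVec, dot]
  obtain ⟨B, rfl⟩ := exists_eq_corner (a := (1, 0)) (b := (0, 1)) v
  obtain ⟨Z, hZ, hBZ⟩ := hv
  rw [corner_mem_boxVerts_iff hf] at hBZ
  rw [deg_corner hf]
  simp only [Wall, side_mem_shadowEdges hH hS hf.left, side_mem_shadowEdges hH hS hf.right]
  have h1 := hS.mem_of_diagonal hH hG (B := B) hf
  have h2 := hS.mem_of_diagonal hH hG (B := B + (1, 0)) hf.neg_left
  rw [add_neg_cancel_right] at h2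
  have h3 : ¬(B ∈ S ∧ B + (1, 0) ∈ S ∧ B + (0, 1) ∈ S ∧ B + (1, 0) + (0, 1) ∈ S) := by
    rintro ⟨g1, g2, g3, g4⟩
    exact hS.not_wall hH hf.right g2 g4 (corner_of_not_of_not hH (hG g1) hf
      (hS.not_wall hH hf.left g1 g2) (hS.not_wall hH hf.right g1 g3)).1
  have h4 : B ∈ S ∨ B + (1, 0) ∈ S ∨ B + (0, 1) ∈ S ∨ B + (1, 0) + (0, 1) ∈ S := by
    rcases hBZ with rfl | rfl | rfl | rfl <;> tauto
  rw [add_right_comm B (0, 1) (1, 0)]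
  by_cases g1 : B ∈ S <;> by_cases g2 : B + (1, 0) ∈ S <;> by_cases g3 : B + (0, 1) ∈ S <;>
    by_cases g4 : B + (1, 0) + (0, 1) ∈ S <;> simp only [g1, g2, g3, g4] at h1 h2 h3 h4 ⊢ <;>
    simp at h1 h2 h3 h4 ⊢

lemma isConnTwoRegular_shadowEdges (hH : IsGridHamCycle m n H) (hS : Grown (boxGraph m n H) S)
    (hG : S ⊆ gridBoxes m n) (hconn : ∀ v ∈ vertsOf S, ∀ x ∈ vertsOf S,
      (fromEdgeSet (shadowEdges H S)).Reachable v x) :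
    IsConnTwoRegular (vertsOf S) (shadowEdges H S) where
  subset := by
    intro v x h
    obtain ⟨B, hB, t, ht, h⟩ := exists_side_of_mem_shadowEdges h
    exact ⟨B, hB, mem_boxVerts_of_mem_boxEdges (by rw [h]; exact mem_boxEdges.2 ⟨t, ht, rfl⟩)⟩
  two := fun v hv => by
    rw [ncard_eq_deg isLattice_shadowEdges, deg_shadowEdges hH hS hG hv]
  irrefl := fun v h => by
    have := isLattice_shadowEdges v v h
    rw [sub_self] at this
    exact this.ne_zero rfl
  conn := hconn

lemma finite_vertsOf (hG : S ⊆ gridBoxes m n) : (vertsOf S).Finite := by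
  have h : vertsOf S = ⋃ Z ∈ S, boxVerts Z := by
    ext v
    simp [vertsOf]
  rw [h]
  refine ((finite_gridBoxes m n).subset hG).biUnion fun Z _ => ?_
  simp [boxVerts]

/-- The shadow is connected: adding a box to `S` replaces one edge of the shadow by the other three
sides of the box. -/
lemma Grown.reachable_shadowEdges (hH : IsGridHamCycle m n H) (hS : Grown (boxGraph m n H) S)
    (hG : S ⊆ gridBoxes m n) {v x : Vtx} (hv : v ∈ vertsOf S) (hx : x ∈ vertsOf S) :
    (fromEdgeSet (shadowEdges H S)).Reachable v x := by
  induction hS generalizing v x with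
  | single C =>
    have hf : IsFrame (1, 0) (0, 1) := by simp [IsFrame, IsUnitVec, dot]
    have hS := Grown.single (G := boxGraph m n H) C
    have hstep : ∀ {a b : ℤ × ℤ}, IsFrame a b → (fromEdgeSet (shadowEdges H {C})).Reachable
        (corner C a b) (corner C a (-b)) := by
      intro a b hf
      refine reachable_of_mem ?_
      rw [← side_eq_corner' hf, side_mem_shadowEdges hH hS hf.left]
      simpa using hf.left.ne_zero
    have key : ∀ v ∈ vertsOf {C}, (fromEdgeSet (shadowEdges H {C})).Reachable
        (corner C (1, 0) (0, 1)) v := by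
      rintro y ⟨Z, rfl, hy⟩
      have h1 := hstep hf
      have h2 := hstep hf.symm
      have h3 := hstep hf.neg_right.symm
      rw [corner_symm Z (0, 1), corner_symm Z (0, 1)] at h2
      rw [corner_symm Z (-(0, 1)), corner_symm Z (-(0, 1))] at h3
      rcases (mem_boxVerts hf).1 hy with rfl | rfl | rfl | rfl
      · exact Reachable.refl _
      · exact h1
      · exact h2
      · exact h1.trans h3
    exact (key v hv).symm.trans (key x hx)
  | @insert S A C hS hA hC hAC ih =>
    have hS' := hS.insert hA hC hAC
    have hGS : S ⊆ gridBoxes m n := fun B hB => hG (Or.inr hB)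
    obtain ⟨hAG, hCG, t, ht, hCt, hw⟩ := boxGraph_adj.1 hAC
    obtain ⟨b, hf⟩ := ht.exists_isFrame
    have huniq : ∀ K ∈ S, ∀ s, IsUnitVec s → K + s = C → K = A := by
      intro K hK s hs hKs
      have h1 := hS'.not_wall hH hs (Or.inr hK) (Or.inl hKs)
      exact hS.eq_of_adj (isAcyclic_boxGraph hH) hK hA hC
        (hKs ▸ boxGraph_adj_add (hGS hK) hs (hKs ▸ hCG) h1).symm hAC.symm
    have h2 := isConnTwoRegular_shadowEdges hH hS hGS fun v hv x hx => ih hGS hv hx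
    have hCside : ∀ s, IsUnitVec s → s ≠ -t → side C s ∈ shadowEdges H (Insert.insert C S) := by
      intro s hs hst
      rw [side_mem_shadowEdges hH hS' hs]
      have h3 : C + s ∉ Insert.insert C S := by
        rintro (h3 | h3)
        · exact hs.ne_zero (by simpa using h3)
        · have h4 := huniq _ h3 (-s) hs.neg (by rw [add_neg_cancel_right])
          rw [hCt, add_assoc] at h4
          exact hst (eq_neg_of_add_eq_zero_right (by simpa using h4))
      have h4 : C ∈ Insert.insert C S := Or.inl rfl
      tauto
    have hle : shadowEdges H S \ {side A t} ⊆ shadowEdges H (Insert.insert C S) := by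
      rintro e ⟨he, hne⟩
      obtain ⟨B, hB, s, hs, rfl⟩ := exists_side_of_mem_shadowEdges he
      rw [side_mem_shadowEdges hH hS hs] at he
      rw [side_mem_shadowEdges hH hS' hs]
      have h3 : B + s ∉ S := by tauto
      have h4 : B + s ≠ C := by
        intro h4
        obtain rfl := huniq B hB s hs h4
        rw [hCt, add_right_inj] at h4
        exact hne (by rw [h4]; rfl)
      have h5 : B + s ∉ Insert.insert C S := by
        rintro (h5 | h5)
        exacts [h4 h5, h3 h5]
      have h6 : B ∈ Insert.insert C S := Or.inr hB
      tauto
    have hreach : ∀ v ∈ vertsOf S, ∀ x ∈ vertsOf S,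
        (fromEdgeSet (shadowEdges H (Insert.insert C S))).Reachable v x := by
      intro v hv x hx
      have hmem : side A t ∈ shadowEdges H S := by
        rw [side_mem_shadowEdges hH hS ht, ← hCt]
        tauto
      rw [side_eq_corner hf] at hmem hle
      exact reachable_mono hle (h2.reachable_diff (finite_vertsOf hGS) hmem hv hx)
    have hold : ∀ {b : ℤ × ℤ}, IsFrame t b → corner C (-t) b ∈ vertsOf S := by
      intro b hf
      refine ⟨A, hA, ?_⟩
      rw [hCt, corner_symm, corner_add_neg hf.symm, corner_symm]
      exact corner_mem_boxVerts hf A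
    have hnew : ∀ {b : ℤ × ℤ}, IsFrame t b →
        (fromEdgeSet (shadowEdges H (Insert.insert C S))).Reachable (corner C t b)
          (corner C (-t) b) := by
      intro b hf
      refine reachable_of_mem ?_
      rw [corner_symm C t, corner_symm C (-t), ← side_eq_corner' hf.symm]
      exact hCside b hf.right fun h => hf.ne_neg (by rw [h, neg_neg])
    have key : ∀ v ∈ vertsOf (Insert.insert C S),
        (fromEdgeSet (shadowEdges H (Insert.insert C S))).Reachable (corner C (-t) b) v := by
      rintro y ⟨Z, rfl | hZ, hy⟩
      · rcases (mem_boxVerts hf).1 hy with rfl | rfl | rfl | rfl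
        all_goals first
          | exact (hnew hf).symm
          | exact hreach _ (hold hf) _ (hold hf)
          | exact (hreach _ (hold hf) _ (hold hf.neg_right)).trans (hnew hf.neg_right).symm
          | exact hreach _ (hold hf) _ (hold hf.neg_right)
      · exact hreach _ (hold hf) _ ⟨Z, hZ, hy⟩
    exact (key v hv).symm.trans (key x hx)

theorem Grown.isHamCycle_shadowEdges (hH : IsGridHamCycle m n H) (hS : Grown (boxGraph m n H) S)
    (hG : S ⊆ gridBoxes m n) (hne : S.Nonempty) : IsHamCycle (vertsOf S) (shadowEdges H S) := by
  obtain ⟨B, hB⟩ := hne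
  rw [isHamCycle_iff (finite_vertsOf hG) ⟨B, B, hB, Or.inl rfl⟩]
  exact isConnTwoRegular_shadowEdges hH hS hG fun v hv x hx =>
    hS.reachable_shadowEdges hH hG hv hx

end Shadow

/-! ### Collinear edges of the shadow -/

section Collinear

variable {m n : ℕ} {H : EdgeSet} {w u : ℤ × ℤ} {M : Box} {r : ℕ} {z : ℕ → Box}

namespace IsTight

variable (T : IsTight m n H w u M r z)

include T

lemma one_lt_of_start (h : z 1 = M + w + u) : 1 < r := by
  by_contra hc
  obtain rfl : r = 1 := by have := T.pos; omega
  have h3 := h.symm.trans T.finish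
  rw [add_assoc, add_right_inj] at h3
  rcases isFrame_cases T.frame with ⟨rfl, rfl⟩ | ⟨rfl, rfl⟩ | ⟨rfl, rfl⟩ | ⟨rfl, rfl⟩ |
    ⟨rfl, rfl⟩ | ⟨rfl, rfl⟩ | ⟨rfl, rfl⟩ | ⟨rfl, rfl⟩ <;> simp at h3

lemma one_lt_of_start' (h : z 1 = M + w + w) : 1 < r := by
  by_contra hc
  obtain rfl : r = 1 := by have := T.pos; omega
  have h3 := h.symm.trans T.finish
  rw [add_assoc, add_right_inj] at h3
  rcases T.frame.left with rfl | rfl | rfl | rfl <;> simp at h3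

/-- The collinear pairs of shadow edges beside the first box of the path and the next box of the
region in the direction `t`: there is only the leg of the `A₁`-type. -/
lemma start_collinear {t e : ℤ × ℤ} (hf : IsFrame t e) (h1 : Wall H (M + w) e)
    (h2 : ¬Wall H (M + w) t) (h3 : z 1 = M + w + t → Wall H (M + w + t) e) : t = u ∧ e = -w := by
  rcases T.start_next with ⟨h4, h5⟩ | ⟨h4, h5, h6⟩
  · rcases hf.left.cases_of_isFrame T.frame with rfl | rfl | rfl | rfl
    · exact absurd h4 h2
    · exact absurd T.wall_start h2
    · rcases hf.right.cases_of_isFrame T.frame with rfl | rfl | rfl | rfl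
      · have h7 := T.no_parallel 1 e (by omega) (T.one_lt_of_start h5) hf.right
          (by rw [h5]; exact h3 h5)
        rw [h5] at h7
        exact absurd T.leg_start h7
      · exact ⟨rfl, rfl⟩
      · exact absurd rfl hf.ne
      · exact absurd (by simp) hf.ne_neg
    · exact absurd T.wing h2
  · rcases hf.left.cases_of_isFrame T.frame with rfl | rfl | rfl | rfl
    · have h7 := (corner_of_not_of_not T.ham T.mem_start T.frame h4 T.not_wall_start).1
      rw [← h5] at h3 h7
      have h8 := T.no_parallel 1 u (by omega) (T.one_lt_of_start' h5) T.frame.right h7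
      rcases hf.right.cases_of_isFrame T.frame with rfl | rfl | rfl | rfl
      · exact absurd rfl hf.ne
      · exact absurd (by simp) hf.ne_neg
      · exact absurd h1 T.not_wall_start
      · exact absurd (h3 rfl) h8
    · exact absurd T.wall_start h2
    · rcases hf.right.cases_of_isFrame T.frame with rfl | rfl | rfl | rfl
      · exact absurd h1 h4
      · exact ⟨rfl, rfl⟩
      · exact absurd rfl hf.ne
      · exact absurd (by simp) hf.ne_neg
    · exact absurd T.wing h2

lemma finish_collinear {t e : ℤ × ℤ} (hf : IsFrame t e) (h1 : Wall H (M + -w) e)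
    (h2 : ¬Wall H (M + -w) t) (h3 : z (r - 1) = M + -w + t → Wall H (M + -w + t) e) :
    t = u ∧ e = w := by
  have := T.flip.start_collinear hf h1 h2 h3
  rwa [neg_neg] at this

/-- Two adjacent boxes of the region, one of them on the path, that both border on the complement of
the region on the same side `e`: one of them is an end-box, and the common line is a leg. -/
lemma collinear_of_path {k : ℕ} (hk : k ≤ r) {t e : ℤ × ℤ} (hf : IsFrame t e)
    (h2 : z k + t ∈ region m n H r z) (h3 : z k + e ∉ region m n H r z)
    (h4 : z k + t + e ∉ region m n H r z) :
    (t = u ∧ (z k = M + w ∧ e = -w ∨ z k = M + -w ∧ e = w)) ∨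
    (-t = u ∧ (z k + t = M + w ∧ e = -w ∨ z k + t = M + -w ∧ e = w)) := by
  have h5 : Wall H (z k) e := by
    by_contra hc
    exact h3 (T.mem_region_of_not_wall hk hf.right hc)
  have h6 : ¬Wall H (z k) t := T.grown_region.not_wall T.ham hf.left ⟨k, hk, Or.inl rfl⟩ h2
  have hpath : ∀ l ≤ r, z l = z k + t → Wall H (z k + t) e := by
    intro l hl h
    by_contra hc
    rw [← h] at h4 hc
    exact h4 (T.mem_region_of_not_wall hl hf.right hc)
  rcases Nat.eq_zero_or_pos k with rfl | hk0
  · left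
    rw [T.start] at h5 h6 hpath ⊢
    obtain ⟨rfl, rfl⟩ := T.start_collinear hf h5 h6 (hpath 1 T.pos)
    exact ⟨rfl, Or.inl ⟨rfl, rfl⟩⟩
  rcases hk.lt_or_eq with hkr | rfl
  swap
  · left
    rw [T.finish] at h5 h6 hpath ⊢
    obtain ⟨rfl, rfl⟩ := T.finish_collinear hf h5 h6 (hpath _ (by omega))
    exact ⟨rfl, Or.inr ⟨rfl, rfl⟩⟩
  by_cases hl : ∃ l ≤ r, z l = z k + t
  · obtain ⟨l, hl, h⟩ := hl
    have h7 := hpath l hl h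
    have h8 : z k = z l + -t := by rw [h, add_neg_cancel_right]
    have h9 : ¬Wall H (z l) (-t) := by rwa [h, wall_neg hf.left]
    rcases Nat.eq_zero_or_pos l with rfl | hl0
    · right
      rw [← h, T.start]
      rw [← h, T.start] at h7
      rw [T.start] at h9
      obtain ⟨h10, rfl⟩ := T.start_collinear hf.neg_left h7 h9 fun h11 => by
        rw [T.start] at h8
        rwa [← h8]
      exact ⟨h10, Or.inl ⟨rfl, rfl⟩⟩
    rcases hl.lt_or_eq with hlr | rfl
    · have h10 := T.no_parallel k e hk0 hkr hf.right h5
      have h11 := T.no_parallel l e hl0 hlr hf.right (by rwa [h])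
      rw [h] at h11
      exact absurd (corner_of_not_of_not T.ham (T.mem k hk) hf.neg_right h6 h10).1 h11
    · right
      rw [← h, T.finish]
      rw [← h, T.finish] at h7
      rw [T.finish] at h9
      obtain ⟨h10, rfl⟩ := T.finish_collinear hf.neg_left h7 h9 fun h11 => by
        rw [T.finish] at h8
        rwa [← h8]
      exact ⟨h10, Or.inr ⟨rfl, rfl⟩⟩
  · exfalso
    push Not at hl
    -- the path passes straight through `z k`, across the direction `t`, hence through the wall `e`
    obtain ⟨i, rfl⟩ : ∃ i, k = i + 1 := ⟨k - 1, by omega⟩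
    obtain ⟨a, ha, g1, g2⟩ := T.step i (by omega)
    have g3 := (T.open_step (by omega) g1).2.2
    have g4 : z i = z (i + 1) + -a := by rw [g1, add_neg_cancel_right]
    obtain ⟨s, hs, g5, g6⟩ := T.step (i + 1) hkr
    rcases ha.cases_of_isFrame hf with rfl | rfl | rfl | rfl
    · rcases hs.cases_of_isFrame hf with rfl | rfl | rfl | rfl
      · exact hl _ hkr g5
      · have := T.inj (i + 2) (by omega) i (by omega) (g5.trans g4.symm)
        omega
      · exact g6 h5
      · obtain ⟨g7, -⟩ := T.turn hf.neg_right hkr g1 g5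
        exact h6 g7
    · rw [neg_neg] at g4
      exact hl i (by omega) g4
    · rcases hs.cases_of_isFrame hf with rfl | rfl | rfl | rfl
      · exact hl _ hkr g5
      · obtain ⟨-, g7⟩ := T.turn hf.symm.neg_right hkr g1 g5
        rw [neg_neg] at g7
        exact h6 g7
      · exact g6 h5
      · have := T.inj (i + 2) (by omega) i (by omega) (g5.trans g4.symm)
        omega
    · rw [neg_neg] at g3
      exact g3 h5

lemma exists_path_of_adj {B : Box} {t : ℤ × ℤ} (ht : IsUnitVec t) (h1 : B ∈ region m n H r z)
    (h2 : B + t ∈ region m n H r z) : ∃ k ≤ r, z k = B ∨ z k = B + t := by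
  obtain ⟨i, hi, rfl | h3⟩ := h1
  · exact ⟨i, hi, Or.inl rfl⟩
  obtain ⟨k, hk, h4 | h4⟩ := id h2
  · exact ⟨k, hk, Or.inr h4⟩
  by_contra hc
  push Not at hc
  have h1 : B ∈ region m n H r z := ⟨i, hi, Or.inr h3⟩
  have hg := (T.grown (k := r) le_rfl).insert_of_mem (A := z i) ⟨i, hi, rfl⟩ h3
  refine (hc k hk).1 (hg.eq_of_adj (isAcyclic_boxGraph T.ham) (C := B + t) (Or.inr ⟨k, hk, rfl⟩)
    (Or.inl rfl) ?_ h4.symm ?_)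
  · rintro (h5 | ⟨l, hl, h5⟩)
    · exact ht.ne_zero (by simpa using h5)
    · exact (hc l hl).2 h5
  · exact (boxGraph_adj_add (T.region_subset h1) ht (T.region_subset h2)
      (T.grown_region.not_wall T.ham ht h1 h2)).symm

lemma collinear_of_region {B : Box} {t e : ℤ × ℤ} (hf : IsFrame t e)
    (h1 : B ∈ region m n H r z) (h2 : B + t ∈ region m n H r z)
    (h3 : B + e ∉ region m n H r z) (h4 : B + t + e ∉ region m n H r z) :
    (corner B t e = corner (M + w) u (-w) ∨ corner B t e = corner (M + -w) u w) ∧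
      (t = u ∨ t = -u) := by
  have key : ∀ {B : Box} {t : ℤ × ℤ}, IsFrame t e →
      (t = u ∧ (B = M + w ∧ e = -w ∨ B = M + -w ∧ e = w)) ∨
      (-t = u ∧ (B + t = M + w ∧ e = -w ∨ B + t = M + -w ∧ e = w)) →
      (corner B t e = corner (M + w) u (-w) ∨ corner B t e = corner (M + -w) u w) ∧
        (t = u ∨ t = -u) := by
    intro B t hf h
    have hc : corner (B + t) (-t) e = corner B t e := by
      rw [corner_symm, corner_add_neg hf.symm, corner_symm]
    rcases h with ⟨rfl, ⟨rfl, rfl⟩ | ⟨rfl, rfl⟩⟩ | ⟨rfl, ⟨h, rfl⟩ | ⟨h, rfl⟩⟩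
    · exact ⟨Or.inl rfl, Or.inl rfl⟩
    · exact ⟨Or.inr rfl, Or.inl rfl⟩
    · rw [← hc, h]
      exact ⟨Or.inl rfl, Or.inr (by simp)⟩
    · rw [← hc, h]
      exact ⟨Or.inr rfl, Or.inr (by simp)⟩
  obtain ⟨k, hk, rfl | h⟩ := T.exists_path_of_adj hf.left h1 h2
  · exact key hf (T.collinear_of_path hk hf h2 h3 h4)
  · obtain rfl : B = z k + -t := by rw [h, add_neg_cancel_right]
    rw [neg_add_cancel_right] at h2 h4
    have := key hf.neg_left (T.collinear_of_path hk hf.neg_left h1 h4 h3)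
    have hc : corner (z k + -t) t e = corner (z k) (-t) e := by
      have := corner_add_neg hf.symm.neg_right (z k)
      rwa [neg_neg, corner_symm, corner_symm _ e] at this
    rw [← hc, neg_inj, neg_eq_iff_eq_neg] at this
    exact ⟨this.1, this.2.symm⟩

/-- The consecutive collinear edges of the shadow are the legs of the `A₁`-type, whose middle vertices
are corners of the end-boxes. -/
theorem collinear_iff {v t : ℤ × ℤ} (ht : IsUnitVec t) :
    (s(v - t, v) ∈ shadowEdges H (region m n H r z) ∧
      s(v, v + t) ∈ shadowEdges H (region m n H r z)) ↔
    (v = corner (M + w) u (-w) ∨ v = corner (M + -w) u w) ∧ (t = u ∨ t = -u) := by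
  have hgr := T.grown_region
  have hiff : ∀ {B : Box} {t e : ℤ × ℤ}, IsFrame t e →
      ((s(corner B t e - t, corner B t e) ∈ shadowEdges H (region m n H r z) ∧
        s(corner B t e, corner B t e + t) ∈ shadowEdges H (region m n H r z)) ↔
      (¬(B ∈ region m n H r z ↔ B + e ∈ region m n H r z) ∧
        ¬(B + t ∈ region m n H r z ↔ B + t + e ∈ region m n H r z))) := by
    intro B t e hf
    rw [← side_mem_shadowEdges T.ham hgr hf.right, ← side_mem_shadowEdges T.ham hgr hf.right,
      side_eq_corner hf.symm, side_add_eq_corner hf.symm, corner_symm B e t,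
      Sym2.eq_swap (a := corner B t e - t)]
  constructor
  · intro h
    obtain ⟨e, hf⟩ := ht.exists_isFrame
    obtain ⟨B, rfl⟩ := exists_eq_corner (a := t) (b := e) v
    rw [hiff hf] at h
    have h1 := hgr.mem_of_diagonal T.ham T.region_subset (B := B) hf
    have h2 := hgr.mem_of_diagonal T.ham T.region_subset (B := B + t) hf.neg_left
    rw [add_neg_cancel_right] at h2
    have h3 : (B ∈ region m n H r z ∧ B + t ∈ region m n H r z ∧ B + e ∉ region m n H r z ∧
        B + t + e ∉ region m n H r z) ∨ (B ∉ region m n H r z ∧ B + t ∉ region m n H r z ∧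
        B + e ∈ region m n H r z ∧ B + t + e ∈ region m n H r z) := by tauto
    rcases h3 with ⟨g1, g2, g3, g4⟩ | ⟨g1, g2, g3, g4⟩
    · exact T.collinear_of_region hf g1 g2 g3 g4
    · have := T.collinear_of_region (B := B + e) hf.neg_right g3 (by rwa [add_right_comm])
        (by rwa [add_neg_cancel_right]) (by rwa [add_right_comm, add_neg_cancel_right])
      rwa [corner_add_neg hf] at this
  · have key : ∀ {w z} (T : IsTight m n H w u M r z), ∀ {t}, (t = u ∨ t = -u) →
        (s(corner (M + w) u (-w) - t, corner (M + w) u (-w)) ∈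
            shadowEdges H (region m n H r z) ∧
          s(corner (M + w) u (-w), corner (M + w) u (-w) + t) ∈
            shadowEdges H (region m n H r z)) := by
      intro w z T t ht
      have hf := T.frame
      have hgr := T.grown_region
      have hI : ∀ {x : Box}, x ∈ region m n H r z → (x ∈ interiorBoxes H ↔ M ∉ interiorBoxes H) :=
        T.mem_interior_of_region
      have h1 : M + w ∈ region m n H r z := T.start ▸ ⟨0, by omega, Or.inl rfl⟩
      have h2 : M + w + u ∈ region m n H r z := by
        have := T.mem_region_of_not_wall (k := 0) (by omega) hf.right
        rw [T.start] at this
        exact this T.not_wall_start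
      have h3 : M ∉ region m n H r z := fun h => by
        have := hI h
        tauto
      have h4 : M + u ∉ region m n H r z := fun h => by
        have h5 := hI h
        have h6 := mem_interior_iff_of_not_wall T.ham hf.right T.corridor.not_wall
        tauto
      have h5 : side (M + w) (-w) ∈ shadowEdges H (region m n H r z) := by
        rw [side_mem_shadowEdges T.ham hgr hf.left.neg, add_neg_cancel_right]
        tauto
      have h6 : side (M + w + u) (-w) ∈ shadowEdges H (region m n H r z) := by
        rw [side_mem_shadowEdges T.ham hgr hf.left.neg, add_right_comm, add_neg_cancel_right]
        rw [add_right_comm] at h2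
        tauto
      rw [side_eq_corner hf.neg_left, corner_symm] at h5
      rw [side_add_eq_corner hf.neg_left, corner_symm] at h6
      rcases ht with rfl | rfl
      · exact ⟨by rwa [Sym2.eq_swap], h6⟩
      · rw [sub_neg_eq_add, ← sub_eq_add_neg]
        exact ⟨by rwa [Sym2.eq_swap], h5⟩
    rintro ⟨rfl | rfl, h⟩
    · exact key T h
    · have := key T.flip h
      rwa [neg_neg, region_flip] at this

end IsTight

end Collinear

/-! ### Turns -/

section Turn

variable {m n : ℕ} {H : EdgeSet} {w u : ℤ × ℤ} {M : Box} {r : ℕ} {z : ℕ → Box}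

namespace IsTight

variable (T : IsTight m n H w u M r z)

include T

/-- From a box `z k` of maximal level `f` on the path, the path descends along a staircase, between
the boxes `z k + i • (a - b)` of maximal level. The staircase ends in a box beside the path, at the
latest when the path reaches its end-box. If `f (z r) = L - 1`, the end-box may lie next to the
staircase; this is admitted only for the directions `-w` and `u`, where the leg of the `A₁`-type
determines the walls of the end-box. -/
lemma exists_stairs {a b : ℤ × ℤ} (hf : IsFrame a b) {f : Box → ℤ} (fa : ∀ B, f (B + a) = f B + 1)
    (fb : ∀ B, f (B + b) = f B + 1) {L : ℤ} (hmax : ∀ i ≤ r, f (z i) ≤ L) (hend : f (z r) < L)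
    (hend' : f (z r) < L - 1 ∨ (a = -w ∧ b = u ∨ a = u ∧ b = -w)) {k : ℕ} (hk : k < r)
    (hL : f (z k) = L) (hnext : z (k + 1) = z k + -b) (hw : ¬Wall H (z k) (-a)) :
    ∃ s : ℕ, 1 ≤ s ∧
      (∀ i < s, Wall H (z k + i • (a - b)) a ∧ Wall H (z k + (i + 1) • (a - b)) b) ∧
      (∀ i ≤ s, z k + i • (a - b) ∈ region m n H r z) ∧ Wall H (z k + s • (a - b)) (-b) ∧
      z k + s • (a - b) ≠ z 0 ∧ z k + s • (a - b) ≠ z r := by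
  induction hs : r - k using Nat.strong_induction_on generalizing k with
  | _ N ih =>
  have fb' : ∀ B, f (B + -b) = f B - 1 := fun B => by
    have := fb (B + -b)
    rw [neg_add_cancel_right] at this
    omega
  have hG := T.mem k hk.le
  have ho := (T.open_step hk hnext).2.1
  have hK : Wall H (z (k + 1)) (-a) := by
    rw [hnext]
    exact (corner_of_not_of_not T.ham hG hf.neg_left.neg_right hw ho).2
  have hfK : f (z (k + 1)) = L - 1 := by rw [hnext, fb', hL]
  -- the walls at the step of the staircase between `z k` and the box after it
  have hstep : ¬Wall H (z (k + 1)) a → Wall H (z k) a ∧ Wall H (z (k + 1) + a) b := by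
    intro h
    rw [hnext] at h ⊢
    obtain ⟨h1, h2⟩ := corner_of_not_of_not' T.ham hG hf.neg_right.symm ho h
    have h3 := (wall_neg hf.right.neg).2 h2
    rw [neg_neg, add_right_comm] at h3
    exact ⟨h1, h3⟩
  have hab : z (k + 1) + a = z k + (a - b) := by
    rw [hnext]
    abel
  have hleaf : ¬Wall H (z (k + 1)) a → (∀ i ≤ r, z i ≠ z (k + 1) + a) → ∃ s : ℕ, 1 ≤ s ∧
      (∀ i < s, Wall H (z k + i • (a - b)) a ∧ Wall H (z k + (i + 1) • (a - b)) b) ∧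
      (∀ i ≤ s, z k + i • (a - b) ∈ region m n H r z) ∧ Wall H (z k + s • (a - b)) (-b) ∧
      z k + s • (a - b) ≠ z 0 ∧ z k + s • (a - b) ≠ z r := by
    intro h1 h2
    obtain ⟨h3, h4⟩ := T.leaf_walls (k := k + 1) hk hf h1 h2
    obtain ⟨h5, h6⟩ := hstep h1
    have h7 := T.mem_region_of_not_wall (k := k + 1) hk hf.left h1
    have h8 := h2 0 (by omega)
    have h9 := h2 r le_rfl
    rw [hab] at h4 h6 h7 h8 h9
    refine ⟨1, le_rfl, ?_, ?_, by rwa [one_smul], by rw [one_smul]; exact h8.symm,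
      by rw [one_smul]; exact h9.symm⟩
    · intro i hi
      obtain rfl : i = 0 := by omega
      rw [zero_smul, add_zero, zero_add, one_smul]
      exact ⟨h5, h6⟩
    · intro i hi
      obtain rfl | rfl : i = 0 ∨ i = 1 := by omega
      · rw [zero_smul, add_zero]
        exact ⟨k, hk.le, Or.inl rfl⟩
      · rwa [one_smul]
  have hoff : (z (k + 2) ≠ z (k + 1) + a ∨ k + 1 = r) → ¬Wall H (z (k + 1)) a →
      ∀ i ≤ r, z i ≠ z (k + 1) + a := by
    intro h1 h2 i hi h3
    have h4 := boxGraph_adj_add (T.mem (k + 1) hk) hf.left (h3 ▸ T.mem i hi) h2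
    rw [← h3] at h4
    rcases T.adj_consecutive hk hi h4 with h5 | rfl
    · obtain rfl : i = k := by omega
      rw [hnext] at h3
      have h6 : a = b := by
        rw [add_assoc] at h3
        have h7 : -b + a = 0 := by simpa using h3.symm
        exact (neg_add_eq_zero.1 h7).symm
      exact hf.ne h6
    · rcases h1 with h1 | h1
      · exact h1 h3
      · omega
  rcases Nat.lt_or_ge (k + 1) r with hlt | hge
  · rcases T.next hf.symm.neg_left hlt hnext with ⟨h1, h1'⟩ | ⟨h1, h1'⟩ | ⟨-, h1⟩
    · have h2 : ¬Wall H (z (k + 1)) a := by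
        rw [T.wall_iff_of_next hf.symm.neg_left (by omega) hlt h1, not_not]
        exact hK
      refine hleaf h2 (hoff (Or.inl ?_) h2)
      rw [h1]
      intro h3
      exact hf.ne_neg (by simpa using h3.symm)
    · have hfD : f (z (k + 2)) = L := by rw [h1, fa, hfK]; ring
      have hlt' : k + 2 < r := by
        by_contra hc
        obtain rfl : r = k + 2 := by omega
        omega
      have hback := (T.open_step hlt h1).2.2
      have hnext' : z (k + 3) = z (k + 2) + -b := by
        rcases T.next hf hlt' h1 with ⟨h2, -⟩ | ⟨h2, -⟩ | ⟨h2, -⟩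
        · have h3 := hmax (k + 3) hlt'
          rw [h2, fa, hfD] at h3
          omega
        · have h3 := hmax (k + 3) hlt'
          rw [h2, fb, hfD] at h3
          omega
        · exact h2
      obtain ⟨s, -, hs1, hs2, hs3, hs4, hs5⟩ := ih (r - (k + 2)) (by omega) (k := k + 2) hlt' hfD
        hnext' hback rfl
      have h2 : z (k + 2) = z k + (a - b) := by rw [h1, hab]
      have h3 : ∀ i : ℕ, z (k + 2) + i • (a - b) = z k + (i + 1) • (a - b) := by
        intro i
        rw [h2, add_smul, one_smul]
        abel
      obtain ⟨h5, h6⟩ := hstep h1'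
      refine ⟨s + 1, by omega, ?_, ?_, by rwa [← h3], by rwa [← h3], by rwa [← h3]⟩
      · rintro (_ | i) hi
        · rw [zero_smul, add_zero, zero_add, one_smul, ← hab]
          exact ⟨h5, h6⟩
        · rw [← h3, ← h3]
          exact hs1 i (by omega)
      · rintro (_ | i) hi
        · rw [zero_smul, add_zero]
          exact ⟨k, hk.le, Or.inl rfl⟩
        · rw [← h3]
          exact hs2 i (by omega)
    · exact absurd hK h1
  · obtain rfl : r = k + 1 := by omega
    have h1 := T.flip.start_next
    simp only [Nat.add_sub_cancel] at h1
    have hk' : z k = M + -w + b := by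
      rw [← T.finish, hnext, neg_add_cancel_right]
    rw [T.finish] at hK hleaf hoff ⊢
    rcases hend' with h2 | ⟨rfl, rfl⟩ | ⟨rfl, rfl⟩
    · omega
    · exfalso
      have h3 := T.flip.leg_start
      rw [← hk'] at h3
      exact hw h3
    · rcases h1 with ⟨-, h1⟩ | ⟨h1, h2, -⟩
      · rw [hk'] at h1
        exact absurd (by simpa using h1.symm) hf.ne
      · have h3 := T.flip.not_wall_start
        exact hleaf h3 (hoff (Or.inr rfl) h3)

/-- From the box where the path is extreme in the direction `w + u`, both arms of the path descend
along staircases; together they form the boundary of a turn, given here by the chain of boxes inside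
it. -/
lemma exists_chain {f : Box → ℤ} (fw : ∀ B, f (B + w) = f B + 1) (fu : ∀ B, f (B + u) = f B + 1) :
    ∃ a b, (a = w ∧ b = u ∨ a = u ∧ b = w) ∧ ∃ (L : Box) (d : ℕ), 2 ≤ d ∧ f M + 2 ≤ f L ∧
      Wall H L (-a) ∧ Wall H (L + (d - 1 : ℕ) • (a - b)) (-b) ∧
      (∀ i : ℕ, i + 1 < d →
        Wall H (L + i • (a - b)) a ∧ Wall H (L + (i + 1) • (a - b)) b) ∧
      (∀ i < d, L + i • (a - b) ∈ region m n H r z) ∧ (L ≠ z 0 ∧ L ≠ z r) ∧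
      (L + (d - 1 : ℕ) • (a - b) ≠ z 0 ∧ L + (d - 1 : ℕ) • (a - b) ≠ z r) := by
  have fneg : ∀ {t : ℤ × ℤ}, (∀ B, f (B + t) = f B + 1) → ∀ B, f (B + -t) = f B - 1 := by
    intro t ft B
    have := ft (B + -t)
    rw [neg_add_cancel_right] at this
    omega
  obtain ⟨k, hk, hmax⟩ := Finset.exists_max_image (Finset.range (r + 1)) (fun i => f (z i))
    ⟨0, by simp⟩
  have hkr : k ≤ r := by rw [Finset.mem_range] at hk; omega
  have hmax' : ∀ i ≤ r, f (z i) ≤ f (z k) := fun i hi => hmax i (by rw [Finset.mem_range]; omega)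
  have h0 : f (z 0) = f M + 1 := by rw [T.start, fw]
  have hr : f (z r) = f M - 1 := by rw [T.finish, fneg fw]
  have h1 : f (z 1) = f M + 2 := by
    rcases T.start_next with ⟨-, h⟩ | ⟨-, h, -⟩
    · rw [h, fu, fw]
      ring
    · rw [h, fw, fw]
      ring
  have hL := hmax' 1 T.pos
  have hk0 : k ≠ 0 := by
    rintro rfl
    omega
  have hkr' : k ≠ r := by
    rintro rfl
    omega
  obtain ⟨i, rfl⟩ : ∃ i, k = i + 1 := ⟨k - 1, by omega⟩
  have main : ∀ {a b}, (a = w ∧ b = u ∨ a = u ∧ b = w) → z (i + 1) = z i + a →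
      z (i + 2) = z (i + 1) + -b → ∃ (L : Box) (d : ℕ), 2 ≤ d ∧ f M + 2 ≤ f L ∧
      Wall H L (-a) ∧ Wall H (L + (d - 1 : ℕ) • (a - b)) (-b) ∧
      (∀ i : ℕ, i + 1 < d →
        Wall H (L + i • (a - b)) a ∧ Wall H (L + (i + 1) • (a - b)) b) ∧
      (∀ i < d, L + i • (a - b) ∈ region m n H r z) ∧ (L ≠ z 0 ∧ L ≠ z r) ∧
      (L + (d - 1 : ℕ) • (a - b) ≠ z 0 ∧ L + (d - 1 : ℕ) • (a - b) ≠ z r) := by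
    intro a b hab ha hb
    have hf : IsFrame a b := by
      rcases hab with ⟨rfl, rfl⟩ | ⟨rfl, rfl⟩
      exacts [T.frame, T.frame.symm]
    have fa : ∀ B, f (B + a) = f B + 1 := by
      rcases hab with ⟨rfl, rfl⟩ | ⟨rfl, rfl⟩
      exacts [fw, fu]
    have fb : ∀ B, f (B + b) = f B + 1 := by
      rcases hab with ⟨rfl, rfl⟩ | ⟨rfl, rfl⟩
      exacts [fu, fw]
    obtain ⟨s₁, hs₁, p1, p2, p3, p4, p5⟩ := T.exists_stairs hf fa fb hmax' (by omega)
      (Or.inl (by omega)) (by omega) rfl hb (T.open_step (by omega) ha).2.2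
    have hk' : r - (r - (i + 1)) = i + 1 := by omega
    have hk'' : r - (r - (i + 1) + 1) = i := by omega
    have hback := T.flip.exists_stairs (L := f (z (i + 1))) hf.symm fb fa
      (fun l hl => hmax' _ (by omega))
      (by simp only [Nat.sub_self]; omega) (Or.inr (by rw [neg_neg]; tauto)) (k := r - (i + 1))
      (by omega) (by simp only [hk'])
      (by simp only [hk', hk'']; rw [ha, add_neg_cancel_right])
      (by simp only [hk']; exact (T.open_step (by omega) hb).2.1)
    simp only [hk', Nat.sub_self, Nat.sub_zero, region_flip] at hback
    obtain ⟨s₂, hs₂, q1, q2, q3, q4, q5⟩ := hback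
    have e1 : ∀ l : ℕ, l ≤ s₂ → z (i + 1) + s₂ • (b - a) + l • (a - b) =
        z (i + 1) + (s₂ - l) • (b - a) := by
      intro l hl
      obtain ⟨x, rfl⟩ : ∃ x, s₂ = l + x := ⟨s₂ - l, by omega⟩
      rw [Nat.add_sub_cancel_left]
      module
    have e2 : ∀ l : ℕ, z (i + 1) + s₂ • (b - a) + (s₂ + l) • (a - b) =
        z (i + 1) + l • (a - b) := by
      intro l
      module
    have e3 : s₁ + s₂ + 1 - 1 = s₂ + s₁ := by omega
    have hfL : ∀ s : ℕ, f (z (i + 1) + s • (b - a)) = f (z (i + 1)) := by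
      intro s
      induction s with
      | zero => simp
      | succ s ihs =>
        rw [show z (i + 1) + (s + 1) • (b - a) = z (i + 1) + s • (b - a) + b + -a by module,
          fneg fa, fb, ihs]
        ring
    refine ⟨z (i + 1) + s₂ • (b - a), s₁ + s₂ + 1, by omega, ?_, q3, ?_, ?_, ?_, ⟨q5, q4⟩, ?_⟩
    · rw [hfL]
      exact h1 ▸ hL
    · rw [e3, e2]
      exact p3
    · intro l hl
      rcases Nat.lt_or_ge l s₂ with h | h
      · obtain ⟨g1, g2⟩ := q1 (s₂ - (l + 1)) (by omega)
        rw [e1 l h.le, e1 (l + 1) h]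
        rw [show s₂ - (l + 1) + 1 = s₂ - l by omega] at g2
        exact ⟨g2, g1⟩
      · obtain ⟨x, rfl⟩ : ∃ x, l = s₂ + x := ⟨l - s₂, by omega⟩
        rw [add_assoc s₂ x 1, e2, e2]
        exact p1 x (by omega)
    · intro l hl
      rcases Nat.lt_or_ge l s₂ with h | h
      · rw [e1 l h.le]
        exact q2 _ (by omega)
      · obtain ⟨x, rfl⟩ : ∃ x, l = s₂ + x := ⟨l - s₂, by omega⟩
        rw [e2]
        exact p2 x (by omega)
    · rw [e3, e2]
      exact ⟨p4, p5⟩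
  obtain ⟨a, ha, h2, -⟩ := T.step i (by omega)
  obtain ⟨t, ht, h3, -⟩ := T.step (i + 1) (by omega)
  have hne : z (i + 2) ≠ z i := fun h => by
    have := T.inj _ (by omega) _ (by omega) h
    omega
  have h4 := hmax' i (by omega)
  have h5 := hmax' (i + 2) (by omega)
  have h6 : a = w ∨ a = u := by
    rcases ha.cases_of_isFrame T.frame with rfl | rfl | rfl | rfl
    · exact Or.inl rfl
    · rw [h2, fneg fw] at h4
      omega
    · exact Or.inr rfl
    · rw [h2, fneg fu] at h4
      omega
  have h7 : t = -w ∨ t = -u := by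
    rcases ht.cases_of_isFrame T.frame with rfl | rfl | rfl | rfl
    · rw [h3, fw] at h5
      omega
    · exact Or.inl rfl
    · rw [h3, fu] at h5
      omega
    · exact Or.inr rfl
  rcases h6 with rfl | rfl <;> rcases h7 with rfl | rfl
  · rw [h3, h2, add_neg_cancel_right] at hne
    exact absurd rfl hne
  · exact ⟨_, _, Or.inl ⟨rfl, rfl⟩, main (Or.inl ⟨rfl, rfl⟩) h2 h3⟩
  · exact ⟨_, _, Or.inr ⟨rfl, rfl⟩, main (Or.inr ⟨rfl, rfl⟩) h2 h3⟩
  · rw [h3, h2, add_neg_cancel_right] at hne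
    exact absurd rfl hne

end IsTight

/-- A chain of boxes along a staircase, with the two ends enclosed on three sides, is a turn. -/
lemma isTurnOf_of_stairs {S : Set Box} {a b : ℤ × ℤ} (hf : IsFrame a b) {d : ℕ} (hd : 2 ≤ d)
    {c : Vtx} {L : Box} (hL : L = boxAt c a b + -b) (h1 : Wall H L (-a))
    (h2 : Wall H (L + (d - 1 : ℕ) • (a - b)) (-b))
    (h3 : ∀ i : ℕ, i + 1 < d →
      Wall H (L + i • (a - b)) a ∧ Wall H (L + (i + 1) • (a - b)) b)
    (h4 : ∀ i < d, L + i • (a - b) ∈ S) : IsTurnOf (inducedEdges H S) c a b d := by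
  have hbox : ∀ i : ℕ, L + i • (a - b) = boxAt c a b + (i : ℤ) • a + (-(i : ℤ) - 1) • b := by
    intro i
    rw [hL]
    module
  have hmem : ∀ (i : ℕ) (t : ℤ × ℤ), i < d → IsUnitVec t → Wall H (L + i • (a - b)) t →
      side (L + i • (a - b)) t ∈ inducedEdges H S := fun i t hi ht hw =>
    ⟨⟨_, h4 i hi, mem_boxEdges.2 ⟨t, ht, rfl⟩⟩, hw⟩
  refine ⟨hf, hd, ?_⟩
  rintro e ((rfl | rfl) | ⟨i, hi, rfl | rfl⟩)
  · have h := hmem 0 (-a) (by omega) hf.left.neg (by simpa using h1)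
    rw [hbox, side_left_eq hf] at h
    simpa using h
  · have h := hmem (d - 1) (-b) (by omega) hf.right.neg h2
    rw [hbox, side_down_eq hf] at h
    convert h using 4 <;> push_cast [show 1 ≤ d by omega] <;> ring
  · have h := hmem i a (by omega) hf.left (h3 i hi).1
    rw [← side_neg hf.left, hbox,
      show boxAt c a b + (i : ℤ) • a + (-(i : ℤ) - 1) • b + a =
        boxAt c a b + ((i : ℤ) + 1) • a + (-(i : ℤ) - 1) • b by module, side_left_eq hf,
      Sym2.eq_swap] at h
    convert h using 4 <;> ring
  · have h := hmem (i + 1) b hi hf.right (h3 i hi).2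
    rw [← side_neg hf.right, hbox,
      show boxAt c a b + ((i + 1 : ℕ) : ℤ) • a + (-((i + 1 : ℕ) : ℤ) - 1) • b + b =
        boxAt c a b + ((i : ℤ) + 1) • a + (-((i : ℤ) + 1)) • b by push_cast; module,
      side_down_eq hf] at h
    rwa [show (i : ℤ) + 1 + 1 = i + 2 by ring] at h

end Turn

/-! ### The sector of the turn and the stack -/

section Sector

variable {m n : ℕ} {H : EdgeSet} {w u p q : ℤ × ℤ} {j : ℕ}

lemma nbhd_eq_region {X Y : Box} (P : (boxGraph m n H).Walk X Y) :
    nbhd P = region m n H P.length P.getVert := by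
  ext x
  simp only [nbhd, region, Set.mem_ofPred_eq, Walk.mem_support_iff_exists_getVert]
  constructor
  · rintro (⟨i, rfl, hi⟩ | ⟨_, ⟨i, rfl, hi⟩, h⟩)
    · exact ⟨i, hi, Or.inl rfl⟩
    · exact ⟨i, hi, Or.inr h⟩
  · rintro ⟨i, hi, rfl | h⟩
    · exact Or.inl ⟨i, rfl, hi⟩
    · exact Or.inr ⟨_, ⟨i, rfl, hi⟩, h⟩

/-- The height of a lattice point in the direction `w + u`. -/
def level (w u v : ℤ × ℤ) : ℤ := dot w v + dot u v

lemma level_add (w u v v' : ℤ × ℤ) : level w u (v + v') = level w u v + level w u v' := by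
  simp only [level, dot, Prod.fst_add, Prod.snd_add]
  ring

lemma level_comm (w u v : ℤ × ℤ) : level w u v = level u w v := add_comm _ _

lemma level_left (hf : IsFrame w u) : level w u w = 1 := by
  rcases isFrame_cases hf with ⟨rfl, rfl⟩ | ⟨rfl, rfl⟩ | ⟨rfl, rfl⟩ | ⟨rfl, rfl⟩ | ⟨rfl, rfl⟩ |
    ⟨rfl, rfl⟩ | ⟨rfl, rfl⟩ | ⟨rfl, rfl⟩ <;> simp [level, dot]

lemma level_right (hf : IsFrame w u) : level w u u = 1 := by
  rw [level_comm, level_left hf.symm]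

lemma level_pt (hf : IsFrame w u) (p : ℤ × ℤ) (x y : ℤ) :
    level w u (pt p w u x y) = level w u p + x + y := by
  have h : ∀ (x : ℤ) (v : ℤ × ℤ), level w u (x • v) = x * level w u v := by
    intro x v
    simp only [level, dot, Prod.smul_fst, Prod.smul_snd, smul_eq_mul]
    ring
  rw [pt, level_add, level_add, h, h, level_left hf, level_right hf]
  ring

lemma boxAt_eq_add (p w u : ℤ × ℤ) : boxAt p w u = p + boxAt 0 w u := by
  obtain ⟨x, y⟩ := p
  simp only [boxAt, Prod.ext_iff, Prod.fst_add, Prod.snd_add, Prod.fst_zero, Prod.snd_zero]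
  omega

lemma corner_eq_pt_one (hf : IsFrame w u) (p : ℤ × ℤ) :
    corner (boxAt p w u + (2 : ℤ) • u + w) u (-w) = pt p w u 1 3 := by
  obtain ⟨x, y⟩ := p
  rcases isFrame_cases hf with ⟨rfl, rfl⟩ | ⟨rfl, rfl⟩ | ⟨rfl, rfl⟩ | ⟨rfl, rfl⟩ | ⟨rfl, rfl⟩ |
    ⟨rfl, rfl⟩ | ⟨rfl, rfl⟩ | ⟨rfl, rfl⟩ <;> simp [corner, boxAt, pt] <;> omega

lemma corner_eq_pt_zero (hf : IsFrame w u) (p : ℤ × ℤ) :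
    corner (boxAt p w u + (2 : ℤ) • u + -w) u w = pt p w u 0 3 := by
  obtain ⟨x, y⟩ := p
  rcases isFrame_cases hf with ⟨rfl, rfl⟩ | ⟨rfl, rfl⟩ | ⟨rfl, rfl⟩ | ⟨rfl, rfl⟩ | ⟨rfl, rfl⟩ |
    ⟨rfl, rfl⟩ | ⟨rfl, rfl⟩ | ⟨rfl, rfl⟩ <;> simp [corner, boxAt, pt] <;> omega

lemma level_le_of_mem_stackVerts (hf : IsFrame w u) (hp : p = q + (2 * ((j : ℤ) - 1)) • u)
    {v : Vtx} (hv : v ∈ stackVerts q w u j) : level w u v ≤ level w u p + 2 := by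
  obtain ⟨e, ⟨i, hi, he⟩, hv⟩ := hv
  have key : ∀ x y : ℤ, x + y ≤ 2 →
      level w u (pt (q + (2 * (i : ℤ)) • u) w u x y) ≤ level w u p + 2 := by
    intro x y hxy
    have h1 : level w u p = level w u q + 2 * ((j : ℤ) - 1) := by
      have := level_pt hf q 0 (2 * ((j : ℤ) - 1))
      rwa [pt, zero_smul, add_zero, ← hp, add_zero] at this
    rw [pt_pt, level_pt hf, h1]
    omega
  simp only [a0Edges, leafEdges, Set.mem_union, Set.mem_insert_iff, Set.mem_singleton_iff] at he
  rcases he with (rfl | rfl) | rfl | rfl | rfl <;> rcases Sym2.mem_iff.1 hv with rfl | rfl <;>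
    exact key _ _ (by norm_num)

lemma le_level_of_mem_sectorVerts {a b c : ℤ × ℤ} (hab : IsFrame a b) {d : ℕ} {v : Vtx}
    (hv : v ∈ sectorVerts m n c a b d) : level a b c ≤ level a b v := by
  obtain ⟨-, x, y, rfl, -, -, h⟩ := hv
  rw [level_pt hab]
  omega

lemma inducedEdges_subset_shadowEdges (S : Set Box) : inducedEdges H S ⊆ shadowEdges H S :=
  Set.subset_union_left

/-- The fat path has an admissible turn whose sector lies above the stack. -/
lemma IsTight.exists_turn {M : Box} {r : ℕ} {z : ℕ → Box} (T : IsTight m n H w u M r z)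
    (hM : M = boxAt p w u + (2 : ℤ) • u) (hp : p = q + (2 * ((j : ℤ) - 1)) • u) :
    ∃ (c a b : ℤ × ℤ) (d : ℕ), IsTurnOf (inducedEdges H (region m n H r z)) c a b d ∧
      IsAdmissible (region m n H r z) (z 0) (z r) c a b d ∧
      Disjoint (sectorVerts m n c a b d) (stackVerts q w u j) := by
  have hf := T.frame
  obtain ⟨a, b, hab, L, d, hd, hL, h1, h2, h3, h4, h5, h6⟩ := T.exists_chain (f := level w u)
    (fun B => by rw [level_add, level_left hf]) (fun B => by rw [level_add, level_right hf])
  have hfab : IsFrame a b := by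
    rcases hab with ⟨rfl, rfl⟩ | ⟨rfl, rfl⟩
    exacts [hf, hf.symm]
  have hlev : ∀ v, level a b v = level w u v := by
    intro v
    rcases hab with ⟨rfl, rfl⟩ | ⟨rfl, rfl⟩
    exacts [rfl, level_comm _ _ _]
  have hbox : ∀ v, boxAt v a b = v + boxAt 0 w u := by
    intro v
    rcases hab with ⟨rfl, rfl⟩ | ⟨rfl, rfl⟩
    · exact boxAt_eq_add _ _ _
    · rw [boxAt_symm]
      exact boxAt_eq_add _ _ _
  have hc : L = boxAt (L - boxAt 0 w u + b) a b + -b := by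
    rw [hbox]
    abel
  refine ⟨L - boxAt 0 w u + b, a, b, d, isTurnOf_of_stairs hfab hd hc h1 h2 h3 h4, ?_, ?_⟩
  · have e1 : turnLeaf₁ (L - boxAt 0 w u + b) a b = L := by
      rw [turnLeaf₁, boxAt_pt hfab, hbox]
      module
    have e2 : turnLeaf₂ (L - boxAt 0 w u + b) a b d = L + (d - 1 : ℕ) • (a - b) := by
      obtain ⟨x, rfl⟩ : ∃ x, d = x + 1 := ⟨d - 1, by omega⟩
      rw [turnLeaf₂, boxAt_pt hfab, hbox, Nat.add_sub_cancel]
      push_cast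
      module
    rintro K (rfl | rfl)
    · rw [e1]
      have := h4 0 (by omega)
      rw [zero_smul, add_zero] at this
      exact ⟨this, h5⟩
    · rw [e2]
      exact ⟨h4 _ (by omega), h6⟩
  · rw [Set.disjoint_left]
    intro v hv hv'
    have g1 := le_level_of_mem_sectorVerts hfab hv
    have g2 := level_le_of_mem_stackVerts hf hp hv'
    have g3 : level w u M = level w u p + level w u (boxAt 0 w u) + 2 := by
      have := level_pt hf (p + boxAt 0 w u) 0 2
      rw [pt, zero_smul, add_zero, ← boxAt_eq_add, ← hM] at this
      rw [this, boxAt_eq_add, level_add]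
      ring
    have g4 : level w u L = level w u (L - boxAt 0 w u) + level w u (boxAt 0 w u) := by
      rw [← level_add, sub_add_cancel]
    have g5 : level w u b = 1 := by rw [← hlev, level_right hfab]
    rw [hlev, hlev, level_add, g5] at g1
    omega

end Sector

end FatPath

theorem lemma4p8 (m n : ℕ) (hm : 5 ≤ m) (hn : 5 ≤ n) (H : FatPath.EdgeSet)
    (hH : FatPath.IsGridHamCycle m n H)
    (hlarge : ∃! J : Set FatPath.Box, FatPath.IsLargeCookie m n H J)
    (w u q p : ℤ × ℤ) (hframe : FatPath.IsFrame w u)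
    (hC : FatPath.IsOutermost m n H w u (FatPath.boxAt q w u))
    (j : ℕ) (hj : 1 ≤ j) (hstack : FatPath.stackEdges q w u j ⊆ H)
    (hp : p = q + (2 * ((j : ℤ) - 1)) • u)
    (P : (FatPath.boxGraph m n H).Walk (FatPath.endBoxX p w u) (FatPath.endBoxY p w u))
    (hP : FatPath.IsLoopingFatPath m n H p w u P) :
    -- the shadow is a cycle through all of its vertices
    FatPath.IsHamCycle (FatPath.vertsOf (FatPath.nbhd P))
      (FatPath.shadowEdges H (FatPath.nbhd P)) ∧
    -- its pairs of consecutive collinear edges are exactly the two legs of the `A₁`-type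
    (∀ v t : ℤ × ℤ, FatPath.IsUnitVec t →
      ((s(v - t, v) ∈ FatPath.shadowEdges H (FatPath.nbhd P) ∧
          s(v, v + t) ∈ FatPath.shadowEdges H (FatPath.nbhd P)) ↔
        ((v = FatPath.pt p w u 0 3 ∨ v = FatPath.pt p w u 1 3) ∧ (t = u ∨ t = -u)))) ∧
    -- the shadow has an admissible turn
    (∃ (c a b : ℤ × ℤ) (d : ℕ),
      FatPath.IsTurnOf (FatPath.shadowEdges H (FatPath.nbhd P)) c a b d ∧
      FatPath.IsAdmissible (FatPath.nbhd P) (FatPath.endBoxX p w u) (FatPath.endBoxY p w u)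
        c a b d) ∧
    -- the fat path has an admissible turn whose sector is disjoint from the stack
    (∃ (c a b : ℤ × ℤ) (d : ℕ),
      FatPath.IsTurnOf (FatPath.inducedEdges H (FatPath.nbhd P)) c a b d ∧
      FatPath.IsAdmissible (FatPath.nbhd P) (FatPath.endBoxX p w u) (FatPath.endBoxY p w u)
        c a b d ∧
      Disjoint (FatPath.sectorVerts m n c a b d) (FatPath.stackVerts q w u j)) := by
  have S := FatPath.isStack_of_anchored hH hframe hC.1.1 hj hstack hp hP.follows
  have L := S.isLoop hp P hP.isPath hP.noWeakening
  have T : FatPath.IsTight m n H w u (FatPath.boxAt q w u + (2 * (j : ℤ)) • u) P.length P.getVert :=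
    ⟨L, fun k e h1 h2 he h => L.not_wall_of_wall hm hn
      (fun hI e he => S.far (S.two_le hj hC.1.1 hI) rfl he) h1 h2 he h⟩
  have hM : FatPath.boxAt q w u + (2 * (j : ℤ)) • u = FatPath.boxAt p w u + (2 : ℤ) • u := by
    rw [FatPath.boxAt_eq_add q, FatPath.boxAt_eq_add p, hp]
    module
  have hturn := T.exists_turn hM hp
  have hX : P.getVert 0 = FatPath.endBoxX p w u := P.getVert_zero
  have hY : P.getVert P.length = FatPath.endBoxY p w u := P.getVert_length
  rw [hX, hY] at hturn
  rw [FatPath.nbhd_eq_region]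
  refine ⟨T.grown_region.isHamCycle_shadowEdges hH T.region_subset ⟨_, 0, by omega, Or.inl rfl⟩,
    fun v t ht => ?_, ?_, hturn⟩
  · rw [T.collinear_iff ht, hM, FatPath.corner_eq_pt_one hframe, FatPath.corner_eq_pt_zero hframe,
      or_comm (a := v = FatPath.pt p w u 1 3)]
  · obtain ⟨c, a, b, d, ⟨h1, h2, h3⟩, h4, -⟩ := hturn
    exact ⟨c, a, b, d, ⟨h1, h2, h3.trans (FatPath.inducedEdges_subset_shadowEdges _)⟩, h4⟩
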